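/- **Setting.** Let $\mathfrak{osp}(1|2)$ be the complex Lie superalgebra with even basis vectors $x_{\pm2\alpha},h$ and odd basis vectors $x_{\pm\alpha}$ and superbrackets $[h,x_{\pm k\alpha}]=\mp k\,x_{\pm k\alpha}$, $[x_{-k\alpha},x_{k\alpha}]=h$ ($k=1,2$), $[x_{\pm\alpha},x_{\pm\alpha}]=\mp2x_{\pm2\alpha}$, $[x_{\pm\alpha},x_{\mp2\alpha}]=x_{\mp\alpha}$, $[x_{\pm2\alpha},x_{\pm\alpha}]=0$. In $\mathfrak G=\mathfrak{osp}(1|2)\times\mathfrak{osp}(1|2)$ put $X_\beta=(x_\beta,x_\beta)$, $\tilde x_\beta=(x_\beta,-x_\beta)$, $H=(h,h)$, $\tilde h=(h,-h)$. Let $R=\mathbb C[H][(H-n)^{-1}\mid n\in\mathbb Z]$, let $U=R\otimes_{\mathbb C[H]}U(\mathfrak G)$ be the corresponding localization of the enveloping algebra, and let $I=UX_\alpha+UX_{2\alpha}$. The diagonal reduction algebra of $\mathfrak{osp}(1|2)$ is the associative superalgebra $A=N_U(I)/I$, where $N_U(I)=\{n\in U\mid In\subseteq I\}$. The map $n+I\mapsto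 n+\mathrm{II}$ is a linear isomorphism of $A$ onto $U/\mathrm{II}$, where $\mathrm{II}=I+X_{-\alpha}U+X_{-2\alpha}U$; let $\bar x_{\pm\alpha},\bar x_{\pm2\alpha},\bar h,H,(H-n)^{-1}\in A$ be the elements corresponding to the classes of $\tilde x_{\pm\alpha},\tilde x_{\pm2\alpha},\tilde h,H,(H-n)^{-1}$. Put $$C^{(1)}=2(H-1)\bar h,$$ $$C^{(2)}=\Big(4+\frac4{H-2}\Big)\bar x_{-2\alpha}\bar x_{2\alpha}-\Big(2-\frac1{H-1}\Big)\bar x_{-\alpha}\bar x_\alpha+\bar h^2+(H-1)^2,$$ $$Q^{(2)}=4\,\frac{H-1}{H-2}\,\bar x_{-2\alpha}\bar x_{2\alpha}-\Big(2(H-2)+\frac1{H-1}\Big)\bar x_{-\alpha}\bar x_\alpha-\bar h^2+(H-1)^2.$$ For $\lambda\in\mathbb C$ let $M(\lambda)=A/(A\bar x_\alpha+A\bar x_{2\alpha}+A(\bar h-\lambda))$ be the Verma module, with (even) generator $v_\lambda$. Let $\Theta$ be the (non-super) anti-automorphism of $A$ with $\Theta(\bar x_{\pm\alpha})=\bar x_{\mp\alpha}$,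 $\Theta(\bar x_{\pm2\alpha})=-\bar x_{\mp2\alpha}$, $\Theta(\bar h)=\bar h$, $\Theta(H)=H$. The Shapovalov form $\langle\cdot,\cdot\rangle_\lambda:M(\lambda)\times M(\lambda)\to R$ sends $(av_\lambda,bv_\lambda)$ to the unique $r\in R$ that is congruent to $\Theta(a)b$ modulo $\big(\bar x_{-\alpha}A+\bar x_{-2\alpha}A+(\bar h-\lambda)A\big)+\big(A\bar x_\alpha+A\bar x_{2\alpha}+A(\bar h-\lambda)\big)$. For $\mu\in\mathbb C\setminus\mathbb Z$ put $$L(\lambda,\mu)=M(\lambda)/N(\lambda,\mu),\qquad N(\lambda,\mu)=\{w\in M(\lambda)\mid\langle u,w\rangle_\lambda\in(H-1-\mu)R\text{ for all }u\in M(\lambda)\}.$$ **Theorem.** (i) For every $(\lambda,\mu)\in\mathbb C\times(\mathbb C\setminus\mathbb Z)$, $L(\lambda,\mu)$ is an irreducible $A$-module. (ii) $L(\lambda,\mu)$ is finite-dimensional over $\mathbb C$ if and only if $\lambda^2=(\mu+n)^2$ for some odd positive integer $n$; in this case $\dim L(\lambda,\mu)=n$ and $\lambda\neq0$. (iii) Every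 finite-dimensional irreducible $A$-module $V$ is odd-dimensional, and there is a unique pair $(\lambda,\mu)\in\mathbb C\times(\mathbb C\setminus\mathbb Z)$ with $\lambda^2=(\mu+\dim V)^2$ and $V\cong L(\lambda,\mu)$. The same holds for $\mathbb Z_2$-graded $A$-modules that are irreducible as graded modules, with isomorphisms that are homogeneous (even or odd). (iv) For every $(\lambda,\mu)\in\mathbb C\times(\mathbb C\setminus\mathbb Z)$, $L(\lambda,\mu)$ is a $\mathbb Z_2$-graded $A$-module with even highest weight vector, and $C^{(1)}$, $C^{(2)}$, $Q^{(2)}$ act on it by $2\lambda\mu$, $\mu^2+\lambda^2$ and $(\mu^2-\lambda^2)(-1)^{|\cdot|}$, where $(-1)^{|\cdot|}$ is the parity operator $v\mapsto(-1)^{|v|}v$ on homogeneous $v$. -/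

import Mathlib

/-! The diagonal reduction superalgebra of the orthosymplectic Lie superalgebra `osp(1|2)` over `ℂ`,
its Verma modules and their quotients `L(lam, mu)`. -/

noncomputable section

namespace Osp12

/-! ### The Lie superalgebra `osp(1|2)` -/

/-- The homogeneous basis `x_{-2α}, x_{-α}, h, x_α, x_{2α}` of `osp(1|2)`. -/
inductive Basis5 : Type
  | xm2 | xm1 | h | xp1 | xp2

/-- Parity of the basis vectors: `x_{±α}` are odd, the other ones are even. -/
def parity : Basis5 → ℕ
  | .xm1 => 1
  | .xp1 => 1
  | _ => 0

/-- The sign `(-1)^{|a||b|}`. -/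
def sgn (a b : Basis5) : ℂ := (-1) ^ (parity a * parity b)

open Basis5 in
/-- The superbracket on basis vectors. Every `[a, b]` is a multiple of a single basis vector:
`bracket a b = (k, c)` means `[a, b] = k • c`. -/
def bracket : Basis5 → Basis5 → ℂ × Basis5
  | h, xp1 => (-1, xp1)
  | xp1, h => (1, xp1)
  | h, xp2 => (-2, xp2)
  | xp2, h => (2, xp2)
  | h, xm1 => (1, xm1)
  | xm1, h => (-1, xm1)
  | h, xm2 => (2, xm2)
  | xm2, h => (-2, xm2)
  | xm1, xp1 => (1, h)
  | xp1, xm1 => (1, h)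
  | xm2, xp2 => (1, h)
  | xp2, xm2 => (-1, h)
  | xp1, xp1 => (-2, xp2)
  | xm1, xm1 => (2, xm2)
  | xp1, xm2 => (1, xm1)
  | xm2, xp1 => (-1, xm1)
  | xm1, xp2 => (1, xp1)
  | xp2, xm1 => (-1, xp1)
  | _, _ => (0, h)

/-! ### The localized enveloping algebra of `osp(1|2) × osp(1|2)` -/

/-- Generators: `x i a` is the basis vector `a` in the `i`-th factor of `osp(1|2) × osp(1|2)`,
and `hinv n` is the formal inverse of `H - n`. -/
inductive Gen : Type
  | x (i : Fin 2) (a : Basis5)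
  | hinv (n : ℤ)

/-- A generator as an element of the free algebra. -/
abbrev fg (g : Gen) : FreeAlgebra ℂ Gen := FreeAlgebra.ι ℂ g

/-- `H = (h, h)` in the free algebra. -/
def freeH : FreeAlgebra ℂ Gen := fg (.x 0 .h) + fg (.x 1 .h)

/-- Defining relations: the supercommutation relations of `osp(1|2) × osp(1|2)`, and the
invertibility of `H - n` for all integers `n`. -/
inductive Rel : FreeAlgebra ℂ Gen → FreeAlgebra ℂ Gen → Prop
  | same (i : Fin 2) (a b : Basis5) :
      Rel (fg (.x i a) * fg (.x i b))
        (sgn a b • (fg (.x i b) * fg (.x i a)) + (bracket a b).1 • fg (.x i (bracket a b).2))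
  | cross (i j : Fin 2) (hij : i ≠ j) (a b : Basis5) :
      Rel (fg (.x i a) * fg (.x j b)) (sgn a b • (fg (.x j b) * fg (.x i a)))
  | mul_hinv (n : ℤ) : Rel ((freeH - (n : FreeAlgebra ℂ Gen)) * fg (.hinv n)) 1
  | hinv_mul (n : ℤ) : Rel (fg (.hinv n) * (freeH - (n : FreeAlgebra ℂ Gen))) 1

/-- The algebra `U = R ⊗_{U(ℂH)} U(osp(1|2) × osp(1|2))`, that is, the localization of the
enveloping algebra at the elements `H - n`, `n ∈ ℤ`, where `R = ℂ[H][(H-n)⁻¹ | n ∈ ℤ]`. -/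
def U : Type := RingQuot Rel

instance : Ring U := inferInstanceAs (Ring (RingQuot Rel))
instance : Algebra ℂ U := inferInstanceAs (Algebra ℂ (RingQuot Rel))

/-- The projection from the free algebra. -/
def toU : FreeAlgebra ℂ Gen →ₐ[ℂ] U := RingQuot.mkAlgHom ℂ Rel

/-- The basis vector `a` of the `i`-th factor, in `U`. -/
def x (i : Fin 2) (a : Basis5) : U := toU (fg (.x i a))

/-- The inverse of `H - n`, in `U`. -/
def hinv (n : ℤ) : U := toU (fg (.hinv n))

/-- The diagonal elements `X_β = (x_β, x_β)`, and `H = (h, h)`. -/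
def X (a : Basis5) : U := x 0 a + x 1 a

/-- The antidiagonal elements `(x_β, -x_β)` and `(h, -h)`. -/
def xt (a : Basis5) : U := x 0 a - x 1 a

/-- The sign by which the parity automorphism acts on a generator. -/
def genSign : Gen → ℂ
  | .x _ a => (-1) ^ parity a
  | .hinv _ => 1

/-- The parity automorphism on the free algebra, followed by the projection to `U`. -/
def freeSigma : FreeAlgebra ℂ Gen →ₐ[ℂ] U :=
  FreeAlgebra.lift ℂ (fun g => genSign g • toU (fg g))

theorem toU_rel {a b : FreeAlgebra ℂ Gen} (h : Rel a b) : toU a = toU b :=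
  RingQuot.mkAlgHom_rel ℂ h

theorem freeSigma_fg (g : Gen) : freeSigma (fg g) = genSign g • toU (fg g) := by
  simp [freeSigma, fg]

theorem freeSigma_freeH : freeSigma freeH = toU freeH := by
  simp only [freeH, map_add, freeSigma_fg]
  simp [genSign, parity]

theorem freeSigma_rel ⦃a b : FreeAlgebra ℂ Gen⦄ (h : Rel a b) : freeSigma a = freeSigma b := by
  have key := toU_rel h
  cases h with
  | same i a b =>
    simp only [map_add, map_mul, map_smul, freeSigma_fg] at key ⊢
    simp only [smul_mul_smul_comm, key, smul_add, smul_smul]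
    cases a <;> cases b <;> simp [genSign, parity, bracket]
  | cross i j hij a b =>
    simp only [map_mul, map_smul, freeSigma_fg] at key ⊢
    simp only [smul_mul_smul_comm, key, smul_smul]
    congr 1
    ring
  | mul_hinv n =>
    simp only [map_sub, map_mul, map_one, map_intCast, freeSigma_fg, freeSigma_freeH] at key ⊢
    simpa [genSign] using key
  | hinv_mul n =>
    simp only [map_sub, map_mul, map_one, map_intCast, freeSigma_fg, freeSigma_freeH] at key ⊢
    simpa [genSign] using key

/-- The parity automorphism of the superalgebra `U`: it acts by `1` on even elements and by `-1`
on odd ones. -/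
def sigma : U →ₐ[ℂ] U := RingQuot.liftAlgHom ℂ ⟨freeSigma, freeSigma_rel⟩

/-! ### The diagonal reduction algebra -/

/-- The left ideal `I = U 𝔑₊` generated by `X_α` and `X_{2α}`. -/
def leftI : Ideal U := Ideal.span {X .xp1, X .xp2}

/-- The normalizer `{n | I n ⊆ I}` of the left ideal `I`: the largest subalgebra of `U` in which
`I` is a two-sided ideal. -/
def normI : Subalgebra ℂ U where
  carrier := {n | ∀ y ∈ leftI, y * n ∈ leftI}
  mul_mem' := fun {a b} ha hb y hy => by
    rw [← mul_assoc]
    exact hb _ (ha y hy)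
  add_mem' := fun {a b} ha hb y hy => by
    rw [mul_add]
    exact leftI.add_mem (ha y hy) (hb y hy)
  algebraMap_mem' := fun r y hy => by
    rw [← Algebra.commutes]
    exact leftI.mul_mem_left _ hy

/-- The left ideal `I`, regarded as an ideal of its normalizer. -/
def idealI : Ideal normI where
  carrier := {n | (n : U) ∈ leftI}
  add_mem' := fun ha hb => leftI.add_mem ha hb
  zero_mem' := leftI.zero_mem
  smul_mem' := fun c _ hy => leftI.mul_mem_left (c : U) hy

instance : idealI.IsTwoSided where
  mul_mem_of_left := fun {a} b ha => b.2 (a : U) ha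

/-- The diagonal reduction algebra `A = N_U(I) / I` of `osp(1|2)`. -/
def A : Type := normI ⧸ idealI

instance : Ring A := inferInstanceAs (Ring (normI ⧸ idealI))
instance : Algebra ℂ A := inferInstanceAs (Algebra ℂ (normI ⧸ idealI))

/-- The projection `N_U(I) → A`. -/
def toA : normI →ₐ[ℂ] A := Ideal.Quotient.mkₐ ℂ idealI

/-- The subspace `𝕀𝕀 = U 𝔑₊ + 𝔑₋ U` of `U`. -/
def doubleI : Submodule ℂ U :=
  leftI.restrictScalars ℂ ⊔ LinearMap.range (LinearMap.mulLeft ℂ (X .xm1)) ⊔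
    LinearMap.range (LinearMap.mulLeft ℂ (X .xm2))

/-- The canonical map `A = N_U(I) / I → U / 𝕀𝕀`, `n + I ↦ n + 𝕀𝕀`. It is a linear isomorphism. -/
def toDouble : A →ₗ[ℂ] U ⧸ doubleI :=
  (idealI.restrictScalars ℂ).liftQ (doubleI.mkQ ∘ₗ normI.val.toLinearMap) (fun n hn => by
    have h : (n : U) ∈ doubleI :=
      Submodule.mem_sup_left (Submodule.mem_sup_left hn)
    simpa using h)

/-- The element of `A` that corresponds to `u + 𝕀𝕀` under the isomorphism `A ≃ U / 𝕀𝕀`. -/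
def bar (u : U) : A := Function.invFun toDouble (Submodule.Quotient.mk u)

/-- The generators `x̄_{±2α}, x̄_{±α}, h̄` of `A`. -/
def xb (a : Basis5) : A := bar (xt a)

/-- The element `H` of `A`. -/
def HA : A := bar (X .h)

/-- The inverse of `H - n` in `A`. -/
def HAinv (n : ℤ) : A := bar (hinv n)

/-- The ring `R = ℂ[H][(H-n)⁻¹ | n ∈ ℤ]` of dynamical scalars, inside `A`. -/
def dynScalars : Subalgebra ℂ A := Algebra.adjoin ℂ ({HA} ∪ Set.range HAinv)

/-- The homogeneous component of `A` of parity `i`: the classes of the elements of the normalizer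
that are homogeneous of parity `i` in `U`. -/
def gradeA (i : ZMod 2) : Submodule ℂ A :=
  Submodule.map toA.toLinearMap
    { carrier := {n : normI | sigma (n : U) = ((-1 : ℂ) ^ i.val) • (n : U)}
      add_mem' := fun {a b} ha hb => by
        simp only [Set.mem_ofPred_eq] at ha hb ⊢
        simp [ha, hb]
      zero_mem' := by simp
      smul_mem' := fun c a ha => by
        simp only [Set.mem_ofPred_eq] at ha ⊢
        simp [ha, smul_comm c] }

/-! ### The elements `C⁽¹⁾`, `C⁽²⁾` and `Q⁽²⁾` -/

/-- `C⁽¹⁾ = 2 (H - 1) h̄`. -/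
def C1 : A := 2 * (HA - 1) * xb .h

/-- `C⁽²⁾ = (4 + 4/(H-2)) x̄_{-2α} x̄_{2α} - (2 - 1/(H-1)) x̄_{-α} x̄_α + h̄² + (H-1)²`. -/
def C2 : A :=
  (4 + 4 * HAinv 2) * xb .xm2 * xb .xp2 - (2 - HAinv 1) * xb .xm1 * xb .xp1
    + xb .h * xb .h + (HA - 1) ^ 2

/-- `Q⁽²⁾ = 4 (H-1)/(H-2) x̄_{-2α} x̄_{2α} - (2(H-2) + 1/(H-1)) x̄_{-α} x̄_α - h̄² + (H-1)²`. -/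
def Q2 : A :=
  4 * ((HA - 1) * HAinv 2) * xb .xm2 * xb .xp2
    - (2 * (HA - 2) + HAinv 1) * xb .xm1 * xb .xp1
    - xb .h * xb .h + (HA - 1) ^ 2

/-! ### Verma modules and the quotients `L(lam, mu)` -/

/-- The left ideal `A x̄_α + A x̄_{2α} + A (h̄ - lam)`. -/
def vermaIdeal (lam : ℂ) : Ideal A :=
  Ideal.span {xb .xp1, xb .xp2, xb .h - algebraMap ℂ A lam}

/-- The Verma module `M(lam)`: the `A`-module generated by a vector `v` subject to
`x̄_α v = x̄_{2α} v = 0` and `h̄ v = lam v`. -/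
def Verma (lam : ℂ) : Type := A ⧸ vermaIdeal lam

instance (lam : ℂ) : AddCommGroup (Verma lam) := inferInstanceAs (AddCommGroup (A ⧸ vermaIdeal lam))
instance (lam : ℂ) : Module A (Verma lam) := inferInstanceAs (Module A (A ⧸ vermaIdeal lam))
instance (lam : ℂ) : Module ℂ (Verma lam) := inferInstanceAs (Module ℂ (A ⧸ vermaIdeal lam))
instance (lam : ℂ) : IsScalarTower ℂ A (Verma lam) :=
  inferInstanceAs (IsScalarTower ℂ A (A ⧸ vermaIdeal lam))

/-- The projection `A → M(lam)`, `a ↦ a v`. -/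
def toVerma (lam : ℂ) : A →ₗ[A] Verma lam := (vermaIdeal lam).mkQ

/-- The right ideal `x̄_{-α} A + x̄_{-2α} A + (h̄ - lam) A`; the quotient of `A` by it is the
opposite Verma module, a right `A`-module. -/
def oppVermaIdeal (lam : ℂ) : Submodule ℂ A :=
  LinearMap.range (LinearMap.mulLeft ℂ (xb .xm1)) ⊔
    LinearMap.range (LinearMap.mulLeft ℂ (xb .xm2)) ⊔
    LinearMap.range (LinearMap.mulLeft ℂ (xb .h - algebraMap ℂ A lam))

/-- The tensor product over `A` of the opposite Verma module with the Verma module. It is a copy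
of `R`: every class has exactly one representative in `R`. -/
def ShapTarget (lam : ℂ) : Type :=
  A ⧸ (oppVermaIdeal lam ⊔ (vermaIdeal lam).restrictScalars ℂ)

instance (lam : ℂ) : AddCommGroup (ShapTarget lam) :=
  inferInstanceAs (AddCommGroup (A ⧸ (oppVermaIdeal lam ⊔ (vermaIdeal lam).restrictScalars ℂ)))
instance (lam : ℂ) : Module ℂ (ShapTarget lam) :=
  inferInstanceAs (Module ℂ (A ⧸ (oppVermaIdeal lam ⊔ (vermaIdeal lam).restrictScalars ℂ)))

/-- The projection `A → ShapTarget lam`, `a ↦ [a]`. -/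
def toShapTarget (lam : ℂ) : A →ₗ[ℂ] ShapTarget lam :=
  (oppVermaIdeal lam ⊔ (vermaIdeal lam).restrictScalars ℂ).mkQ

/-- The map `M(lam) → R`, `a v ↦ [a]`, given by pairing with the generator of the opposite Verma
module. The Shapovalov form is `⟨b v, w⟩ = shap (Θ(b) w)`, where `Θ` is the anti-automorphism of
`A` with `Θ(x̄_{±α}) = x̄_{∓α}`, `Θ(x̄_{±2α}) = - x̄_{∓2α}`, `Θ(h̄) = h̄` and `Θ(H) = H`. -/
def shap (lam : ℂ) : Verma lam →ₗ[ℂ] ShapTarget lam :=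
  ((vermaIdeal lam).restrictScalars ℂ).liftQ (toShapTarget lam)
    (fun _ ha => (Submodule.Quotient.mk_eq_zero _).2 (Submodule.mem_sup_right ha))

/-- The ideal `(H - 1 - mu)` of `R`, in the target of the Shapovalov form. -/
def evalIdeal (lam mu : ℂ) : Submodule ℂ (ShapTarget lam) :=
  Submodule.map (toShapTarget lam)
    (Submodule.map (LinearMap.mulLeft ℂ (HA - 1 - algebraMap ℂ A mu))
      (Subalgebra.toSubmodule dynScalars))

/-- `N(lam, mu) = {w ∈ M(lam) | ⟨u, w⟩ ∈ (H - 1 - mu) for all u ∈ M(lam)}`, where `⟨·,·⟩` is the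
Shapovalov form. As `Θ` is a bijection of `A`, the elements `Θ(b)` with `b ∈ A` are
all the elements of `A`. -/
def shapKer (lam mu : ℂ) : Submodule A (Verma lam) where
  carrier := {w | ∀ b : A, shap lam (b • w) ∈ evalIdeal lam mu}
  add_mem' := fun {w w'} hw hw' b => by
    rw [smul_add, map_add]
    exact Submodule.add_mem _ (hw b) (hw' b)
  zero_mem' := fun b => by simp
  smul_mem' := fun c w hw b => by
    rw [smul_smul]
    exact hw (b * c)

/-- `L(lam, mu) = M(lam) / N(lam, mu)`. -/
def L (lam mu : ℂ) : Type := Verma lam ⧸ shapKer lam mu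

instance (lam mu : ℂ) : AddCommGroup (L lam mu) :=
  inferInstanceAs (AddCommGroup (Verma lam ⧸ shapKer lam mu))
instance (lam mu : ℂ) : Module A (L lam mu) :=
  inferInstanceAs (Module A (Verma lam ⧸ shapKer lam mu))
instance (lam mu : ℂ) : Module ℂ (L lam mu) :=
  inferInstanceAs (Module ℂ (Verma lam ⧸ shapKer lam mu))
instance (lam mu : ℂ) : IsScalarTower ℂ A (L lam mu) :=
  inferInstanceAs (IsScalarTower ℂ A (Verma lam ⧸ shapKer lam mu))

/-- The projection `M(lam) → L(lam, mu)`. -/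
def toL (lam mu : ℂ) : Verma lam →ₗ[A] L lam mu := (shapKer lam mu).mkQ

/-- The homogeneous component of `L(lam, mu)` of parity `i`; the highest weight vector is even. -/
def gradeL (lam mu : ℂ) (i : ZMod 2) : Submodule ℂ (L lam mu) :=
  Submodule.map ((toL lam mu ∘ₗ toVerma lam).restrictScalars ℂ) (gradeA i)

/-! ### Supermodules -/

/-- The family `V_i` makes the `A`-module `V` a supermodule: `V` is the direct sum of its even and
its odd part, and `A_i V_j ⊆ V_{i+j}`. -/
structure IsSupermodule {V : Type*} [AddCommGroup V] [Module ℂ V] [Module A V]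
    (gr : ZMod 2 → Submodule ℂ V) : Prop where
  internal : DirectSum.IsInternal gr
  smul_mem : ∀ i j : ZMod 2, ∀ a ∈ gradeA i, ∀ v ∈ gr j, a • v ∈ gr (i + j)

/-- `V` is irreducible as a supermodule: it is nonzero, and its only submodules that are spanned by
homogeneous elements are `0` and `V`. -/
def IsSuperIrreducible {V : Type*} [AddCommGroup V] [Module ℂ V] [Module A V]
    (gr : ZMod 2 → Submodule ℂ V) : Prop :=
  IsSupermodule gr ∧ Nontrivial V ∧
    ∀ W : Submodule A V,
      (∀ w ∈ W, ∃ w₀ ∈ W, ∃ w₁ ∈ W, w₀ ∈ gr 0 ∧ w₁ ∈ gr 1 ∧ w = w₀ + w₁) → W = ⊥ ∨ W = ⊤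

end Osp12

end

/-! Reduction to singular vectors. `A` is the space of vectors of `U/I` killed by `X_α`. In any
`U`-module on which `X_α` is locally nilpotent, `X_α^k X_{-α}^k` acts on singular vectors through a
product of nonzero integers and elements `H + m`, all invertible in the localization. Hence the
module is the direct sum of its singular vectors and the image of `X_{-α}`. For `U/I` this is the
isomorphism of `A` with `U/II`. In other modules it allows an element `u` of `U` to be replaced by
`bar u` whenever `u` yields a singular vector.

The form as a functional. Ordering `A` as `R` plus lowering terms on the left plus the Verma ideal
on the right (`orderedA_eq_top`) shows that the Shapovalov form modulo `H - 1 - mu` is governed by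
any functional `χ` with the properties in `IsHighestWeightFunctional`: the kernel of `A → L(lam,
mu)` consists of the `a` with `χ (b * a) = 0` for all `b`. No uniqueness statement about ordered
expressions is needed.

The model. Such a `χ` is the leading coefficient of `a δ`, where `δ` is the highest weight vector in
the tensor product of two (completed) dual Verma modules of `osp(1|2)` of highest weights `(mu + 1 ±
lam)/2`. Raising operators there are shifts, so `a δ = 0` exactly when `χ (A a) = 0`, and `L(lam,
mu)` is identified with `A δ` (`toLA_eq_zero_iff`). This is the space of singular vectors in the
product of the two simple submodules: one in each degree `k` that both factors reach. A factor is
finite-dimensional only for highest weight `-m`, with dimension `2m + 1`. The two weights add up to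
the non-integer `mu + 1`, so at most one factor is finite-dimensional, and the condition reads `lam²
= (mu + 2m + 1)²`. Any nonzero vector of the product can be raised to `δ`, which gives
irreducibility.

Classification. On a finite-dimensional module an eigenvalue of `H` with minimal real part supplies
a highest weight vector `v`. The coefficient of `v` induces a functional of the same kind, so a
module on which it is nondegenerate is some `L(lam, mu)`. In the graded case `v` is chosen
homogeneous, and the radical is graded because these functionals are even.

Ghost center. The Scasimirs of the two factors anticommute with the odd generators of their own
factor and commute with the other factor. `C1` and `C2` come from their squares, `Q2` from their
product, and the scalars are read off on the generator. -/

noncomputable section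

namespace Osp12

/-! ### Commutation relations in `U` -/

/-- The raising operator `x_α` of the `i`-th factor. -/
def E (i : Fin 2) : U := x i .xp1

/-- The lowering operator `x_{-α}` of the `i`-th factor. -/
def F (i : Fin 2) : U := x i .xm1

/-- The Cartan element of the `i`-th factor. -/
def h (i : Fin 2) : U := x i .h

theorem x_mul_x_same (i : Fin 2) (a b : Basis5) :
    x i a * x i b = sgn a b • (x i b * x i a) + (bracket a b).1 • x i (bracket a b).2 := by
  simpa only [x, map_mul, map_add, map_smul] using toU_rel (Rel.same i a b)

theorem x_mul_x_cross {i j : Fin 2} (hij : i ≠ j) (a b : Basis5) :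
    x i a * x j b = sgn a b • (x j b * x i a) := by
  simpa only [x, map_mul, map_add, map_smul] using toU_rel (Rel.cross i j hij a b)

theorem X_h : X .h = h 0 + h 1 := rfl
theorem X_xp1 : X .xp1 = E 0 + E 1 := rfl
theorem X_xm1 : X .xm1 = F 0 + F 1 := rfl
theorem xt_h : xt .h = h 0 - h 1 := rfl
theorem xt_xp1 : xt .xp1 = E 0 - E 1 := rfl
theorem xt_xm1 : xt .xm1 = F 0 - F 1 := rfl

theorem sub_mul_hinv (n : ℤ) : (X .h - (n : U)) * hinv n = 1 := by
  have := toU_rel (Rel.mul_hinv n)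
  simp only [map_mul, map_sub, map_one, map_intCast, freeH, map_add] at this
  exact this

theorem hinv_mul_sub (n : ℤ) : hinv n * (X .h - (n : U)) = 1 := by
  have := toU_rel (Rel.hinv_mul n)
  simp only [map_mul, map_sub, map_one, map_intCast, freeH, map_add] at this
  exact this

/-- The bracket of an odd vector with itself is twice its square. Together with `x_xm2` this leaves
only `E`, `F`, `h` and the inverses as generators of `U`. -/
theorem x_xp2 (i : Fin 2) : x i .xp2 = -(E i * E i) := by
  have := x_mul_x_same i .xp1 .xp1
  simp only [sgn, parity, bracket] at this
  change E i * E i = (-1 : ℂ) ^ (1 * 1) • (E i * E i) + (-2 : ℂ) • x i .xp2 at this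
  have h2 : (2 : ℂ) • x i .xp2 = (2 : ℂ) • (-(E i * E i)) := by
    linear_combination (norm := module) this
  exact smul_right_injective U (two_ne_zero) h2

theorem x_xm2 (i : Fin 2) : x i .xm2 = F i * F i := by
  have := x_mul_x_same i .xm1 .xm1
  simp only [sgn, parity, bracket] at this
  change F i * F i = (-1 : ℂ) ^ (1 * 1) • (F i * F i) + (2 : ℂ) • x i .xm2 at this
  have h2 : (2 : ℂ) • x i .xm2 = (2 : ℂ) • (F i * F i) := by
    linear_combination (norm := module) -this
  exact smul_right_injective U (two_ne_zero) h2

theorem E_mul_F (i : Fin 2) : E i * F i = h i - F i * E i := by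
  have := x_mul_x_same i .xp1 .xm1
  simp only [sgn, parity, bracket] at this
  simp only [E, F, h, this]
  simp; abel

theorem E_mul_h (i : Fin 2) : E i * h i = h i * E i + E i := by
  have := x_mul_x_same i .xp1 .h
  simp only [sgn, parity, bracket] at this
  simp only [E, h, this]
  simp

theorem h_mul_F (i : Fin 2) : h i * F i = F i * h i + F i := by
  have := x_mul_x_same i .h .xm1
  simp only [sgn, parity, bracket] at this
  simp only [F, h, this]
  simp

theorem E_one_mul_E_zero : E 1 * E 0 = -(E 0 * E 1) := by
  have := x_mul_x_cross (i := 1) (j := 0) (by decide) .xp1 .xp1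
  simpa [sgn, parity, E] using this

theorem F_one_mul_F_zero : F 1 * F 0 = -(F 0 * F 1) := by
  have := x_mul_x_cross (i := 1) (j := 0) (by decide) .xm1 .xm1
  simpa [sgn, parity, F] using this

theorem E_one_mul_F_zero : E 1 * F 0 = -(F 0 * E 1) := by
  have := x_mul_x_cross (i := 1) (j := 0) (by decide) .xp1 .xm1
  simpa [sgn, parity, F, E] using this

theorem E_zero_mul_F_one : E 0 * F 1 = -(F 1 * E 0) := by
  have := x_mul_x_cross (i := 0) (j := 1) (by decide) .xp1 .xm1
  simpa [sgn, parity, F, E] using this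

theorem E_zero_mul_h_one : E 0 * h 1 = h 1 * E 0 := by
  have := x_mul_x_cross (i := 0) (j := 1) (by decide) .xp1 .h
  simpa [sgn, parity, h, E] using this

theorem E_one_mul_h_zero : E 1 * h 0 = h 0 * E 1 := by
  have := x_mul_x_cross (i := 1) (j := 0) (by decide) .xp1 .h
  simpa [sgn, parity, h, E] using this

theorem h_one_mul_F_zero : h 1 * F 0 = F 0 * h 1 := by
  have := x_mul_x_cross (i := 1) (j := 0) (by decide) .h .xm1
  simpa [sgn, parity, h, F] using this

theorem h_zero_mul_F_one : h 0 * F 1 = F 1 * h 0 := by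
  have := x_mul_x_cross (i := 0) (j := 1) (by decide) .h .xm1
  simpa [sgn, parity, h, F] using this

theorem h_one_mul_h_zero : h 1 * h 0 = h 0 * h 1 := by
  have := x_mul_x_cross (i := 1) (j := 0) (by decide) .h .h
  simpa [sgn, parity, h] using this

theorem mul_mul_of_eq {S : Type*} [Semigroup S] {a b c : S} (hab : a * b = c) (z : S) :
    a * (b * z) = c * z := by
  rw [← mul_assoc, hab]

theorem X_h_mul_F (i : Fin 2) : X .h * F i = F i * X .h + F i := by
  rw [X_h, add_mul, mul_add]
  fin_cases i
  · have h0 := h_mul_F 0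
    have h1 := h_one_mul_F_zero
    simp only [Fin.zero_eta, h0, h1]; abel
  · have h0 := h_mul_F 1
    have h1 := h_zero_mul_F_one
    simp only [Fin.mk_one, h0, h1]; abel

theorem E_mul_X_h (i : Fin 2) : E i * X .h = X .h * E i + E i := by
  rw [X_h, add_mul, mul_add]
  fin_cases i
  · have h0 := E_mul_h 0
    have h1 := E_zero_mul_h_one
    simp only [Fin.zero_eta, h0, h1]; abel
  · have h0 := E_mul_h 1
    have h1 := E_one_mul_h_zero
    simp only [Fin.mk_one, h0, h1]; abel

theorem X_h_mul_h (i : Fin 2) : X .h * h i = h i * X .h := by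
  rw [X_h, add_mul, mul_add]
  fin_cases i <;> simp [h_one_mul_h_zero]

/-- An element on which `H` acts from the left as `H + k` from the right intertwines the inverses of
`H - n`. -/
theorem hinv_mul_of_weight {u : U} {k : ℤ} (hu : X .h * u = u * (X .h + (k : U))) (n : ℤ) :
    hinv n * u = u * hinv (n - k) := by
  have h1 : (X .h - (n : U)) * u = u * (X .h - ((n - k : ℤ) : U)) := by
    have hc : (n : U) * u = u * (n : U) := (Int.cast_commute n u)
    rw [sub_mul, hu, hc, mul_add, mul_sub]
    push_cast
    rw [mul_sub]; abel
  calc hinv n * u = hinv n * (u * ((X .h - ((n - k : ℤ) : U)) * hinv (n - k))) := by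
        rw [sub_mul_hinv, mul_one]
    _ = hinv n * (X .h - (n : U)) * u * hinv (n - k) := by
        rw [← mul_assoc u, ← h1]; simp only [mul_assoc]
    _ = _ := by rw [hinv_mul_sub, one_mul]

theorem hinv_mul_F (n : ℤ) (i : Fin 2) : hinv n * F i = F i * hinv (n - 1) :=
  hinv_mul_of_weight (by rw [X_h_mul_F]; simp [mul_add]) n

theorem E_mul_hinv (n : ℤ) (i : Fin 2) : E i * hinv n = hinv (n - 1) * E i := by
  rw [hinv_mul_of_weight (k := -1) (u := E i)]
  · congr 2; ring
  · rw [mul_add, E_mul_X_h]; simp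

theorem h_mul_hinv (n : ℤ) (i : Fin 2) : h i * hinv n = hinv n * h i := by
  rw [hinv_mul_of_weight (k := 0) (u := h i)]
  · simp
  · rw [X_h_mul_h]; simp

/-- A subspace of `U` that contains `1` and is stable under left multiplication by the generators
is everything. -/
theorem U_induction (S : Submodule ℂ U) (h1 : (1 : U) ∈ S) (hE : ∀ i, ∀ u ∈ S, E i * u ∈ S)
    (hF : ∀ i, ∀ u ∈ S, F i * u ∈ S) (hh : ∀ i, ∀ u ∈ S, h i * u ∈ S)
    (hinvS : ∀ n, ∀ u ∈ S, hinv n * u ∈ S) (u : U) : u ∈ S := by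
  suffices H : ∀ a : FreeAlgebra ℂ Gen, ∀ s ∈ S, toU a * s ∈ S by
    obtain ⟨a, rfl⟩ := RingQuot.mkAlgHom_surjective ℂ Rel u
    have := H a 1 h1
    rwa [mul_one] at this
  intro a
  induction a using FreeAlgebra.induction with
  | grade0 r =>
    intro s hs
    rw [AlgHom.commutes, ← Algebra.smul_def]
    exact S.smul_mem r hs
  | grade1 g =>
    intro s hs
    cases g with
    | x i a =>
      change x i a * s ∈ S
      cases a with
      | xm2 => rw [x_xm2, mul_assoc]; exact hF i _ (hF i _ hs)
      | xm1 => exact hF i s hs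
      | h => exact hh i s hs
      | xp1 => exact hE i s hs
      | xp2 =>
        rw [x_xp2, neg_mul, mul_assoc]
        exact S.neg_mem (hE i _ (hE i _ hs))
    | hinv n => exact hinvS n s hs
  | mul a b ha hb =>
    intro s hs
    rw [map_mul, mul_assoc]
    exact ha _ (hb s hs)
  | add a b ha hb =>
    intro s hs
    rw [map_add, add_mul]
    exact S.add_mem (ha s hs) (hb s hs)

theorem X_xp2 : X .xp2 = -(X .xp1 * X .xp1) := by
  have := E_one_mul_E_zero
  rw [X_xp1, X, x_xp2, x_xp2]
  simp only [mul_add, add_mul, this]; abel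

theorem X_xm2 : X .xm2 = X .xm1 * X .xm1 := by
  have := F_one_mul_F_zero
  rw [X_xm1, X, x_xm2, x_xm2]
  simp only [mul_add, add_mul, this]; abel

theorem X_xp1_mul_X_xm1 : X .xp1 * X .xm1 = X .h - X .xm1 * X .xp1 := by
  simp only [X_xp1, X_xm1, X_h, mul_add, add_mul, E_mul_F, E_one_mul_F_zero, E_zero_mul_F_one]
  abel

theorem X_h_mul_X_xm1 : X .h * X .xm1 = X .xm1 * X .h + X .xm1 := by
  rw [X_xm1, mul_add, X_h_mul_F, X_h_mul_F, add_mul]; abel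

theorem X_xp1_mul_X_h : X .xp1 * X .h = X .h * X .xp1 + X .xp1 := by
  rw [X_xp1, add_mul, E_mul_X_h, E_mul_X_h, mul_add]; abel

theorem hinv_mul_X_xm1 (n : ℤ) : hinv n * X .xm1 = X .xm1 * hinv (n - 1) := by
  rw [X_xm1, mul_add, hinv_mul_F, hinv_mul_F, add_mul]

theorem X_xp1_mul_hinv (n : ℤ) : X .xp1 * hinv n = hinv (n - 1) * X .xp1 := by
  rw [X_xp1, add_mul, E_mul_hinv, E_mul_hinv, mul_add]

/-! ### Modules on which `X_α` is locally nilpotent -/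

section Nilpotent

variable {M : Type*} [AddCommGroup M] [Module U M]

/-- The square of `X_α`. -/
def eSq : U := X .xp1 * X .xp1

/-- Leibniz rule for a commutator that itself commutes with `eSq`. The even element `eSq` is used in
place of `X_α` because its relations with the generators are ordinary commutators, without signs. -/
theorem eSq_pow_succ_mul {g g' : U} (hg : eSq * g = g * eSq + g') (hg' : eSq * g' = g' * eSq)
    (n : ℕ) : eSq ^ (n + 1) * g = g * eSq ^ (n + 1) + (n + 1 : ℕ) • (g' * eSq ^ n) := by
  induction n with
  | zero => simpa using hg
  | succ n ih =>
    rw [pow_succ' eSq (n + 1), mul_assoc, ih, mul_add, ← mul_assoc, hg, mul_smul_comm,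
      ← mul_assoc eSq g', hg', succ_nsmul (g' * eSq ^ (n + 1)) (n + 1)]
    simp only [add_mul, mul_assoc, ← pow_succ']
    abel

theorem eSq_smul_nilpotent {g g' : U} (hg : eSq * g = g * eSq + g') (hg' : eSq * g' = g' * eSq)
    {m : M} (hm : ∃ n : ℕ, eSq ^ n • m = 0) : ∃ n : ℕ, eSq ^ n • (g • m) = 0 := by
  obtain ⟨n, hn⟩ := hm
  refine ⟨n + 1, ?_⟩
  have : eSq ^ (n + 1) • m = 0 := by rw [pow_succ', mul_smul, hn, smul_zero]
  rw [smul_smul, eSq_pow_succ_mul hg hg', add_smul, mul_smul, this, smul_zero, zero_add,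
    smul_assoc, mul_smul, hn, smul_zero, smul_zero]

theorem eSq_eq : eSq = E 0 * E 0 + E 1 * E 1 := by
  have := E_one_mul_E_zero
  rw [eSq, X_xp1]
  simp only [mul_add, add_mul, this]; abel

theorem eSq_mul_E (i : Fin 2) : eSq * E i = E i * eSq := by
  have h0 := E_one_mul_E_zero
  have h1 := mul_mul_of_eq E_one_mul_E_zero
  fin_cases i <;> simp [eSq_eq, mul_add, add_mul, mul_assoc, h0, h1]

theorem eSq_mul_h (i : Fin 2) : eSq * h i = h i * eSq + (E i * E i + E i * E i) := by
  have h0 := E_mul_h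
  have h1 := fun i => mul_mul_of_eq (E_mul_h i)
  have h2 := E_one_mul_h_zero
  have h3 := E_zero_mul_h_one
  have h4 := mul_mul_of_eq E_one_mul_h_zero
  have h5 := mul_mul_of_eq E_zero_mul_h_one
  fin_cases i <;> simp [eSq_eq, mul_add, add_mul, mul_assoc, h0, h1, h2, h3, h4, h5] <;> abel

theorem eSq_mul_F (i : Fin 2) : eSq * F i = F i * eSq + E i := by
  have h0 := E_mul_h
  have h1 := E_mul_F
  have h2 := E_one_mul_F_zero
  have h3 := E_zero_mul_F_one
  have h4 := mul_mul_of_eq E_one_mul_F_zero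
  have h5 := mul_mul_of_eq E_zero_mul_F_one
  have h6 := fun i => mul_mul_of_eq (E_mul_F i)
  fin_cases i <;>
    simp [eSq_eq, mul_add, add_mul, mul_sub, sub_mul, mul_assoc, h0, h1, h2, h3, h4, h5, h6] <;> abel

theorem eSq_pow_mul_hinv (n : ℤ) (k : ℕ) : eSq ^ k * hinv n = hinv (n - 2 * k) * eSq ^ k := by
  induction k with
  | zero => simp
  | succ k ih =>
    rw [pow_succ', mul_assoc, ih, ← mul_assoc, eSq, mul_assoc (X .xp1), X_xp1_mul_hinv,
      ← mul_assoc (X .xp1), X_xp1_mul_hinv]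
    simp only [mul_assoc]
    congr 2
    push_cast; ring

/-- If `X_α` acts nilpotently on a vector, then it does so on the submodule generated by it. -/
theorem eSq_nilpotent_smul {m : M} (hm : ∃ n : ℕ, eSq ^ n • m = 0) (u : U) :
    ∃ n : ℕ, eSq ^ n • (u • m) = 0 := by
  let S : Submodule ℂ U :=
    { carrier := {u | ∃ n : ℕ, eSq ^ n • (u • m) = 0}
      zero_mem' := ⟨0, by simp⟩
      add_mem' := by
        rintro u v ⟨n, hn⟩ ⟨k, hk⟩
        refine ⟨n + k, ?_⟩
        rw [add_smul, smul_add, pow_add, mul_smul _ _ (v • m), hk, smul_zero, add_zero, ← pow_add,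
          add_comm, pow_add, mul_smul, hn, smul_zero]
      smul_mem' := by
        rintro c u ⟨n, hn⟩
        refine ⟨n, ?_⟩
        rw [smul_smul, mul_smul_comm, Algebra.smul_def, mul_smul, mul_smul, hn, smul_zero] }
  refine U_induction S (by simpa [S] using hm) ?_ ?_ ?_ ?_ u
  · intro i u hu
    change ∃ n : ℕ, _
    simp only [mul_smul]
    exact eSq_smul_nilpotent (g := E i) (g' := 0) (by simp [eSq_mul_E]) (by simp) hu
  · intro i u hu
    change ∃ n : ℕ, _
    simp only [mul_smul]
    exact eSq_smul_nilpotent (eSq_mul_F i) (eSq_mul_E i) hu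
  · intro i u hu
    change ∃ n : ℕ, _
    simp only [mul_smul]
    exact eSq_smul_nilpotent (eSq_mul_h i)
      (by rw [mul_add, add_mul, ← mul_assoc, eSq_mul_E, mul_assoc, eSq_mul_E, mul_assoc]) hu
  · rintro n u ⟨k, hk⟩
    refine ⟨k, ?_⟩
    rw [smul_smul, ← mul_assoc, eSq_pow_mul_hinv, mul_assoc, mul_smul, mul_smul, hk, smul_zero]

/-- The factor `d k` in `X_α X_{-α}^k m = X_{-α}^{k-1} (d k) m` for singular `m`. -/
def dCoef : ℕ → U
  | 0 => 0
  | k + 1 => X .h + (k : U) - dCoef k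

theorem dCoef_even_odd (m : ℕ) :
    dCoef (2 * m) = (m : U) ∧ dCoef (2 * m + 1) = X .h + (m : U) := by
  induction m with
  | zero => simp [dCoef]
  | succ m ih =>
    have h1 : dCoef (2 * (m + 1)) = ((m + 1 : ℕ) : U) := by
      change X .h + ((2 * m + 1 : ℕ) : U) - dCoef (2 * m + 1) = _
      rw [ih.2]; push_cast; noncomm_ring
    refine ⟨h1, ?_⟩
    change X .h + ((2 * (m + 1) : ℕ) : U) - dCoef (2 * (m + 1)) = _
    rw [h1]; push_cast; noncomm_ring

/-- For even `k + 1` the factor is a nonzero integer; for odd `k + 1` it is `H + m`, and this is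
where the localization enters. The clause with `r'` ensures that the inverse preserves singular
vectors. -/
theorem dCoef_isUnit (k : ℕ) : ∃ r r' : U, dCoef (k + 1) * r = 1 ∧ r * dCoef (k + 1) = 1 ∧
    X .xp1 * r = r' * X .xp1 := by
  obtain ⟨m, hm | hm⟩ := Nat.even_or_odd' (k + 1)
  · have hm0 : (m : ℂ) ≠ 0 := by
      norm_cast; omega
    refine ⟨algebraMap ℂ U (m : ℂ)⁻¹, algebraMap ℂ U (m : ℂ)⁻¹, ?_, ?_, ?_⟩
    · rw [hm, (dCoef_even_odd m).1, ← map_natCast (algebraMap ℂ U), ← map_mul, mul_inv_cancel₀ hm0,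
        map_one]
    · rw [hm, (dCoef_even_odd m).1, ← map_natCast (algebraMap ℂ U), ← map_mul, inv_mul_cancel₀ hm0,
        map_one]
    · exact (Algebra.commutes _ _).symm
  · have key : dCoef (k + 1) = X .h - ((-m : ℤ) : U) := by
      rw [hm, (dCoef_even_odd m).2]; simp
    exact ⟨hinv (-m), hinv (-m - 1), by rw [key, sub_mul_hinv], by rw [key, hinv_mul_sub],
      X_xp1_mul_hinv _⟩

theorem X_h_mul_X_xm1_pow (k : ℕ) :
    X .h * X .xm1 ^ k = X .xm1 ^ k * (X .h + (k : U)) := by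
  induction k with
  | zero => simp
  | succ k ih =>
    rw [pow_succ, ← mul_assoc, ih, mul_assoc, add_mul, X_h_mul_X_xm1, mul_assoc,
      (Nat.cast_commute k (X .xm1)).eq]
    push_cast
    noncomm_ring

/-- Each step uses `X_α X_{-α} = H - X_{-α} X_α` and moves `H` through `X_{-α}^k`, where it becomes
`H + k`; this is exactly the recursion that defines `dCoef`. -/
theorem X_xp1_smul_X_xm1_pow {m : M} (hm : X .xp1 • m = 0) (k : ℕ) :
    X .xp1 • X .xm1 ^ (k + 1) • m = X .xm1 ^ k • dCoef (k + 1) • m := by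
  induction k with
  | zero =>
    simp only [zero_add, pow_one, pow_zero, one_smul, dCoef]
    rw [smul_smul, X_xp1_mul_X_xm1, sub_smul, mul_smul, hm]
    simp
  | succ k ih =>
    rw [pow_succ' _ (k + 1), mul_smul, smul_smul, X_xp1_mul_X_xm1, sub_smul, mul_smul (X .xm1), ih,
      smul_smul (X .h), X_h_mul_X_xm1_pow, smul_smul (X .xm1), ← pow_succ', mul_smul, ← smul_sub,
      ← sub_smul]
    rfl

theorem singular_dCoef {m : M} (hm : X .xp1 • m = 0) (k : ℕ) : X .xp1 • dCoef k • m = 0 := by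
  induction k with
  | zero => simp [dCoef]
  | succ k ih =>
    rw [dCoef, sub_smul, smul_sub, ih, add_smul, smul_add, smul_smul, X_xp1_mul_X_h, add_smul,
      mul_smul, hm, smul_smul, ← (Nat.cast_commute k (X .xp1)).eq, mul_smul, hm]
    simp

/-- Surjectivity of `X_α^k X_{-α}^k` on singular vectors: it acts there by a product of invertible
factors `dCoef`. Injectivity is `eq_zero_of_X_xp1_pow_smul_X_xm1_pow`. -/
theorem exists_singular_preimage {m : M} (hm : X .xp1 • m = 0) (k : ℕ) :
    ∃ m' : M, X .xp1 • m' = 0 ∧ X .xp1 ^ k • X .xm1 ^ k • m' = m := by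
  induction k with
  | zero => exact ⟨m, hm, by simp⟩
  | succ k ih =>
    obtain ⟨m'', h1, h2⟩ := ih
    obtain ⟨r, r', hr, -, hr'⟩ := dCoef_isUnit k
    have h3 : X .xp1 • r • m'' = 0 := by rw [smul_smul, hr', mul_smul, h1, smul_zero]
    refine ⟨r • m'', h3, ?_⟩
    rw [pow_succ, mul_smul, X_xp1_smul_X_xm1_pow h3, smul_smul (dCoef _), hr, one_smul, h2]

theorem X_xp1_pow_smul_X_xm1_pow_of_lt {m : M} (hm : X .xp1 • m = 0) {j k : ℕ} (hjk : j < k) :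
    X .xp1 ^ k • X .xm1 ^ j • m = 0 := by
  induction j generalizing k m with
  | zero =>
    obtain ⟨k, rfl⟩ : ∃ l, k = l + 1 := ⟨k - 1, by omega⟩
    rw [pow_zero, one_smul, pow_succ, mul_smul, hm, smul_zero]
  | succ j ih =>
    obtain ⟨k, rfl⟩ : ∃ l, k = l + 1 := ⟨k - 1, by omega⟩
    rw [pow_succ, mul_smul, X_xp1_smul_X_xm1_pow hm, ih (singular_dCoef hm _) (by omega)]

theorem eq_zero_of_X_xp1_pow_smul_X_xm1_pow {m : M} (hm : X .xp1 • m = 0) {k : ℕ}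
    (hk : X .xp1 ^ k • X .xm1 ^ k • m = 0) : m = 0 := by
  induction k generalizing m with
  | zero => simpa using hk
  | succ k ih =>
    rw [pow_succ, mul_smul, X_xp1_smul_X_xm1_pow hm] at hk
    obtain ⟨r, r', -, hr, -⟩ := dCoef_isUnit k
    have := ih (singular_dCoef hm _) hk
    rw [← one_smul U m, ← hr, mul_smul, this, smul_zero]

/-- If `X_α^{N+1}` kills `m`, then `X_α^N m` is singular, hence equal to `X_α^N X_{-α}^N m'` with
`m'` singular; subtracting `X_{-α}^N m'` lowers the order of nilpotency. This takes the place of the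
extremal projector. -/
theorem exists_eq_sum_singular {N : ℕ} {m : M} (hm : X .xp1 ^ N • m = 0) :
    ∃ s : ℕ → M, (∀ k, X .xp1 • s k = 0) ∧ m = ∑ k ∈ Finset.range N, X .xm1 ^ k • s k := by
  induction N generalizing m with
  | zero => exact ⟨0, by simp, by simpa using hm⟩
  | succ N ih =>
    have h1 : X .xp1 • X .xp1 ^ N • m = 0 := by rw [smul_smul, ← pow_succ', hm]
    obtain ⟨m', hm', h2⟩ := exists_singular_preimage h1 N
    obtain ⟨s, hs, h3⟩ := ih (m := m - X .xm1 ^ N • m') (by rw [smul_sub, h2, sub_self])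
    refine ⟨fun k => if k = N then m' else s k, fun k => by dsimp; split_ifs <;> simp [*], ?_⟩
    simp only [Finset.sum_range_succ, if_true]
    rw [← sub_eq_iff_eq_add, h3]
    refine Finset.sum_congr rfl fun k hk => ?_
    rw [if_neg (Finset.mem_range.1 hk).ne]

theorem sum_eq_zero_of_singular {N : ℕ} {s : ℕ → M} (hs : ∀ k, X .xp1 • s k = 0)
    (h : X .xp1 • ∑ k ∈ Finset.range N, X .xm1 ^ (k + 1) • s k = 0) :
    ∑ k ∈ Finset.range N, X .xm1 ^ (k + 1) • s k = 0 := by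
  induction N with
  | zero => simp
  | succ N ih =>
    -- This power of `X_α` kills every term except the one with the highest power of `X_{-α}`.
    have h1 : X .xp1 ^ (N + 1) • ∑ k ∈ Finset.range (N + 1), X .xm1 ^ (k + 1) • s k = 0 := by
      rw [pow_succ, mul_smul, h, smul_zero]
    rw [Finset.sum_range_succ, smul_add, Finset.smul_sum, Finset.sum_eq_zero, zero_add] at h1
    · have h2 := eq_zero_of_X_xp1_pow_smul_X_xm1_pow (hs N) h1
      rw [Finset.sum_range_succ, h2, smul_zero, add_zero] at h ⊢
      exact ih h
    · intro k hk
      exact X_xp1_pow_smul_X_xm1_pow_of_lt (hs k) (by simpa using hk)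

theorem X_xp1_pow_of_eSq {m : M} (hm : ∃ n : ℕ, eSq ^ n • m = 0) :
    ∃ N : ℕ, X .xp1 ^ N • m = 0 := by
  obtain ⟨n, hn⟩ := hm
  exact ⟨2 * n, by rw [pow_mul, pow_two]; exact hn⟩

/-- The sum half of the decomposition into singular vectors and the image of `X_{-α}`;
`X_xm1_smul_eq_zero` says that the sum is direct. -/
theorem exists_singular_add {m : M} (hm : ∃ n : ℕ, eSq ^ n • m = 0) :
    ∃ s m' : M, X .xp1 • s = 0 ∧ m = s + X .xm1 • m' := by
  obtain ⟨N, hN⟩ := X_xp1_pow_of_eSq hm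
  -- The exponent `N + 1` makes the range nonempty, so that the term `k = 0` can be split off.
  obtain ⟨s, hs, h1⟩ := exists_eq_sum_singular (N := N + 1) (m := m)
    (by rw [pow_succ', mul_smul, hN, smul_zero])
  refine ⟨s 0, ∑ k ∈ Finset.range N, X .xm1 ^ k • s (k + 1), hs 0, ?_⟩
  rw [h1, Finset.sum_range_succ', Finset.smul_sum, add_comm]
  simp [pow_succ', mul_smul]

theorem X_xm1_smul_eq_zero {m : M} (hm : ∃ n : ℕ, eSq ^ n • m = 0)
    (h : X .xp1 • X .xm1 • m = 0) : X .xm1 • m = 0 := by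
  obtain ⟨N, hN⟩ := X_xp1_pow_of_eSq hm
  obtain ⟨s, hs, h1⟩ := exists_eq_sum_singular hN
  have h2 : X .xm1 • m = ∑ k ∈ Finset.range N, X .xm1 ^ (k + 1) • s k := by
    rw [h1, Finset.smul_sum]
    simp [pow_succ', mul_smul]
  rw [h2] at h ⊢
  exact sum_eq_zero_of_singular hs h

end Nilpotent

end Osp12

end

noncomputable section

namespace Osp12

/-! ### Normal ordering of words: `F`, then `hinv`, then `h`, then `E`, with index `0` before index
`1` -/

section NormalOrdering

theorem E_mul_F_assoc (i : Fin 2) (z : U) : E i * (F i * z) = h i * z - F i * (E i * z) := by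
  rw [mul_mul_of_eq (E_mul_F i), sub_mul, mul_assoc]
theorem h_mul_F_assoc (i : Fin 2) (z : U) : h i * (F i * z) = F i * (h i * z) + F i * z := by
  rw [mul_mul_of_eq (h_mul_F i), add_mul, mul_assoc]
theorem E_one_mul_E_zero_assoc (z : U) : E 1 * (E 0 * z) = -(E 0 * (E 1 * z)) := by
  rw [mul_mul_of_eq E_one_mul_E_zero, neg_mul, mul_assoc]
theorem F_one_mul_F_zero_assoc (z : U) : F 1 * (F 0 * z) = -(F 0 * (F 1 * z)) := by
  rw [mul_mul_of_eq F_one_mul_F_zero, neg_mul, mul_assoc]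
theorem E_one_mul_F_zero_assoc (z : U) : E 1 * (F 0 * z) = -(F 0 * (E 1 * z)) := by
  rw [mul_mul_of_eq E_one_mul_F_zero, neg_mul, mul_assoc]
theorem E_zero_mul_F_one_assoc (z : U) : E 0 * (F 1 * z) = -(F 1 * (E 0 * z)) := by
  rw [mul_mul_of_eq E_zero_mul_F_one, neg_mul, mul_assoc]
theorem h_one_mul_F_zero_assoc (z : U) : h 1 * (F 0 * z) = F 0 * (h 1 * z) := by
  rw [mul_mul_of_eq h_one_mul_F_zero, mul_assoc]
theorem h_zero_mul_F_one_assoc (z : U) : h 0 * (F 1 * z) = F 1 * (h 0 * z) := by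
  rw [mul_mul_of_eq h_zero_mul_F_one, mul_assoc]
theorem hinv_mul_F_assoc (n : ℤ) (i : Fin 2) (z : U) :
    hinv n * (F i * z) = F i * (hinv (n - 1) * z) := by
  rw [mul_mul_of_eq (hinv_mul_F n i), mul_assoc]
theorem E_mul_hinv_assoc (n : ℤ) (i : Fin 2) (z : U) :
    E i * (hinv n * z) = hinv (n - 1) * (E i * z) := by
  rw [mul_mul_of_eq (E_mul_hinv n i), mul_assoc]
theorem h_mul_hinv_assoc (n : ℤ) (i : Fin 2) (z : U) :
    h i * (hinv n * z) = hinv n * (h i * z) := by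
  rw [mul_mul_of_eq (h_mul_hinv n i), mul_assoc]
-- Since `(H - n)⁻¹ (H - n) = 1`, the words `hinv n * h 0`, `hinv n * h 1`, `hinv n` and `1` are
-- linearly dependent; eliminating one of them removes this ambiguity from the normal form.
theorem hinv_mul_h_one (n : ℤ) : hinv n * h 1 = 1 + (n : ℂ) • hinv n - hinv n * h 0 := by
  have h1 := hinv_mul_sub n
  rw [X_h, mul_sub, mul_add, ← (Int.cast_commute n (hinv n)).eq] at h1
  have h2 : (n : ℂ) • hinv n = (n : U) * hinv n := by
    rw [Algebra.smul_def, map_intCast]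
  rw [h2, ← h1]; abel
theorem hinv_mul_h_one_assoc (n : ℤ) (z : U) :
    hinv n * (h 1 * z) = z + (n : ℂ) • (hinv n * z) - hinv n * (h 0 * z) := by
  rw [mul_mul_of_eq (hinv_mul_h_one n), sub_mul, add_mul, one_mul, smul_mul_assoc, mul_assoc]

end NormalOrdering

attribute [local simp] E_mul_F E_mul_h h_mul_F E_one_mul_E_zero F_one_mul_F_zero E_one_mul_F_zero
  E_zero_mul_F_one E_zero_mul_h_one E_one_mul_h_zero h_one_mul_F_zero h_zero_mul_F_one
  h_one_mul_h_zero hinv_mul_F E_mul_hinv h_mul_hinv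
  E_mul_F_assoc h_mul_F_assoc E_one_mul_E_zero_assoc F_one_mul_F_zero_assoc
  E_one_mul_F_zero_assoc E_zero_mul_F_one_assoc
  h_one_mul_F_zero_assoc h_zero_mul_F_one_assoc hinv_mul_F_assoc
  E_mul_hinv_assoc h_mul_hinv_assoc hinv_mul_h_one hinv_mul_h_one_assoc

theorem xt_xp2 : xt .xp2 = E 1 * E 1 - E 0 * E 0 := by
  rw [xt, x_xp2, x_xp2]; abel

theorem xt_xm2 : xt .xm2 = F 0 * F 0 - F 1 * F 1 := by
  rw [xt, x_xm2, x_xm2]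

/-! ### The isomorphism `A ≃ U / 𝕀𝕀` -/

/-- `X_{2α}` is minus the square of `X_α`, so `X_α` alone generates the left ideal. -/
theorem mem_leftI {u : U} : u ∈ leftI ↔ ∃ v, u = v * X .xp1 := by
  rw [leftI, Ideal.mem_span_pair]
  constructor
  · rintro ⟨a, b, rfl⟩
    exact ⟨a - b * X .xp1, by rw [X_xp2]; noncomm_ring⟩
  · rintro ⟨v, rfl⟩
    exact ⟨v, 0, by simp⟩

theorem mem_normI {n : U} : n ∈ normI ↔ X .xp1 * n ∈ leftI := by
  constructor
  · intro hn
    exact hn _ (Ideal.subset_span (by simp))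
  · intro hn y hy
    obtain ⟨v, rfl⟩ := mem_leftI.1 hy
    rw [mul_assoc]
    exact leftI.mul_mem_left v hn

theorem mem_doubleI {u : U} : u ∈ doubleI ↔ ∃ v w, u = v * X .xp1 + X .xm1 * w := by
  simp only [doubleI, Submodule.mem_sup, LinearMap.mem_range, LinearMap.mulLeft_apply,
    Submodule.restrictScalars_mem, mem_leftI]
  constructor
  · rintro ⟨_, ⟨_, ⟨v, rfl⟩, _, ⟨w, rfl⟩, rfl⟩, _, ⟨w', rfl⟩, rfl⟩
    exact ⟨v, w + X .xm1 * w', by rw [X_xm2]; noncomm_ring⟩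
  · rintro ⟨v, w, rfl⟩
    exact ⟨_, ⟨_, ⟨v, rfl⟩, _, ⟨w, rfl⟩, rfl⟩, _, ⟨0, rfl⟩, by simp⟩

theorem toDouble_toA (n : normI) : toDouble (toA n) = Submodule.Quotient.mk (n : U) := rfl

theorem toA_surjective : Function.Surjective toA := Ideal.Quotient.mkₐ_surjective ℂ idealI

theorem toA_eq_zero {n : normI} : toA n = 0 ↔ (n : U) ∈ leftI :=
  Ideal.Quotient.eq_zero_iff_mem

/-- The module is generated by the class of `1`, which `X_α` kills, and nilpotency spreads from a
generator. -/
theorem mk_leftI_nilpotent (m : U ⧸ leftI) : ∃ n : ℕ, eSq ^ n • m = 0 := by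
  obtain ⟨u, rfl⟩ := Submodule.Quotient.mk_surjective _ m
  have h1 : ∃ n : ℕ, eSq ^ n • (Submodule.Quotient.mk 1 : U ⧸ leftI) = 0 := by
    refine ⟨1, ?_⟩
    rw [← Submodule.Quotient.mk_smul, Submodule.Quotient.mk_eq_zero, mem_leftI]
    exact ⟨X .xp1, by simp [eSq]⟩
  simpa [← Submodule.Quotient.mk_smul] using eSq_nilpotent_smul h1 u

/-- Singular vectors of `U/I` are precisely the classes of elements of the normalizer, so the
splitting into a singular vector and an element of the image of `X_{-α}` gives the representative.
-/
theorem exists_normalizer_rep (u : U) : ∃ n : normI, (n : U) - u ∈ doubleI := by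
  obtain ⟨s, m', hs, h1⟩ := exists_singular_add (mk_leftI_nilpotent (Submodule.Quotient.mk u))
  obtain ⟨n, rfl⟩ := Submodule.Quotient.mk_surjective _ s
  obtain ⟨w, rfl⟩ := Submodule.Quotient.mk_surjective _ m'
  rw [← Submodule.Quotient.mk_smul, Submodule.Quotient.mk_eq_zero] at hs
  rw [← Submodule.Quotient.mk_smul, ← Submodule.Quotient.mk_add, Submodule.Quotient.eq,
    mem_leftI] at h1
  obtain ⟨v, hv⟩ := h1
  refine ⟨⟨n, mem_normI.2 hs⟩, mem_doubleI.2 ⟨-v, -w, ?_⟩⟩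
  rw [neg_mul, ← hv, smul_eq_mul]
  noncomm_ring

theorem toDouble_surjective : Function.Surjective toDouble := by
  intro y
  obtain ⟨u, rfl⟩ := Submodule.Quotient.mk_surjective _ y
  obtain ⟨n, hn⟩ := exists_normalizer_rep u
  exact ⟨toA n, (Submodule.Quotient.eq _).2 hn⟩

/-- An element of the normalizer that lies in `II` gives a singular vector of `U/I` in the image of
`X_{-α}`, and these two subspaces meet in `0`. -/
theorem toDouble_injective : Function.Injective toDouble := by
  rw [← LinearMap.ker_eq_bot, LinearMap.ker_eq_bot']
  intro a ha
  obtain ⟨n, rfl⟩ := toA_surjective a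
  rw [toDouble_toA, Submodule.Quotient.mk_eq_zero, mem_doubleI] at ha
  obtain ⟨v, w, hn⟩ := ha
  rw [toA_eq_zero]
  have h1 : (Submodule.Quotient.mk (n : U) : U ⧸ leftI)
      = X .xm1 • (Submodule.Quotient.mk w : U ⧸ leftI) := by
    rw [← Submodule.Quotient.mk_smul, Submodule.Quotient.eq, mem_leftI]
    exact ⟨v, by rw [hn, smul_eq_mul]; abel⟩
  have h2 := X_xm1_smul_eq_zero (mk_leftI_nilpotent (Submodule.Quotient.mk w)) (by
    rw [← h1, ← Submodule.Quotient.mk_smul, Submodule.Quotient.mk_eq_zero]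
    exact mem_normI.1 n.2)
  rwa [← h1, Submodule.Quotient.mk_eq_zero] at h2

theorem toDouble_bar (u : U) : toDouble (bar u) = Submodule.Quotient.mk u :=
  Function.rightInverse_invFun toDouble_surjective _

theorem bar_eq {u : U} {a : A} : bar u = a ↔ toDouble a = Submodule.Quotient.mk u := by
  rw [← toDouble_injective.eq_iff, toDouble_bar, eq_comm]

theorem bar_eq_toA {u : U} {n : normI} : bar u = toA n ↔ (n : U) - u ∈ doubleI := by
  rw [bar_eq, toDouble_toA, Submodule.Quotient.eq]

theorem bar_coe (n : normI) : bar n = toA n := bar_eq_toA.2 (by simp)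

theorem exists_toA_eq_bar (u : U) : ∃ n : normI, toA n = bar u ∧ (n : U) - u ∈ doubleI := by
  obtain ⟨n, hn⟩ := toA_surjective (bar u)
  exact ⟨n, hn, bar_eq_toA.1 hn.symm⟩

theorem bar_surjective : Function.Surjective bar := fun a => by
  obtain ⟨n, rfl⟩ := toA_surjective a
  exact ⟨n, bar_coe n⟩

theorem bar_add (u v : U) : bar (u + v) = bar u + bar v :=
  bar_eq.2 (by rw [map_add, toDouble_bar, toDouble_bar, Submodule.Quotient.mk_add])

theorem bar_smul (c : ℂ) (u : U) : bar (c • u) = c • bar u :=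
  bar_eq.2 (by rw [map_smul, toDouble_bar, Submodule.Quotient.mk_smul])

/-- The map `bar` as a linear map. -/
def barₗ : U →ₗ[ℂ] A where
  toFun := bar
  map_add' := bar_add
  map_smul' := bar_smul

theorem bar_zero : bar 0 = 0 := map_zero barₗ
theorem bar_sub (u v : U) : bar (u - v) = bar u - bar v := map_sub barₗ u v

theorem bar_congr {u v : U} (huv : u - v ∈ doubleI) : bar u = bar v :=
  bar_eq.2 (by rw [toDouble_bar, eq_comm, Submodule.Quotient.eq]; exact huv)

theorem bar_X_xm1_mul (u : U) : bar (X .xm1 * u) = 0 := by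
  rw [bar_eq, map_zero, eq_comm, Submodule.Quotient.mk_eq_zero, mem_doubleI]
  exact ⟨0, u, by simp⟩

theorem bar_mul_X_xp1 (u : U) : bar (u * X .xp1) = 0 := by
  rw [bar_eq, map_zero, eq_comm, Submodule.Quotient.mk_eq_zero, mem_doubleI]
  exact ⟨u, 0, by simp⟩

theorem mul_mem_doubleI {u n : U} (hu : u ∈ doubleI) (hn : n ∈ normI) : u * n ∈ doubleI := by
  obtain ⟨v, w, rfl⟩ := mem_doubleI.1 hu
  obtain ⟨v', hv'⟩ := mem_leftI.1 (mem_normI.1 hn)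
  exact mem_doubleI.2 ⟨v * v', w * n, by rw [add_mul, mul_assoc, hv']; simp only [mul_assoc]⟩

/-- `II` is stable under right multiplication by the normalizer. A product in `A` can thus be
computed with a normalizer representative of the right factor only. -/
theorem bar_mul_coe (u : U) (n : normI) : bar (u * n) = bar u * toA n := by
  obtain ⟨m, hm, hmu⟩ := exists_toA_eq_bar u
  rw [← hm, ← map_mul, bar_eq_toA, Subalgebra.coe_mul, ← sub_mul]
  exact mul_mem_doubleI hmu n.2

theorem X_h_mem_normI : X .h ∈ normI :=
  mem_normI.2 (mem_leftI.2 ⟨X .h + 1, by rw [X_xp1_mul_X_h]; noncomm_ring⟩)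

theorem hinv_mem_normI (n : ℤ) : hinv n ∈ normI :=
  mem_normI.2 (mem_leftI.2 ⟨hinv (n - 1), X_xp1_mul_hinv n⟩)

theorem HA_eq : HA = toA ⟨X .h, X_h_mem_normI⟩ := bar_coe ⟨X .h, X_h_mem_normI⟩

theorem HAinv_eq (n : ℤ) : HAinv n = toA ⟨hinv n, hinv_mem_normI n⟩ :=
  bar_coe ⟨hinv n, hinv_mem_normI n⟩

theorem bar_X_h_mul (u : U) : bar (X .h * u) = HA * bar u := by
  obtain ⟨n, hn, hnu⟩ := exists_toA_eq_bar u
  rw [← hn, HA_eq, ← map_mul, bar_eq_toA]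
  obtain ⟨v, w, h1⟩ := mem_doubleI.1 hnu
  refine mem_doubleI.2 ⟨X .h * v, (X .h + 1) * w, ?_⟩
  have h2 := mul_mul_of_eq X_h_mul_X_xm1 w
  rw [Subalgebra.coe_mul, ← mul_sub, h1, mul_add, h2]
  noncomm_ring

theorem bar_hinv_mul (k : ℤ) (u : U) : bar (hinv k * u) = HAinv k * bar u := by
  obtain ⟨n, hn, hnu⟩ := exists_toA_eq_bar u
  rw [← hn, HAinv_eq, ← map_mul, bar_eq_toA]
  obtain ⟨v, w, h1⟩ := mem_doubleI.1 hnu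
  refine mem_doubleI.2 ⟨hinv k * v, hinv (k - 1) * w, ?_⟩
  have h2 := mul_mul_of_eq (hinv_mul_X_xm1 k) w
  rw [Subalgebra.coe_mul, ← mul_sub, h1, mul_add, h2]
  noncomm_ring

theorem HA_sub_mul_HAinv (n : ℤ) : (HA - (n : A)) * HAinv n = 1 := by
  have : (HA - (n : A)) = toA (⟨X .h, X_h_mem_normI⟩ - (n : normI)) := by
    rw [map_sub, HA_eq, map_intCast]
  rw [this, HAinv_eq, ← map_mul, ← map_one toA]
  congr 1
  exact Subtype.ext (sub_mul_hinv n)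

theorem HAinv_mul_HA_sub (n : ℤ) : HAinv n * (HA - (n : A)) = 1 := by
  have : (HA - (n : A)) = toA (⟨X .h, X_h_mem_normI⟩ - (n : normI)) := by
    rw [map_sub, HA_eq, map_intCast]
  rw [this, HAinv_eq, ← map_mul, ← map_one toA]
  congr 1
  exact Subtype.ext (hinv_mul_sub n)

theorem HA_mul_bar {u : U} {k : ℤ} (hu : X .h * u = u * (X .h + (k : U))) :
    HA * bar u = bar u * (HA + (k : A)) := by
  have h1 : bar (u * X .h) = bar u * HA := by
    rw [HA_eq]; exact bar_mul_coe u ⟨X .h, X_h_mem_normI⟩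
  have h2 : bar (u * (k : U)) = bar u * (k : A) := by
    have := bar_mul_coe u (k : normI)
    rwa [map_intCast] at this
  rw [← bar_X_h_mul, hu, mul_add, bar_add, h1, h2, mul_add]

/-! ### Representatives of the generators in the normalizer -/

/-- The representative of `x̄_{2α}` in the normalizer. -/
def repP2 : U := xt .xp2

/-- The representative of `x̄_α` in the normalizer. -/
def repP1 : U := xt .xp1 + (2 : ℂ) • (X .xm1 * (hinv 0 * xt .xp2))

/-- The representative of `h̄` in the normalizer. -/
def repH : U :=
  xt .h - X .xm1 * (hinv 0 * xt .xp1) + (2 : ℂ) • (X .xm1 * (X .xm1 * (hinv (-1) * xt .xp2)))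

theorem repP2_mem : repP2 ∈ normI := by
  refine mem_normI.2 (mem_leftI.2 ⟨repP2, ?_⟩)
  simp [repP2, xt_xp2, X_xp1, mul_add, add_mul, mul_sub, sub_mul, mul_assoc]
  abel

/-- Here `X_α x̃_α + x̃_α X_α = -2 x̃_{2α}`. As `X_α X_{-α} = H - X_{-α} X_α`, the correction term
contributes `2 x̃_{2α}` modulo `I`, which cancels the defect. -/
theorem repP1_mem : repP1 ∈ normI := by
  refine mem_normI.2 (mem_leftI.2 ⟨-xt .xp1 - (2 : ℂ) • (X .xm1 * (hinv (-1) * xt .xp2)), ?_⟩)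
  simp [repP1, xt_xp2, xt_xp1, X_xm1, X_xp1, mul_add, add_mul, mul_sub, sub_mul, mul_assoc]
  module

/-- The first correction cancels the commutator `[X_α, h̃] = x̃_α` but leaves a multiple of `X_{-α}
(H + 1)⁻¹ x̃_{2α}`; the second removes that, by `[X_α, X_{-α}²] = X_{-α}`. -/
theorem repH_mem : repH ∈ normI := by
  refine mem_normI.2 (mem_leftI.2 ⟨xt .h - X .xm1 * (hinv (-1) * xt .xp1)
    + (2 : ℂ) • (X .xm1 * (X .xm1 * (hinv (-2) * xt .xp2))), ?_⟩)
  simp [repH, xt_xp2, xt_xp1, xt_h, X_xm1, X_xp1, mul_add, add_mul, mul_sub, sub_mul, mul_assoc]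
  module

theorem xb_xp2_eq : xb .xp2 = toA ⟨repP2, repP2_mem⟩ := bar_coe ⟨repP2, repP2_mem⟩

theorem xb_xp1_eq : xb .xp1 = toA ⟨repP1, repP1_mem⟩ := by
  refine bar_eq_toA.2 (mem_doubleI.2 ⟨0, (2 : ℂ) • (hinv 0 * xt .xp2), ?_⟩)
  simp [repP1]

theorem xb_h_eq : xb .h = toA ⟨repH, repH_mem⟩ := by
  refine bar_eq_toA.2 (mem_doubleI.2 ⟨0, -(hinv 0 * xt .xp1)
    + (2 : ℂ) • (X .xm1 * (hinv (-1) * xt .xp2)), ?_⟩)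
  simp [repH, mul_add]; abel

end Osp12

end

noncomputable section

namespace Osp12

/-! ### Triangular decomposition -/

/-- The subalgebra of `U` generated by `H` and the `(H - n)⁻¹`. -/
def dynU : Subalgebra ℂ U := Algebra.adjoin ℂ ({X .h} ∪ Set.range hinv)

theorem X_h_mem_dynU : X .h ∈ dynU := Algebra.subset_adjoin (by simp)

theorem hinv_mem_dynU (n : ℤ) : hinv n ∈ dynU := Algebra.subset_adjoin (by simp)

theorem dynU_commute_h {r : U} (hr : r ∈ dynU) (i : Fin 2) : h i * r = r * h i := by
  have : dynU ≤ Subalgebra.centralizer ℂ {h i} := by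
    refine Algebra.adjoin_le ?_
    rintro r (rfl | ⟨n, rfl⟩)
    · exact Subalgebra.mem_centralizer_iff ℂ |>.2 (by simp [X_h_mul_h])
    · exact Subalgebra.mem_centralizer_iff ℂ |>.2 (by simp [h_mul_hinv])
  exact (Subalgebra.mem_centralizer_iff ℂ).1 (this hr) (h i) rfl

theorem E_mul_dynU {r : U} (hr : r ∈ dynU) (i : Fin 2) : ∃ r', E i * r = r' * E i := by
  induction hr using Algebra.adjoin_induction with
  | mem r hr =>
    rcases hr with rfl | ⟨n, rfl⟩
    · exact ⟨X .h + 1, by rw [E_mul_X_h]; noncomm_ring⟩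
    · exact ⟨_, E_mul_hinv n i⟩
  | algebraMap c => exact ⟨_, (Algebra.commutes c (E i)).symm⟩
  | add r s _ _ hr hs =>
    obtain ⟨r', hr'⟩ := hr
    obtain ⟨s', hs'⟩ := hs
    exact ⟨r' + s', by rw [mul_add, hr', hs', add_mul]⟩
  | mul r s _ _ hr hs =>
    obtain ⟨r', hr'⟩ := hr
    obtain ⟨s', hs'⟩ := hs
    exact ⟨r' * s', by rw [← mul_assoc, hr', mul_assoc, hs', mul_assoc]⟩

/-- The left ideal of `U` that defines the universal Verma module of `osp(1|2) × osp(1|2)`. -/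
def bigVermaIdeal (lam : ℂ) : Ideal U := Ideal.span {E 0, E 1, xt .h - algebraMap ℂ U lam}

theorem E_mem_bigVermaIdeal (lam : ℂ) (i : Fin 2) : E i ∈ bigVermaIdeal lam := by
  fin_cases i <;> exact Ideal.subset_span (by simp)

/-- The span of the elements of `U` that are ordered with the lowering operators on the left,
modulo `bigVermaIdeal`. -/
inductive IsOrdered (lam : ℂ) : U → Prop
  | base (r j : U) (hr : r ∈ dynU) (hj : j ∈ bigVermaIdeal lam) : IsOrdered lam (r + j)
  | lower (i : Fin 2) (u : U) (hu : IsOrdered lam u) : IsOrdered lam (F i * u)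
  | add (u v : U) (hu : IsOrdered lam u) (hv : IsOrdered lam v) : IsOrdered lam (u + v)

namespace IsOrdered

variable {lam : ℂ} {u : U}

theorem smul (hu : IsOrdered lam u) (c : ℂ) : IsOrdered lam (c • u) := by
  induction hu with
  | base r j hr hj =>
    rw [smul_add]
    exact base _ _ (dynU.smul_mem hr c) (by
      rw [Algebra.smul_def]; exact (bigVermaIdeal lam).mul_mem_left _ hj)
  | lower i u hu ih => rw [← mul_smul_comm]; exact lower i _ ih
  | add u v hu hv ihu ihv => rw [smul_add]; exact add _ _ ihu ihv

theorem zero : IsOrdered lam 0 := by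
  simpa using base (lam := lam) 0 0 (zero_mem _) (zero_mem _)

theorem neg (hu : IsOrdered lam u) : IsOrdered lam (-u) := by
  simpa using hu.smul (-1)

theorem X_h_mul (hu : IsOrdered lam u) : IsOrdered lam (X .h * u) := by
  induction hu with
  | base r j hr hj =>
    rw [mul_add]
    exact base _ _ (mul_mem X_h_mem_dynU hr) ((bigVermaIdeal lam).mul_mem_left _ hj)
  | lower i u hu ih =>
    rw [← mul_assoc, X_h_mul_F, add_mul, mul_assoc]
    exact add _ _ (lower i _ ih) (lower i _ hu)
  | add u v hu hv ihu ihv => rw [mul_add]; exact add _ _ ihu ihv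

theorem hinv_mul (hu : IsOrdered lam u) (n : ℤ) : IsOrdered lam (hinv n * u) := by
  induction hu generalizing n with
  | base r j hr hj =>
    rw [mul_add]
    exact base _ _ (mul_mem (hinv_mem_dynU n) hr) ((bigVermaIdeal lam).mul_mem_left _ hj)
  | lower i u hu ih =>
    rw [← mul_assoc, hinv_mul_F, mul_assoc]
    exact lower i _ (ih _)
  | add u v hu hv ihu ihv => rw [mul_add]; exact add _ _ (ihu n) (ihv n)

theorem xt_h_mul_F (i : Fin 2) : ∃ c : ℂ, xt .h * F i = F i * xt .h + c • F i := by
  fin_cases i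
  · refine ⟨1, ?_⟩
    simp [xt_h, mul_sub, sub_mul, h_mul_F, h_one_mul_F_zero]; abel
  · refine ⟨-1, ?_⟩
    simp [xt_h, mul_sub, sub_mul, h_mul_F, h_zero_mul_F_one]; abel

theorem xt_h_mul (hu : IsOrdered lam u) : IsOrdered lam (xt .h * u) := by
  induction hu with
  | base r j hr hj =>
    have : xt .h * (r + j) = lam • r + (r * (xt .h - algebraMap ℂ U lam) + xt .h * j) := by
      have : xt .h * r = r * xt .h := by
        rw [xt_h, sub_mul, mul_sub, dynU_commute_h hr, dynU_commute_h hr]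
      rw [mul_add, this, mul_sub, ← Algebra.commutes, ← Algebra.smul_def]
      abel
    rw [this]
    exact base _ _ (dynU.smul_mem hr lam) (add_mem ((bigVermaIdeal lam).mul_mem_left _
      (Ideal.subset_span (by simp))) ((bigVermaIdeal lam).mul_mem_left _ hj))
  | lower i u hu ih =>
    obtain ⟨c, hc⟩ := xt_h_mul_F i
    rw [← mul_assoc, hc, add_mul, mul_assoc, smul_mul_assoc]
    exact add _ _ (lower i _ ih) ((lower i _ hu).smul c)
  | add u v hu hv ihu ihv => rw [mul_add]; exact add _ _ ihu ihv

theorem h_mul (hu : IsOrdered lam u) (i : Fin 2) : IsOrdered lam (h i * u) := by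
  have h0 : h 0 = (1 / 2 : ℂ) • X .h + (1 / 2 : ℂ) • xt .h := by rw [X_h, xt_h]; module
  have h1 : h 1 = (1 / 2 : ℂ) • X .h + (-1 / 2 : ℂ) • xt .h := by rw [X_h, xt_h]; module
  fin_cases i
  · change IsOrdered lam (h 0 * u)
    rw [h0, add_mul, smul_mul_assoc, smul_mul_assoc]
    exact add _ _ (hu.X_h_mul.smul _) (hu.xt_h_mul.smul _)
  · change IsOrdered lam (h 1 * u)
    rw [h1, add_mul, smul_mul_assoc, smul_mul_assoc]
    exact add _ _ (hu.X_h_mul.smul _) (hu.xt_h_mul.smul _)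

theorem E_mul_F_cases (i j : Fin 2) :
    ∃ c : ℂ, E i * F j = c • h i - F j * E i := by
  fin_cases i <;> fin_cases j
  · exact ⟨1, by simp [E_mul_F]⟩
  · exact ⟨0, by simp [E_zero_mul_F_one]⟩
  · exact ⟨0, by simp [E_one_mul_F_zero]⟩
  · exact ⟨1, by simp [E_mul_F]⟩

theorem E_mul (hu : IsOrdered lam u) (i : Fin 2) : IsOrdered lam (E i * u) := by
  induction hu with
  | base r j hr hj =>
    obtain ⟨r', hr'⟩ := E_mul_dynU hr i
    rw [mul_add, hr', ← zero_add (r' * E i + E i * j)]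
    exact base _ _ (zero_mem _) (add_mem ((bigVermaIdeal lam).mul_mem_left _
      (E_mem_bigVermaIdeal lam i)) ((bigVermaIdeal lam).mul_mem_left _ hj))
  | lower j u hu ih =>
    obtain ⟨c, hc⟩ := E_mul_F_cases i j
    rw [← mul_assoc, hc, sub_mul, mul_assoc, smul_mul_assoc, sub_eq_add_neg]
    exact add _ _ ((hu.h_mul i).smul c) (lower j _ ih).neg
  | add u v hu hv ihu ihv => rw [mul_add]; exact add _ _ ihu ihv

theorem all (lam : ℂ) (u : U) : IsOrdered lam u :=
  U_induction
    { carrier := {u | IsOrdered lam u}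
      zero_mem' := zero
      add_mem' := fun hu hv => add _ _ hu hv
      smul_mem' := fun c _ hu => hu.smul c }
    (by simpa using base (lam := lam) 1 0 (one_mem _) (zero_mem _))
    (fun i _ hu => E_mul hu i) (fun i u hu => lower i u hu) (fun i _ hu => h_mul hu i)
    (fun n _ hu => hinv_mul hu n) u

end IsOrdered

/-! ### Descent of the triangular decomposition from `U` to `A` -/

theorem bar_mem_dynScalars {r : U} (hr : r ∈ dynU) : bar r ∈ dynScalars := by
  suffices H : ∃ n : normI, (n : U) = r ∧ toA n ∈ dynScalars by
    obtain ⟨n, rfl, hn⟩ := H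
    rwa [bar_coe]
  induction hr using Algebra.adjoin_induction with
  | mem r hr =>
    rcases hr with rfl | ⟨n, rfl⟩
    · exact ⟨⟨_, X_h_mem_normI⟩, rfl, by rw [← HA_eq]; exact Algebra.subset_adjoin (by simp)⟩
    · exact ⟨⟨_, hinv_mem_normI n⟩, rfl, by
        rw [← HAinv_eq]; exact Algebra.subset_adjoin (by simp)⟩
  | algebraMap c => exact ⟨algebraMap ℂ _ c, rfl, by
      rw [AlgHom.commutes]; exact dynScalars.algebraMap_mem c⟩
  | add r s _ _ hr hs =>
    obtain ⟨n, rfl, hn⟩ := hr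
    obtain ⟨m, rfl, hm⟩ := hs
    exact ⟨n + m, rfl, by rw [map_add]; exact add_mem hn hm⟩
  | mul r s _ _ hr hs =>
    obtain ⟨n, rfl, hn⟩ := hr
    obtain ⟨m, rfl, hm⟩ := hs
    exact ⟨n * m, rfl, by rw [map_mul]; exact mul_mem hn hm⟩

theorem bar_mul_repP2 (u : U) : bar (u * xt .xp2) = bar u * xb .xp2 := by
  rw [xb_xp2_eq]; exact bar_mul_coe u ⟨repP2, repP2_mem⟩

theorem bar_mul_repP1 (u : U) : bar (u * repP1) = bar u * xb .xp1 := by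
  rw [xb_xp1_eq]; exact bar_mul_coe u ⟨repP1, repP1_mem⟩

theorem bar_mul_repH (u : U) : bar (u * repH) = bar u * xb .h := by
  rw [xb_h_eq]; exact bar_mul_coe u ⟨repH, repH_mem⟩

/-- `x̃_α` differs from its normalizer representative by a left multiple of `x̃_{2α}`, and `x̃_{2α}`
lies in the normalizer itself. -/
theorem bar_mul_xt_xp1_mem (lam : ℂ) (u : U) : bar (u * xt .xp1) ∈ vermaIdeal lam := by
  have : u * xt .xp1 = u * repP1 - (2 : ℂ) • (u * X .xm1 * hinv 0 * xt .xp2) := by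
    rw [repP1, mul_add, mul_smul_comm]; simp only [mul_assoc]; abel
  rw [this, bar_sub, bar_smul, bar_mul_repP1, bar_mul_repP2, ← smul_mul_assoc]
  exact sub_mem (Ideal.mul_mem_left _ _ (Ideal.subset_span (by simp)))
    (Ideal.mul_mem_left _ _ (Ideal.subset_span (by simp)))

theorem bar_mul_xt_h_mem (lam : ℂ) (u : U) :
    bar (u * (xt .h - algebraMap ℂ U lam)) ∈ vermaIdeal lam := by
  have : u * (xt .h - algebraMap ℂ U lam) = (u * repH - lam • u) + u * X .xm1 * hinv 0 * xt .xp1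
      - (2 : ℂ) • (u * X .xm1 * X .xm1 * hinv (-1) * xt .xp2) := by
    rw [repH, mul_sub, ← Algebra.commutes, ← Algebra.smul_def]
    simp only [mul_assoc, mul_add, mul_sub, mul_smul_comm]; abel
  rw [this, bar_sub, bar_add, bar_sub, bar_smul, bar_smul, bar_mul_repH, bar_mul_repP2,
    ← smul_mul_assoc, Algebra.smul_def lam, Algebra.commutes, ← mul_sub]
  exact sub_mem (add_mem (Ideal.mul_mem_left _ _ (Ideal.subset_span (by simp)))
    (bar_mul_xt_xp1_mem lam _)) (Ideal.mul_mem_left _ _ (Ideal.subset_span (by simp)))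

/-- Each `E i` is half of `X_α ± x̃_α`: the diagonal part disappears under `bar`, and the
antidiagonal part lands in the Verma ideal of `A`. -/
theorem bar_mem_vermaIdeal {lam : ℂ} {u : U} (hu : u ∈ bigVermaIdeal lam) :
    bar u ∈ vermaIdeal lam := by
  have key : ∀ v : U, bar (v * E 0) ∈ vermaIdeal lam ∧ bar (v * E 1) ∈ vermaIdeal lam := by
    intro v
    have h0 : v * E 0 = (1 / 2 : ℂ) • (v * X .xp1) + (1 / 2 : ℂ) • v * xt .xp1 := by
      rw [X_xp1, xt_xp1, smul_mul_assoc, mul_add, mul_sub]; module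
    have h1 : v * E 1 = (1 / 2 : ℂ) • (v * X .xp1) + (-1 / 2 : ℂ) • v * xt .xp1 := by
      rw [X_xp1, xt_xp1, smul_mul_assoc, mul_add, mul_sub]; module
    rw [h0, h1, bar_add, bar_add, bar_smul, bar_mul_X_xp1, smul_zero, zero_add, zero_add]
    exact ⟨bar_mul_xt_xp1_mem _ _, bar_mul_xt_xp1_mem _ _⟩
  obtain ⟨a, b, c, rfl⟩ := Submodule.mem_span_triple.1 hu
  simp only [smul_eq_mul, bar_add]
  exact add_mem (add_mem (key a).1 (key b).2) (bar_mul_xt_h_mem lam c)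

theorem xt_xm1_mul_X_xm1 :
    xt .xm1 * X .xm1 = (2 : ℂ) • xt .xm2 - X .xm1 * xt .xm1 := by
  have := F_one_mul_F_zero
  simp only [xt_xm1, X_xm1, xt_xm2, mul_add, add_mul, mul_sub, sub_mul, this]; module

theorem xt_xm2_mul_X_xm1 : xt .xm2 * X .xm1 = X .xm1 * xt .xm2 := by
  have h0 := F_one_mul_F_zero
  have h1 := F_one_mul_F_zero_assoc
  simp [X_xm1, xt_xm2, mul_add, add_mul, mul_sub, sub_mul, mul_assoc, h0, h1]; abel

theorem bar_mul_doubleI {g : U} {y : U} (hy : y ∈ doubleI) : ∃ w, bar (g * y) = bar (g * X .xm1 * w) := by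
  obtain ⟨v, w, rfl⟩ := mem_doubleI.1 hy
  exact ⟨w, by rw [mul_add, ← mul_assoc, ← mul_assoc, bar_add, bar_mul_X_xp1, zero_add]⟩

/-- `x̃_{-2α}` commutes with `X_{-α}`, so left multiplication by it preserves `II`. -/
theorem bar_xt_xm2_mul (u : U) : bar (xt .xm2 * u) = xb .xm2 * bar u := by
  obtain ⟨n, hn, hnu⟩ := exists_toA_eq_bar u
  obtain ⟨w, hw⟩ := bar_mul_doubleI (g := xt .xm2) hnu
  rw [xt_xm2_mul_X_xm1, mul_assoc, bar_X_xm1_mul, mul_sub, bar_sub, sub_eq_zero, bar_mul_coe] at hw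
  rw [← hw, hn, xb]

/-- Moving `x̃_{-α}` past `X_{-α}` leaves `2 x̃_{-2α}`, so left multiplication by `x̃_{-α}` descends
to `A` only up to `x̄_{-2α} A`. -/
theorem bar_xt_xm1_mul (u : U) : ∃ a, bar (xt .xm1 * u) = xb .xm1 * bar u + xb .xm2 * a := by
  obtain ⟨n, hn, hnu⟩ := exists_toA_eq_bar u
  obtain ⟨w, hw⟩ := bar_mul_doubleI (g := xt .xm1) hnu
  rw [xt_xm1_mul_X_xm1, sub_mul, mul_assoc (X .xm1), bar_sub, bar_X_xm1_mul, mul_sub, bar_sub,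
    sub_zero, bar_mul_coe, smul_mul_assoc, bar_smul, bar_xt_xm2_mul, hn] at hw
  refine ⟨(-2 : ℂ) • bar w, ?_⟩
  rw [mul_smul_comm, neg_smul, ← hw, xb]; abel

/-- The span of the ordered elements of `A`, modulo the left ideal that defines `M(lam)`. -/
def orderedA (lam : ℂ) : Submodule ℂ A :=
  Subalgebra.toSubmodule dynScalars ⊔ LinearMap.range (LinearMap.mulLeft ℂ (xb .xm1)) ⊔
    LinearMap.range (LinearMap.mulLeft ℂ (xb .xm2)) ⊔ (vermaIdeal lam).restrictScalars ℂ

theorem mem_orderedA {lam : ℂ} {a : A} : a ∈ orderedA lam ↔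
    ∃ r ∈ dynScalars, ∃ b c : A, ∃ d ∈ vermaIdeal lam, a = r + xb .xm1 * b + xb .xm2 * c + d := by
  simp only [orderedA, Submodule.mem_sup, LinearMap.mem_range, LinearMap.mulLeft_apply,
    Submodule.restrictScalars_mem]
  constructor
  · rintro ⟨_, ⟨_, ⟨r, hr, _, ⟨b, rfl⟩, rfl⟩, _, ⟨c, rfl⟩, rfl⟩, d, hd, rfl⟩
    exact ⟨r, hr, b, c, d, hd, rfl⟩
  · rintro ⟨r, hr, b, c, d, hd, rfl⟩
    exact ⟨_, ⟨_, ⟨r, hr, _, ⟨b, rfl⟩, rfl⟩, _, ⟨c, rfl⟩, rfl⟩, d, hd, rfl⟩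

/-- Ordered words upstairs have a lowering operator leftmost, and `bar` turns it into `x̄_{-α}` and
`x̄_{-2α}` terms on the left. Only spanning is asserted; the functionals below stand in for
independence. -/
theorem orderedA_eq_top (lam : ℂ) (a : A) : a ∈ orderedA lam := by
  obtain ⟨u, rfl⟩ := bar_surjective a
  induction IsOrdered.all lam u with
  | base r j hr hj =>
    exact mem_orderedA.2 ⟨bar r, bar_mem_dynScalars hr, 0, 0, bar j, bar_mem_vermaIdeal hj, by
      rw [bar_add]; simp⟩
  | lower i u hu ih =>
    have h0 : F 0 = (1 / 2 : ℂ) • X .xm1 + (1 / 2 : ℂ) • xt .xm1 := by rw [X_xm1, xt_xm1]; module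
    have h1 : F 1 = (1 / 2 : ℂ) • X .xm1 + (-1 / 2 : ℂ) • xt .xm1 := by rw [X_xm1, xt_xm1]; module
    have key : bar (xt .xm1 * u) ∈ orderedA lam := by
      obtain ⟨a, ha⟩ := bar_xt_xm1_mul u
      exact mem_orderedA.2 ⟨0, zero_mem _, bar u, a, 0, zero_mem _, by rw [ha]; simp⟩
    fin_cases i
    · change bar (F 0 * u) ∈ _
      rw [h0, add_mul, smul_mul_assoc, smul_mul_assoc, bar_add, bar_smul, bar_smul, bar_X_xm1_mul,
        smul_zero, zero_add]
      exact Submodule.smul_mem _ _ key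
    · change bar (F 1 * u) ∈ _
      rw [h1, add_mul, smul_mul_assoc, smul_mul_assoc, bar_add, bar_smul, bar_smul, bar_X_xm1_mul,
        smul_zero, zero_add]
      exact Submodule.smul_mem _ _ key
  | add u v hu hv ihu ihv => rw [bar_add]; exact add_mem ihu ihv

/-! ### Functionals that detect the kernel of the Shapovalov form -/

/-- Evaluation at `H = mu + 1` with remainder. It makes sense because no `H - n` vanishes there when
`mu` is not an integer. -/
theorem dynScalars_eval {mu : ℂ} (hmu : ∀ k : ℤ, mu ≠ k) {r : A} (hr : r ∈ dynScalars) :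
    ∃ c : ℂ, ∃ s ∈ dynScalars, r = algebraMap ℂ A c + (HA - 1 - algebraMap ℂ A mu) * s := by
  induction hr using Algebra.adjoin_induction with
  | mem r hr =>
    rcases hr with rfl | ⟨n, rfl⟩
    · refine ⟨mu + 1, 1, one_mem _, ?_⟩
      rw [map_add, map_one]; noncomm_ring
    · have hc : mu + 1 - n ≠ 0 := fun h0 => hmu (n - 1) (by push_cast; linear_combination h0)
      refine ⟨(mu + 1 - n)⁻¹, -((mu + 1 - n)⁻¹ • HAinv n),
        neg_mem (dynScalars.smul_mem (Algebra.subset_adjoin (by simp)) _), ?_⟩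
      have h1 := HA_sub_mul_HAinv n
      have h2 : HA - 1 - algebraMap ℂ A mu
          = (HA - (n : A)) - algebraMap ℂ A (mu + 1 - n) := by
        rw [map_sub, map_add, map_one, map_intCast]; noncomm_ring
      rw [h2, mul_neg, mul_smul_comm, sub_mul, h1, ← Algebra.smul_def, smul_sub, smul_smul,
        inv_mul_cancel₀ hc, Algebra.algebraMap_eq_smul_one]
      module
  | algebraMap c => exact ⟨c, 0, zero_mem _, by simp⟩
  | add r s _ _ hr hs =>
    obtain ⟨c, r', hr', h1⟩ := hr
    obtain ⟨d, s', hs', h2⟩ := hs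
    exact ⟨c + d, r' + s', add_mem hr' hs', by rw [map_add, h1, h2, mul_add]; abel⟩
  | mul r s hr0 hs0 hr hs =>
    obtain ⟨c, r', hr', h1⟩ := hr
    obtain ⟨d, s', hs', h2⟩ := hs
    refine ⟨c * d, c • s' + r' * s, add_mem (dynScalars.smul_mem hs' c) (mul_mem hr' hs0), ?_⟩
    have h3 : algebraMap ℂ A c * s = algebraMap ℂ A (c * d)
        + (HA - 1 - algebraMap ℂ A mu) * (c • s') := by
      rw [h2, mul_add, ← map_mul, mul_smul_comm, ← Algebra.smul_def]
    nth_rewrite 1 [h1]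
    rw [add_mul, h3, mul_add, mul_assoc]
    abel

/-- A functional on `A` that vanishes on the kernel of the projection of `A` to
`R / (H - 1 - mu)`, normalized to `1` at `1`. -/
structure IsHighestWeightFunctional (lam mu : ℂ) (χ : A →ₗ[ℂ] ℂ) : Prop where
  map_one : χ 1 = 1
  map_verma : ∀ a ∈ vermaIdeal lam, χ a = 0
  map_xm1 : ∀ a, χ (xb .xm1 * a) = 0
  map_xm2 : ∀ a, χ (xb .xm2 * a) = 0
  map_h : ∀ a, χ (xb .h * a) = lam * χ a
  map_dyn : ∀ r, χ ((HA - 1 - algebraMap ℂ A mu) * r) = 0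

namespace IsHighestWeightFunctional

variable {lam mu : ℂ} {χ : A →ₗ[ℂ] ℂ}

/-- By the ordered decomposition and `dynScalars_eval`, the preimage of `(H - 1 - mu)` together with
`1` spans `A`. As `χ` vanishes on this preimage but not at `1`, its kernel is the preimage. In
particular all such `χ` have the same kernel. -/
theorem toShapTarget_mem_iff (hmu : ∀ k : ℤ, mu ≠ k) (hχ : IsHighestWeightFunctional lam mu χ)
    (a : A) : toShapTarget lam a ∈ evalIdeal lam mu ↔ χ a = 0 := by
  constructor
  · rintro ⟨_, ⟨r, hr, rfl⟩, h1⟩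
    have h2 : a - (HA - 1 - algebraMap ℂ A mu) * r ∈
        oppVermaIdeal lam ⊔ (vermaIdeal lam).restrictScalars ℂ :=
      (Submodule.Quotient.eq _).1 h1.symm
    have h3 : oppVermaIdeal lam ⊔ (vermaIdeal lam).restrictScalars ℂ ≤ LinearMap.ker χ := by
      refine sup_le (sup_le (sup_le ?_ ?_) ?_) hχ.map_verma
      · rintro _ ⟨b, rfl⟩; exact hχ.map_xm1 b
      · rintro _ ⟨b, rfl⟩; exact hχ.map_xm2 b
      · rintro _ ⟨b, rfl⟩
        change χ ((xb .h - algebraMap ℂ A lam) * b) = 0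
        rw [sub_mul, map_sub, hχ.map_h, ← Algebra.smul_def, map_smul, smul_eq_mul, sub_self]
    have h4 := h3 h2
    rwa [LinearMap.mem_ker, map_sub, hχ.map_dyn, sub_zero] at h4
  · intro ha
    obtain ⟨r, hr, b, c, d, hd, h1⟩ := mem_orderedA.1 (orderedA_eq_top lam a)
    obtain ⟨k, s, hs, h2⟩ := dynScalars_eval hmu hr
    rw [h1, h2, map_add, map_add, map_add, map_add, hχ.map_dyn, hχ.map_xm1, hχ.map_xm2,
      hχ.map_verma d hd, Algebra.algebraMap_eq_smul_one, map_smul, hχ.map_one] at ha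
    simp only [add_zero, smul_eq_mul, mul_one] at ha
    refine ⟨_, ⟨s, hs, rfl⟩, ?_⟩
    refine ((Submodule.Quotient.eq _).2 ?_).symm
    have h3 : a - (HA - 1 - algebraMap ℂ A mu) * s = (xb .xm1 * b + xb .xm2 * c) + d := by
      rw [h1, h2, ha, map_zero]; abel
    change a - (HA - 1 - algebraMap ℂ A mu) * s ∈ _
    rw [h3]
    refine Submodule.add_mem_sup (Submodule.mem_sup_left ?_) hd
    exact Submodule.add_mem_sup ⟨b, rfl⟩ ⟨c, rfl⟩

theorem toL_eq_zero_iff (hmu : ∀ k : ℤ, mu ≠ k) (hχ : IsHighestWeightFunctional lam mu χ)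
    (a : A) : toL lam mu (toVerma lam a) = 0 ↔ ∀ b, χ (b * a) = 0 := by
  have h1 : toL lam mu (toVerma lam a) = 0 ↔ toVerma lam a ∈ shapKer lam mu :=
    Submodule.Quotient.mk_eq_zero _
  rw [h1]
  refine forall_congr' fun b => ?_
  rw [← hχ.toShapTarget_mem_iff hmu (b * a)]
  rfl

end IsHighestWeightFunctional

end Osp12

end

noncomputable section

namespace Osp12

/-! ### Representations of `U` from operators -/

section Operators

variable {B : Type*} [Ring B] [Algebra ℂ B]

/-- The basis of `osp(1|2)` in terms of the operators of `x_α`, `x_{-α}` and `h`. -/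
def opBasis (e f k : B) : Basis5 → B
  | .xp1 => e
  | .xm1 => f
  | .h => k
  | .xp2 => -(e * e)
  | .xm2 => f * f

/-- Three relations among `e`, `f`, `k` imply all brackets within one factor, since the other two
basis vectors are squares up to sign. -/
theorem opBasis_same {e f k : B} (hef : e * f = k - f * e) (hek : e * k = k * e + e)
    (hkf : k * f = f * k + f) (a b : Basis5) :
    opBasis e f k a * opBasis e f k b = sgn a b • (opBasis e f k b * opBasis e f k a)
      + (bracket a b).1 • opBasis e f k (bracket a b).2 := by
  have h1 : ∀ z, e * (f * z) = k * z - f * (e * z) := fun z => by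
    rw [mul_mul_of_eq hef, sub_mul, mul_assoc]
  have h2 : ∀ z, e * (k * z) = k * (e * z) + e * z := fun z => by
    rw [mul_mul_of_eq hek, add_mul, mul_assoc]
  have h3 : ∀ z, k * (f * z) = f * (k * z) + f * z := fun z => by
    rw [mul_mul_of_eq hkf, add_mul, mul_assoc]
  cases a <;> cases b <;>
    simp [opBasis, sgn, parity, bracket, mul_add, mul_sub, mul_assoc, hef, hek, hkf, h1, h2, h3] <;>
    module

theorem opBasis_cross {e f k e' f' k' : B} (hee : e * e' = -(e' * e)) (hef : e * f' = -(f' * e))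
    (hfe : f * e' = -(e' * f)) (hff : f * f' = -(f' * f)) (hek : e * k' = k' * e)
    (hfk : f * k' = k' * f) (hke : k * e' = e' * k) (hkf : k * f' = f' * k) (hkk : k * k' = k' * k)
    (a b : Basis5) :
    opBasis e f k a * opBasis e' f' k' b
      = sgn a b • (opBasis e' f' k' b * opBasis e f k a) := by
  have hee' : ∀ z, e * (e' * z) = -(e' * (e * z)) := fun z => by
    rw [mul_mul_of_eq hee, neg_mul, mul_assoc]
  have hef' : ∀ z, e * (f' * z) = -(f' * (e * z)) := fun z => by
    rw [mul_mul_of_eq hef, neg_mul, mul_assoc]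
  have hfe' : ∀ z, f * (e' * z) = -(e' * (f * z)) := fun z => by
    rw [mul_mul_of_eq hfe, neg_mul, mul_assoc]
  have hff' : ∀ z, f * (f' * z) = -(f' * (f * z)) := fun z => by
    rw [mul_mul_of_eq hff, neg_mul, mul_assoc]
  have hek' : ∀ z, e * (k' * z) = k' * (e * z) := fun z => by
    rw [mul_mul_of_eq hek, mul_assoc]
  have hfk' : ∀ z, f * (k' * z) = k' * (f * z) := fun z => by
    rw [mul_mul_of_eq hfk, mul_assoc]
  have hke' : ∀ z, k * (e' * z) = e' * (k * z) := fun z => by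
    rw [mul_mul_of_eq hke, mul_assoc]
  have hkf' : ∀ z, k * (f' * z) = f' * (k * z) := fun z => by
    rw [mul_mul_of_eq hkf, mul_assoc]
  cases a <;> cases b <;>
    simp [opBasis, sgn, parity, mul_assoc, hee, hef, hfe, hff, hek, hfk, hke, hkf, hkk,
      hee', hef', hfe', hff', hek', hfk', hke', hkf']

end Operators

/-! ### Tensor products of dual Verma modules of `osp(1|2)` -/

/-- The coefficients of the lowering operator of a dual Verma module of `osp(1|2)` with highest
weight `a`. -/
def lowCoef (a : ℂ) : ℕ → ℂ
  | 0 => 0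
  | k + 1 => a + k - lowCoef a k

theorem lowCoef_even_odd (a : ℂ) (m : ℕ) :
    lowCoef a (2 * m) = m ∧ lowCoef a (2 * m + 1) = a + m := by
  induction m with
  | zero => simp [lowCoef]
  | succ m ih =>
    have h1 : lowCoef a (2 * (m + 1)) = ((m + 1 : ℕ) : ℂ) := by
      change a + ((2 * m + 1 : ℕ) : ℂ) - lowCoef a (2 * m + 1) = _
      rw [ih.2]; push_cast; ring
    refine ⟨h1, ?_⟩
    change a + ((2 * (m + 1) : ℕ) : ℂ) - lowCoef a (2 * (m + 1)) = _
    rw [h1]; push_cast; ring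

/-- The space of functions of two natural numbers. -/
abbrev W : Type := ℕ → ℕ → ℂ

variable (p : Fin 2 → ℂ)

/-- The raising operators on `W`. -/
def opE : Fin 2 → Module.End ℂ W
  | 0 => { toFun := fun w i j => w (i + 1) j
           map_add' := fun _ _ => rfl
           map_smul' := fun _ _ => rfl }
  -- The factor `(-1) ^ i` is the Koszul sign for moving an odd operator past the first tensor
  -- factor.
  | 1 => { toFun := fun w i j => (-1) ^ i * w i (j + 1)
           map_add' := fun _ _ => by ext; simp [mul_add]
           map_smul' := fun _ _ => by ext; simp; ring }

/-- The lowering operators on `W`. -/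
def opF : Fin 2 → Module.End ℂ W
  -- At `i = 0` the truncated index `i - 1` is harmless because `lowCoef (p 0) 0 = 0`.
  | 0 => { toFun := fun w i j => lowCoef (p 0) i * w (i - 1) j
           map_add' := fun _ _ => by ext; simp [mul_add]
           map_smul' := fun _ _ => by ext; simp; ring }
  | 1 => { toFun := fun w i j => (-1) ^ i * (lowCoef (p 1) j * w i (j - 1))
           map_add' := fun _ _ => by ext; simp [mul_add]
           map_smul' := fun _ _ => by ext; simp; ring }

/-- The Cartan operators on `W`. -/
def opH : Fin 2 → Module.End ℂ W
  | 0 => { toFun := fun w i j => (p 0 + i) * w i j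
           map_add' := fun _ _ => by ext; simp [mul_add]
           map_smul' := fun _ _ => by ext; simp; ring }
  | 1 => { toFun := fun w i j => (p 1 + j) * w i j
           map_add' := fun _ _ => by ext; simp [mul_add]
           map_smul' := fun _ _ => by ext; simp; ring }

/-- The inverse of `H - n` on `W`. -/
def opHinv (n : ℤ) : Module.End ℂ W where
  toFun := fun w i j => (p 0 + p 1 + i + j - n)⁻¹ * w i j
  map_add' := fun _ _ => by ext; simp [mul_add]
  map_smul' := fun _ _ => by ext; simp; ring

theorem opE_zero_apply (w : W) (i j : ℕ) : opE 0 w i j = w (i + 1) j := rfl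
theorem opE_one_apply (w : W) (i j : ℕ) : opE 1 w i j = (-1) ^ i * w i (j + 1) := rfl
theorem opF_zero_apply (w : W) (i j : ℕ) : opF p 0 w i j = lowCoef (p 0) i * w (i - 1) j := rfl
theorem opF_one_apply (w : W) (i j : ℕ) :
    opF p 1 w i j = (-1) ^ i * (lowCoef (p 1) j * w i (j - 1)) := rfl
theorem opH_zero_apply (w : W) (i j : ℕ) : opH p 0 w i j = (p 0 + i) * w i j := rfl
theorem opH_one_apply (w : W) (i j : ℕ) : opH p 1 w i j = (p 1 + j) * w i j := rfl
theorem opHinv_apply (n : ℤ) (w : W) (i j : ℕ) :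
    opHinv p n w i j = (p 0 + p 1 + i + j - n)⁻¹ * w i j := rfl

/-- The operators of the generators of `U` on `W`. -/
def opGen : Gen → Module.End ℂ W
  | .x i a => opBasis (opE i) (opF p i) (opH p i) a
  | .hinv n => opHinv p n

/-- The representation on `W` of the free algebra on the generators of `U`. -/
def repFree : FreeAlgebra ℂ Gen →ₐ[ℂ] Module.End ℂ W := FreeAlgebra.lift ℂ (opGen p)

theorem repFree_fg (g : Gen) : repFree p (fg g) = opGen p g := by
  simp [repFree, fg]

theorem neg_one_pow_mul_self_mul (i : ℕ) (z : ℂ) : (-1) ^ i * ((-1) ^ i * z) = z := by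
  rw [← mul_assoc, ← mul_pow]; simp

variable {p}

theorem opGen_same (i : Fin 2) (a b : Basis5) :
    opGen p (.x i a) * opGen p (.x i b) = sgn a b • (opGen p (.x i b) * opGen p (.x i a))
      + (bracket a b).1 • opGen p (.x i (bracket a b).2) := by
  fin_cases i
  · refine opBasis_same ?_ ?_ ?_ a b
    · ext w i j
      simp only [Fin.zero_eta, Module.End.mul_apply, LinearMap.sub_apply, Pi.sub_apply,
        opE_zero_apply, opF_zero_apply, opH_zero_apply]
      cases i <;> simp [lowCoef]
      ring
    · ext w i j
      simp only [Fin.zero_eta, Module.End.mul_apply, LinearMap.add_apply, Pi.add_apply,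
        opE_zero_apply, opH_zero_apply]
      push_cast; ring
    · ext w i j
      simp only [Fin.zero_eta, Module.End.mul_apply, LinearMap.add_apply, Pi.add_apply,
        opF_zero_apply, opH_zero_apply]
      cases i <;> simp [lowCoef]
      ring
  · refine opBasis_same ?_ ?_ ?_ a b
    · ext w i j
      simp only [Fin.mk_one, Module.End.mul_apply, LinearMap.sub_apply, Pi.sub_apply,
        opE_one_apply, opF_one_apply, opH_one_apply]
      cases j <;> simp [lowCoef, mul_left_comm _ ((-1 : ℂ) ^ i), neg_one_pow_mul_self_mul]
      ring
    · ext w i j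
      simp only [Fin.mk_one, Module.End.mul_apply, LinearMap.add_apply, Pi.add_apply,
        opE_one_apply, opH_one_apply]
      push_cast; ring
    · ext w i j
      simp only [Fin.mk_one, Module.End.mul_apply, LinearMap.add_apply, Pi.add_apply,
        opF_one_apply, opH_one_apply]
      cases j <;> simp [lowCoef]
      ring

theorem opGen_cross {i j : Fin 2} (hij : i ≠ j) (a b : Basis5) :
    opGen p (.x i a) * opGen p (.x j b) = sgn a b • (opGen p (.x j b) * opGen p (.x i a)) := by
  have hee : opE 0 * opE 1 = -(opE 1 * opE 0) := by
    ext w i j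
    simp only [Module.End.mul_apply, LinearMap.neg_apply, Pi.neg_apply, opE_zero_apply,
      opE_one_apply]
    ring
  have hef : opE 0 * opF p 1 = -(opF p 1 * opE 0) := by
    ext w i j
    simp only [Module.End.mul_apply, LinearMap.neg_apply, Pi.neg_apply, opE_zero_apply,
      opF_one_apply]
    ring
  have hfe : opF p 0 * opE 1 = -(opE 1 * opF p 0) := by
    ext w i j
    simp only [Module.End.mul_apply, LinearMap.neg_apply, Pi.neg_apply, opF_zero_apply,
      opE_one_apply]
    cases i <;> simp [lowCoef]
    ring
  have hff : opF p 0 * opF p 1 = -(opF p 1 * opF p 0) := by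
    ext w i j
    simp only [Module.End.mul_apply, LinearMap.neg_apply, Pi.neg_apply, opF_zero_apply,
      opF_one_apply]
    cases i <;> simp [lowCoef]
    ring
  have hek : opE 0 * opH p 1 = opH p 1 * opE 0 := by
    ext w i j
    simp only [Module.End.mul_apply, opE_zero_apply, opH_one_apply]
  have hfk : opF p 0 * opH p 1 = opH p 1 * opF p 0 := by
    ext w i j
    simp only [Module.End.mul_apply, opF_zero_apply, opH_one_apply]
    ring
  have hke : opH p 0 * opE 1 = opE 1 * opH p 0 := by
    ext w i j
    simp only [Module.End.mul_apply, opE_one_apply, opH_zero_apply]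
    ring
  have hkf : opH p 0 * opF p 1 = opF p 1 * opH p 0 := by
    ext w i j
    simp only [Module.End.mul_apply, opF_one_apply, opH_zero_apply]
    ring
  have hkk : opH p 0 * opH p 1 = opH p 1 * opH p 0 := by
    ext w i j
    simp only [Module.End.mul_apply, opH_one_apply, opH_zero_apply]
    ring
  fin_cases i <;> fin_cases j
  · exact absurd rfl hij
  · exact opBasis_cross hee hef hfe hff hek hfk hke hkf hkk a b
  · exact opBasis_cross (by rw [hee, neg_neg]) (by rw [hfe, neg_neg]) (by rw [hef, neg_neg])
      (by rw [hff, neg_neg]) hke.symm hkf.symm hek.symm hfk.symm hkk.symm a b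
  · exact absurd rfl hij

/-- At `(i, j)` the element `H - n` acts by `p 0 + p 1 + i + j - n`, which is never zero because `p
0 + p 1` is not an integer. -/
theorem repFree_rel (hp : ∀ k : ℤ, p 0 + p 1 ≠ k) ⦃a b : FreeAlgebra ℂ Gen⦄ (hab : Rel a b) :
    repFree p a = repFree p b := by
  have hne : ∀ (n : ℤ) (i j : ℕ), p 0 + p 1 + i + j - n ≠ 0 := fun n i j h0 =>
    hp (n - i - j) (by push_cast; linear_combination h0)
  have key : ∀ (n : ℤ) (w : W) (i j : ℕ), repFree p (freeH - (n : FreeAlgebra ℂ Gen)) w i j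
      = (p 0 + p 1 + i + j - n) * w i j := by
    intro n w i j
    rw [freeH, map_sub, map_add, repFree_fg, repFree_fg, map_intCast]
    have hn : ((n : Module.End ℂ W) w) i j = n * w i j := by
      rw [← map_intCast (algebraMap ℂ (Module.End ℂ W))]
      simp
    simp only [LinearMap.sub_apply, LinearMap.add_apply, Pi.sub_apply, Pi.add_apply, hn]
    change (p 0 + i) * w i j + (p 1 + j) * w i j - _ = _
    ring
  cases hab with
  | same i a b => simpa only [map_add, map_mul, map_smul, repFree_fg] using opGen_same i a b
  | cross i j hij a b => simpa only [map_mul, map_smul, repFree_fg] using opGen_cross hij a b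
  | mul_hinv n =>
    ext w i j
    rw [map_mul, Module.End.mul_apply, key, repFree_fg, map_one]
    exact mul_inv_cancel_left₀ (hne n i j) _
  | hinv_mul n =>
    ext w i j
    rw [map_mul, Module.End.mul_apply, repFree_fg, map_one]
    change (p 0 + p 1 + i + j - n)⁻¹ * _ = _
    rw [key]
    exact inv_mul_cancel_left₀ (hne n i j) _

/-- The representation of `U` on `W`. -/
def rep (hp : ∀ k : ℤ, p 0 + p 1 ≠ k) : U →ₐ[ℂ] Module.End ℂ W :=
  RingQuot.liftAlgHom ℂ ⟨repFree p, repFree_rel hp⟩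

variable (hp : ∀ k : ℤ, p 0 + p 1 ≠ k)

theorem rep_toU (a : FreeAlgebra ℂ Gen) : rep hp (toU a) = repFree p a :=
  RingQuot.liftAlgHom_mkAlgHom_apply ℂ (repFree p) (repFree_rel hp) a

theorem rep_E (i : Fin 2) : rep hp (E i) = opE i := (rep_toU hp _).trans (repFree_fg p _)
theorem rep_F (i : Fin 2) : rep hp (F i) = opF p i := (rep_toU hp _).trans (repFree_fg p _)
theorem rep_h (i : Fin 2) : rep hp (h i) = opH p i := (rep_toU hp _).trans (repFree_fg p _)
theorem rep_hinv (n : ℤ) : rep hp (hinv n) = opHinv p n := (rep_toU hp _).trans (repFree_fg p _)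

end Osp12

end

noncomputable section

namespace Osp12

variable {p : Fin 2 → ℂ}

/-! ### The map `A → W` given by the highest weight vector -/

/-- The basis function of `W` at `(i, j)`. -/
def delta (i j : ℕ) : W := fun i' j' => if i' = i ∧ j' = j then 1 else 0

theorem delta_apply (i j i' j' : ℕ) : delta i j i' j' = if i' = i ∧ j' = j then 1 else 0 := rfl

theorem opE_delta_zero (i : Fin 2) : opE i (delta 0 0) = 0 := by
  ext i' j'
  fin_cases i
  · simp [opE_zero_apply, delta_apply]
  · simp [opE_one_apply, delta_apply]

theorem opF_zero_delta (i j : ℕ) : opF p 0 (delta i j) = lowCoef (p 0) (i + 1) • delta (i + 1) j := by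
  ext i' j'
  cases i' <;> simp [opF_zero_apply, delta_apply, lowCoef]
  split_ifs with h1
  · rw [h1.1]
  · rfl

theorem opF_one_delta (i j : ℕ) :
    opF p 1 (delta i j) = ((-1) ^ i * lowCoef (p 1) (j + 1)) • delta i (j + 1) := by
  ext i' j'
  cases j' <;> simp [opF_one_apply, delta_apply, lowCoef]
  split_ifs with h1
  · rw [h1.1, h1.2]
  · rfl

theorem opF_apply_zero_zero (i : Fin 2) (w : W) : opF p i w 0 0 = 0 := by
  fin_cases i
  · simp [opF_zero_apply, lowCoef]
  · simp [opF_one_apply, lowCoef]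

section Rep

variable (hp : ∀ k : ℤ, p 0 + p 1 ≠ k)

theorem rep_X_xp1_delta : rep hp (X .xp1) (delta 0 0) = 0 := by
  rw [X_xp1, map_add, rep_E, rep_E, LinearMap.add_apply, opE_delta_zero, opE_delta_zero, add_zero]

theorem rep_mem_leftI {u : U} (hu : u ∈ leftI) {w : W} (hw : rep hp (X .xp1) w = 0) :
    rep hp u w = 0 := by
  obtain ⟨v, rfl⟩ := mem_leftI.1 hu
  rw [map_mul, Module.End.mul_apply, hw, map_zero]

theorem rep_X_h_apply (w : W) (i j : ℕ) :
    rep hp (X .h) w i j = (p 0 + p 1 + i + j) * w i j := by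
  rw [X_h, map_add, rep_h, rep_h]
  change (p 0 + i) * w i j + (p 1 + j) * w i j = _
  ring

/-- Lowering operators produce nothing at `(0, 0)`. On a singular vector the leading coefficient
therefore depends only on the class of `u` in `U/II`, that is, on `bar u`. -/
theorem rep_mem_doubleI {u : U} (hu : u ∈ doubleI) {w : W} (hw : rep hp (X .xp1) w = 0) :
    rep hp u w 0 0 = 0 := by
  obtain ⟨v, v', rfl⟩ := mem_doubleI.1 hu
  rw [map_add, map_mul, map_mul, LinearMap.add_apply, Module.End.mul_apply, hw, map_zero, zero_add,
    Module.End.mul_apply, X_xm1, map_add, rep_F, rep_F]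
  simp only [LinearMap.add_apply, Pi.add_apply, opF_apply_zero_zero, add_zero]

/-- The map `A → W` that sends `n + I` to the image of the highest weight vector under `n`. -/
def evA : A →ₗ[ℂ] W :=
  (idealI.restrictScalars ℂ).liftQ
    (LinearMap.applyₗ (delta 0 0) ∘ₗ (rep hp).toLinearMap ∘ₗ normI.val.toLinearMap)
    (fun _ hn => rep_mem_leftI hp hn (rep_X_xp1_delta hp))

theorem evA_toA (n : normI) : evA hp (toA n) = rep hp n (delta 0 0) := rfl

theorem evA_toA_mul (n : normI) (a : A) : evA hp (toA n * a) = rep hp n (evA hp a) := by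
  obtain ⟨m, rfl⟩ := toA_surjective a
  rw [← map_mul, evA_toA, evA_toA, Subalgebra.coe_mul, map_mul, Module.End.mul_apply]

theorem rep_X_xp1_evA (a : A) : rep hp (X .xp1) (evA hp a) = 0 := by
  obtain ⟨m, rfl⟩ := toA_surjective a
  rw [evA_toA, ← Module.End.mul_apply, ← map_mul]
  exact rep_mem_leftI hp (mem_normI.1 m.2) (rep_X_xp1_delta hp)

theorem evA_one : evA hp 1 = delta 0 0 := by
  rw [← map_one toA, evA_toA]; simp

theorem evA_bar_mul_apply (u : U) (a : A) :
    evA hp (bar u * a) 0 0 = rep hp u (evA hp a) 0 0 := by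
  obtain ⟨n, hn, hnu⟩ := exists_toA_eq_bar u
  rw [← hn, evA_toA_mul, ← sub_eq_zero]
  have := rep_mem_doubleI hp hnu (rep_X_xp1_evA hp a)
  rwa [map_sub] at this

theorem evA_mul_eq_zero {a : A} (ha : evA hp a = 0) (b : A) : evA hp (b * a) = 0 := by
  obtain ⟨n, rfl⟩ := toA_surjective b
  rw [evA_toA_mul, ha, map_zero]

theorem evA_xb_xp2 : evA hp (xb .xp2) = 0 := by
  rw [xb_xp2_eq, evA_toA]
  simp [repP2, xt_xp2, rep_E, opE_delta_zero]

theorem rep_xt_xp2_delta : rep hp (xt .xp2) (delta 0 0) = 0 := by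
  simp [xt_xp2, rep_E, opE_delta_zero]

theorem rep_xt_xp1_delta : rep hp (xt .xp1) (delta 0 0) = 0 := by
  simp [xt_xp1, rep_E, opE_delta_zero]

theorem evA_xb_xp1 : evA hp (xb .xp1) = 0 := by
  rw [xb_xp1_eq, evA_toA]
  simp [repP1, rep_xt_xp1_delta, rep_xt_xp2_delta]

theorem evA_xb_h : evA hp (xb .h) = (p 0 - p 1) • delta 0 0 := by
  rw [xb_h_eq, evA_toA]
  simp only [repH, map_add, map_sub, map_mul, map_smul, LinearMap.add_apply, LinearMap.sub_apply,
    LinearMap.smul_apply, Module.End.mul_apply, rep_xt_xp1_delta, rep_xt_xp2_delta, map_zero,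
    smul_zero, sub_zero, add_zero]
  rw [xt_h, map_sub, rep_h, rep_h]
  ext i j
  change (p 0 + i) * delta 0 0 i j - (p 1 + j) * delta 0 0 i j = (p 0 - p 1) * delta 0 0 i j
  by_cases hij : i = 0 ∧ j = 0
  · rw [hij.1, hij.2]; push_cast; ring
  · simp [delta_apply, hij]

theorem evA_HA : evA hp HA = (p 0 + p 1) • delta 0 0 := by
  rw [HA_eq, evA_toA]
  ext i j
  rw [rep_X_h_apply]
  change _ = (p 0 + p 1) * delta 0 0 i j
  by_cases hij : i = 0 ∧ j = 0
  · rw [hij.1, hij.2]; push_cast; ring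
  · simp [delta_apply, hij]

/-- The coefficient of the highest weight vector. -/
def chi : A →ₗ[ℂ] ℂ where
  toFun := fun a => evA hp a 0 0
  map_add' := fun a b => by rw [map_add]; rfl
  map_smul' := fun c a => by rw [map_smul]; rfl

theorem chi_apply (a : A) : chi hp a = evA hp a 0 0 := rfl

variable {lam mu : ℂ}

theorem evA_mem_vermaIdeal (hlam : p 0 - p 1 = lam) {a : A} (ha : a ∈ vermaIdeal lam) :
    evA hp a = 0 := by
  obtain ⟨b, c, d, rfl⟩ := Submodule.mem_span_triple.1 ha
  simp only [smul_eq_mul, map_add]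
  rw [evA_mul_eq_zero hp (evA_xb_xp1 hp), evA_mul_eq_zero hp (evA_xb_xp2 hp),
    evA_mul_eq_zero hp, add_zero, add_zero]
  rw [map_sub, evA_xb_h, hlam, Algebra.algebraMap_eq_smul_one, map_smul, evA_one, sub_self]

theorem isHighestWeightFunctional_chi (hlam : p 0 - p 1 = lam) (hmu : p 0 + p 1 = mu + 1) :
    IsHighestWeightFunctional lam mu (chi hp) where
  map_one := by rw [chi_apply, evA_one]; simp [delta_apply]
  map_verma := fun a ha => by rw [chi_apply, evA_mem_vermaIdeal hp hlam ha]; rfl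
  map_xm1 := fun a => by
    rw [chi_apply, xb, evA_bar_mul_apply, xt_xm1, map_sub, rep_F, rep_F]
    simp only [LinearMap.sub_apply, Pi.sub_apply, opF_apply_zero_zero, sub_zero]
  map_xm2 := fun a => by
    rw [chi_apply, xb, evA_bar_mul_apply, xt_xm2, map_sub, map_mul, map_mul, rep_F, rep_F]
    simp only [LinearMap.sub_apply, Pi.sub_apply, Module.End.mul_apply, opF_apply_zero_zero,
      sub_zero]
  map_h := fun a => by
    rw [chi_apply, chi_apply, xb, evA_bar_mul_apply, xt_h, map_sub, rep_h, rep_h]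
    change (p 0 + (0 : ℕ)) * evA hp a 0 0 - (p 1 + (0 : ℕ)) * evA hp a 0 0 = _
    rw [← hlam]; push_cast; ring
  map_dyn := fun a => by
    have h1 : (HA - 1 - algebraMap ℂ A mu) * a = HA * a - (mu + 1) • a := by
      rw [sub_mul, sub_mul, one_mul, ← Algebra.smul_def]; module
    rw [h1, map_sub, map_smul, chi_apply, chi_apply, HA, evA_bar_mul_apply, rep_X_h_apply, ← hmu]
    simp

/-- Raising operators are shifts, so `E 1 ^ j * E 0 ^ i` brings the value at `(i, j)` to `(0, 0)`.
Passing to `bar` does not change the leading coefficient, hence `χ` sees every value of `a δ`. -/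
theorem evA_eq_zero_iff (a : A) : evA hp a = 0 ↔ ∀ b, chi hp (b * a) = 0 := by
  constructor
  · intro ha b
    rw [chi_apply, evA_mul_eq_zero hp ha]; rfl
  · intro ha
    ext i j
    have hE0 : ∀ (k : ℕ) (w : W) (i' j' : ℕ), (opE 0 ^ k) w i' j' = w (i' + k) j' := by
      intro k
      induction k with
      | zero => intro w i' j'; simp
      | succ k ih =>
        intro w i' j'
        rw [pow_succ, Module.End.mul_apply, ih, opE_zero_apply, add_assoc]
    -- Only row `0` is needed, where the Koszul sign is trivial.
    have hE1 : ∀ (k : ℕ) (w : W) (j' : ℕ), (opE 1 ^ k) w 0 j' = w 0 (j' + k) := by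
      intro k
      induction k with
      | zero => intro w j'; simp
      | succ k ih =>
        intro w j'
        rw [pow_succ, Module.End.mul_apply, ih, opE_one_apply, pow_zero, one_mul, add_assoc]
    have h1 := ha (bar (E 1 ^ j * E 0 ^ i))
    rw [chi_apply, evA_bar_mul_apply, map_mul, map_pow, map_pow, rep_E, rep_E, Module.End.mul_apply,
      hE1, hE0, zero_add, zero_add] at h1
    exact h1

/-! ### The image of `A` in `W` -/

/-- The representation of `U` on `W`, as a module structure. -/
abbrev moduleW : Module U W := Module.compHom W (rep hp).toRingHom

/-- The vectors obtained from `v` and from a normalizer representative of `bar v` are both singular,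
and they differ by an element of `X_{-α} U δ`. On `U δ` the operator `X_α` is locally nilpotent, so
the difference is zero. -/
theorem evA_bar_of_singular {v : U} (hv : rep hp (X .xp1) (rep hp v (delta 0 0)) = 0) :
    evA hp (bar v) = rep hp v (delta 0 0) := by
  obtain ⟨n, hn, hnv⟩ := exists_toA_eq_bar v
  obtain ⟨y, z, hyz⟩ := mem_doubleI.1 hnv
  let _ : Module U W := moduleW hp
  have hsm : ∀ (u : U) (w : W), u • w = rep hp u w := fun _ _ => rfl
  have h0 : ∃ n : ℕ, eSq ^ n • delta 0 0 = 0 := by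
    refine ⟨1, ?_⟩
    rw [hsm, pow_one, eSq, map_mul, Module.End.mul_apply, rep_X_xp1_delta, map_zero]
  have h1 := eSq_nilpotent_smul h0 z
  have h2 : X .xm1 • z • delta 0 0 = rep hp n (delta 0 0) - rep hp v (delta 0 0) := by
    rw [← LinearMap.sub_apply, ← map_sub, hyz, hsm, hsm, map_add, map_mul, map_mul,
      LinearMap.add_apply, Module.End.mul_apply, Module.End.mul_apply, rep_X_xp1_delta, map_zero,
      zero_add]
  have h3 := X_xm1_smul_eq_zero h1 (by
    rw [h2, hsm, map_sub, hv, ← evA_toA, rep_X_xp1_evA, sub_zero])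
  rw [h2, sub_eq_zero] at h3
  rw [← hn, evA_toA, h3]

/-- Indices of the basis vectors in the simple submodule of a dual Verma module of `osp(1|2)`. -/
def IsReachable (a : ℂ) (i : ℕ) : Prop := ∀ k < i, lowCoef a (k + 1) ≠ 0

theorem IsReachable.zero (a : ℂ) : IsReachable a 0 := fun k hk => absurd hk k.not_lt_zero

theorem IsReachable.of_le {a : ℂ} {i j : ℕ} (hj : IsReachable a j) (hij : i ≤ j) :
    IsReachable a i := fun k hk => hj k (by omega)

theorem isReachable_succ {a : ℂ} {i : ℕ} (hi : IsReachable a i) (h : lowCoef a (i + 1) ≠ 0) :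
    IsReachable a (i + 1) := fun k hk => by
  rcases Nat.lt_succ_iff_lt_or_eq.1 hk with h1 | rfl
  · exact hi k h1
  · exact h

variable (p) in
/-- The functions with finite support in the set of pairs of reachable indices. -/
def simpleW : Submodule ℂ W where
  carrier := {w | (∃ N, ∀ i j, N ≤ i + j → w i j = 0) ∧
    ∀ i j, w i j ≠ 0 → IsReachable (p 0) i ∧ IsReachable (p 1) j}
  zero_mem' := ⟨⟨0, fun _ _ _ => rfl⟩, fun i j hij => absurd rfl hij⟩
  add_mem' := by
    rintro w w' ⟨⟨N, hN⟩, hw⟩ ⟨⟨N', hN'⟩, hw'⟩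
    refine ⟨⟨max N N', fun i j hij => ?_⟩, fun i j hij => ?_⟩
    · change w i j + w' i j = 0
      rw [hN i j (le_trans (le_max_left _ _) hij), hN' i j (le_trans (le_max_right _ _) hij),
        add_zero]
    · by_cases h0 : w i j = 0
      · refine hw' i j fun h1 => hij ?_
        change w i j + w' i j = 0
        rw [h0, h1, add_zero]
      · exact hw i j h0
  smul_mem' := by
    rintro c w ⟨⟨N, hN⟩, hw⟩
    refine ⟨⟨N, fun i j hij => ?_⟩, fun i j hij => hw i j fun h0 => hij ?_⟩
    · change c * w i j = 0
      rw [hN i j hij, mul_zero]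
    · change c * w i j = 0
      rw [h0, mul_zero]

/-- Lowering from index `k` to `k + 1` multiplies by `lowCoef a (k + 1)`, so nothing passes the
first zero coefficient; the other generators do not increase the indices. -/
theorem rep_delta_mem_simpleW (u : U) : rep hp u (delta 0 0) ∈ simpleW p := by
  refine U_induction ((simpleW p).comap (LinearMap.applyₗ (delta 0 0) ∘ₗ (rep hp).toLinearMap))
    ?_ ?_ ?_ ?_ ?_ u
  · change rep hp 1 (delta 0 0) ∈ simpleW p
    rw [map_one, Module.End.one_apply]
    refine ⟨⟨1, fun i j hij => if_neg (by omega)⟩, fun i j hij => ?_⟩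
    rw [delta_apply, ne_eq, ite_eq_right_iff, Classical.not_imp] at hij
    rw [hij.1.1, hij.1.2]
    exact ⟨.zero _, .zero _⟩
  all_goals
    intro k u hu
    change rep hp u (delta 0 0) ∈ simpleW p at hu
    change rep hp (_ * u) (delta 0 0) ∈ simpleW p
    rw [map_mul, Module.End.mul_apply]
    generalize rep hp u (delta 0 0) = w at hu
    obtain ⟨⟨N, hN⟩, hw⟩ := hu
  · rw [rep_E]
    fin_cases k
    · exact ⟨⟨N, fun i j hij => hN _ _ (by omega)⟩, fun i j hij =>
        ⟨(hw _ _ hij).1.of_le (by omega), (hw _ _ hij).2⟩⟩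
    · refine ⟨⟨N, fun i j hij => ?_⟩, fun i j hij => ?_⟩
      · change (-1) ^ i * w i (j + 1) = 0
        rw [hN _ _ (by omega), mul_zero]
      · have := hw i (j + 1) (right_ne_zero_of_mul hij)
        exact ⟨this.1, this.2.of_le (by omega)⟩
  · rw [rep_F]
    fin_cases k
    · refine ⟨⟨N + 1, fun i j hij => ?_⟩, fun i j hij => ?_⟩
      · change lowCoef (p 0) i * w (i - 1) j = 0
        rw [hN _ _ (by omega), mul_zero]
      · change lowCoef (p 0) i * w (i - 1) j ≠ 0 at hij
        cases i with
        | zero => simp [lowCoef] at hij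
        | succ i =>
          have := hw _ _ (right_ne_zero_of_mul hij)
          exact ⟨isReachable_succ this.1 (left_ne_zero_of_mul hij), this.2⟩
    · refine ⟨⟨N + 1, fun i j hij => ?_⟩, fun i j hij => ?_⟩
      · change (-1) ^ i * (lowCoef (p 1) j * w i (j - 1)) = 0
        rw [hN _ _ (by omega), mul_zero, mul_zero]
      · change (-1) ^ i * (lowCoef (p 1) j * w i (j - 1)) ≠ 0 at hij
        replace hij := right_ne_zero_of_mul hij
        cases j with
        | zero => simp [lowCoef] at hij
        | succ j =>
          have := hw _ _ (right_ne_zero_of_mul hij)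
          exact ⟨this.1, isReachable_succ this.2 (left_ne_zero_of_mul hij)⟩
  · rw [rep_h]
    fin_cases k
    · refine ⟨⟨N, fun i j hij => ?_⟩, fun i j hij => ?_⟩
      · change (p 0 + i) * w i j = 0
        rw [hN _ _ hij, mul_zero]
      · exact hw _ _ (right_ne_zero_of_mul hij)
    · refine ⟨⟨N, fun i j hij => ?_⟩, fun i j hij => ?_⟩
      · change (p 1 + j) * w i j = 0
        rw [hN _ _ hij, mul_zero]
      · exact hw _ _ (right_ne_zero_of_mul hij)
  · rw [rep_hinv]
    refine ⟨⟨N, fun i j hij => ?_⟩, fun i j hij => ?_⟩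
    · rw [opHinv_apply, hN _ _ hij, mul_zero]
    · exact hw _ _ (right_ne_zero_of_mul hij)

theorem evA_mem_simpleW (a : A) : evA hp a ∈ simpleW p := by
  obtain ⟨n, rfl⟩ := toA_surjective a
  exact rep_delta_mem_simpleW hp n

theorem exists_rep_eq_delta {i j : ℕ} (hi : IsReachable (p 0) i) (hj : IsReachable (p 1) j) :
    ∃ u, rep hp u (delta 0 0) = delta i j := by
  induction i with
  | zero =>
    induction j with
    | zero => exact ⟨1, by simp⟩
    | succ j ih =>
      obtain ⟨u, hu⟩ := ih (hj.of_le (by omega))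
      refine ⟨(lowCoef (p 1) (j + 1))⁻¹ • (F 1 * u), ?_⟩
      rw [map_smul, map_mul, LinearMap.smul_apply, Module.End.mul_apply, hu, rep_F, opF_one_delta,
        smul_smul, pow_zero, one_mul, inv_mul_cancel₀ (hj j (by omega)), one_smul]
  | succ i ih =>
    obtain ⟨u, hu⟩ := ih (hi.of_le (by omega))
    refine ⟨(lowCoef (p 0) (i + 1))⁻¹ • (F 0 * u), ?_⟩
    rw [map_smul, map_mul, LinearMap.smul_apply, Module.End.mul_apply, hu, rep_F, opF_zero_delta,
      smul_smul, inv_mul_cancel₀ (hi i (by omega)), one_smul]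

/-- The alternating sign in the singular vectors of `W`. -/
def eps : ℕ → ℂ
  | 0 => 1
  | i + 1 => -((-1) ^ i * eps i)

/-- Being singular is a recursion along each antidiagonal `i + j = k`, so there is at most a line of
singular vectors in each degree. -/
theorem eq_eps_mul_of_singular {w : W} (hw : rep hp (X .xp1) w = 0) (i j : ℕ) :
    w i j = eps i * w 0 (i + j) := by
  induction i generalizing j with
  | zero => simp [eps]
  | succ i ih =>
    have h1 : w (i + 1) j + (-1) ^ i * w i (j + 1) = 0 := by
      rw [X_xp1, map_add, rep_E, rep_E] at hw
      exact congrFun (congrFun hw i) j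
    rw [eq_neg_of_add_eq_zero_left h1, ih, eps, show i + (j + 1) = i + 1 + j by ring]
    ring

theorem eps_ne_zero (i : ℕ) : eps i ≠ 0 := by
  induction i with
  | zero => simp [eps]
  | succ i ih => simp [eps, ih]

/-- The singular vector of degree `k` in `W`. -/
def singularW (k : ℕ) : W := fun i j => if i + j = k then eps i else 0

theorem rep_X_xp1_singularW (k : ℕ) : rep hp (X .xp1) (singularW k) = 0 := by
  rw [X_xp1, map_add, rep_E, rep_E]
  ext i j
  change singularW k (i + 1) j + (-1) ^ i * singularW k i (j + 1) = 0
  simp only [singularW, show i + 1 + j = i + (j + 1) by ring]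
  split_ifs
  · rw [eps]; ring
  · simp

theorem singularW_eq_sum (k : ℕ) :
    singularW k = ∑ i ∈ Finset.range (k + 1), eps i • delta i (k - i) := by
  ext i j
  simp only [Finset.sum_apply, Pi.smul_apply, delta_apply, smul_eq_mul, mul_ite, mul_one, mul_zero]
  simp only [singularW]
  split_ifs with hk
  · rw [Finset.sum_eq_single i]
    · rw [if_pos ⟨rfl, by omega⟩]
    · intro l _ hl
      exact if_neg fun h0 => hl h0.1.symm
    · intro hi
      exact absurd (Finset.mem_range.2 (by omega)) hi
  · refine (Finset.sum_eq_zero fun l hl => if_neg ?_).symm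
    rw [Finset.mem_range] at hl
    omega

/-- The singular vector of degree `k` involves every `delta i (k - i)` with `i ≤ k`, all reachable
once `k` is reachable in both factors. The element of `U` that produces it is then replaced by its
`bar`. -/
theorem exists_evA_eq_singularW {k : ℕ} (h0 : IsReachable (p 0) k) (h1 : IsReachable (p 1) k) :
    ∃ a, evA hp a = singularW k := by
  have : ∃ u, rep hp u (delta 0 0) = singularW k := by
    choose f hf using fun i : Fin (k + 1) => exists_rep_eq_delta hp
      (h0.of_le (Nat.lt_succ_iff.1 i.2)) (h1.of_le (Nat.sub_le k i))
    refine ⟨∑ i : Fin (k + 1), eps i • f i, ?_⟩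
    rw [singularW_eq_sum, Finset.sum_range, map_sum, LinearMap.sum_apply]
    refine Finset.sum_congr rfl fun i _ => ?_
    rw [map_smul, LinearMap.smul_apply, hf]
  obtain ⟨u, hu⟩ := this
  exact ⟨bar u, by rw [evA_bar_of_singular hp (by rw [hu, rep_X_xp1_singularW]), hu]⟩

/-- Every nonzero function in the image of `A` can be raised to the highest weight vector. -/
theorem exists_raise {w : W} (hw : w ∈ simpleW p) (hw0 : w ≠ 0) :
    ∃ u, rep hp u w = delta 0 0 := by
  obtain ⟨⟨N, hN⟩, -⟩ := hw
  induction N generalizing w with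
  | zero => exact absurd (by ext i j; exact hN i j (Nat.zero_le _)) hw0
  | succ N ih =>
    by_cases h0 : opE 0 w = 0 ∧ opE 1 w = 0
    · have h1 : ∀ i j, w (i + 1) j = 0 := fun i j => congrFun (congrFun h0.1 i) j
      have h2 : ∀ j, w 0 (j + 1) = 0 := fun j => by
        have := congrFun (congrFun h0.2 0) j
        rwa [opE_one_apply, pow_zero, one_mul] at this
      have h3 : w = w 0 0 • delta 0 0 := by
        ext i j
        rcases i with _ | i
        · rcases j with _ | j
          · simp [delta_apply]
          · rw [h2]; simp [delta_apply]
        · rw [h1]; simp [delta_apply]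
      have h4 : w 0 0 ≠ 0 := fun h5 => hw0 (by rw [h3, h5, zero_smul])
      refine ⟨algebraMap ℂ U (w 0 0)⁻¹, ?_⟩
      rw [AlgHom.commutes, Module.algebraMap_end_apply]
      nth_rewrite 2 [h3]
      rw [smul_smul, inv_mul_cancel₀ h4, one_smul]
    · have : ∃ i : Fin 2, opE i w ≠ 0 := by
        by_contra! h1
        exact h0 ⟨h1 0, h1 1⟩
      obtain ⟨i, hi⟩ := this
      obtain ⟨u, hu⟩ := ih hi (fun i' j' hij => by
        fin_cases i
        · exact hN _ _ (by omega)
        · change (-1) ^ i' * w i' (j' + 1) = 0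
          rw [hN _ _ (by omega), mul_zero])
      exact ⟨u * E i, by rw [map_mul, Module.End.mul_apply, rep_E, hu]⟩

/-- The raising takes place in `U`; since its result `δ` is singular, `bar u` achieves the same
inside `A`. -/
theorem exists_mul_evA_eq_delta {a : A} (ha : evA hp a ≠ 0) :
    ∃ b, evA hp (b * a) = delta 0 0 := by
  obtain ⟨n, rfl⟩ := toA_surjective a
  obtain ⟨u, hu⟩ := exists_raise hp (evA_mem_simpleW hp _) ha
  have h1 : rep hp (u * n) (delta 0 0) = delta 0 0 := by
    rw [map_mul, Module.End.mul_apply, ← evA_toA, hu]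
  refine ⟨bar u, ?_⟩
  rw [← bar_mul_coe, evA_bar_of_singular hp, h1]
  rw [h1, rep_X_xp1_delta]

end Rep

end Osp12

end

noncomputable section

namespace Osp12

/-! ### The structure of `L(lam, mu)` -/

section Reachable

theorem lowCoef_succ_eq_zero_iff {a : ℂ} {k : ℕ} :
    lowCoef a (k + 1) = 0 ↔ ∃ m : ℕ, k = 2 * m ∧ a = -m := by
  obtain ⟨m, hm | hm⟩ := Nat.even_or_odd' (k + 1)
  · rw [hm, (lowCoef_even_odd a m).1]
    constructor
    · intro h0
      have : m = 0 := by exact_mod_cast h0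
      omega
    · rintro ⟨l, hl, -⟩
      omega
  · rw [hm, (lowCoef_even_odd a m).2]
    constructor
    · intro h0
      exact ⟨m, by omega, eq_neg_of_add_eq_zero_left h0⟩
    · rintro ⟨l, hl, rfl⟩
      have : l = m := by omega
      rw [this]; ring

theorem isReachable_of_ne {a : ℂ} (ha : ∀ m : ℕ, a ≠ -m) (i : ℕ) : IsReachable a i :=
  fun _ _ h0 => by
    obtain ⟨m, -, hm⟩ := lowCoef_succ_eq_zero_iff.1 h0
    exact ha m hm

theorem isReachable_neg_natCast_iff {m i : ℕ} : IsReachable (-m : ℂ) i ↔ i < 2 * m + 1 := by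
  constructor
  · intro h0
    by_contra! h1
    exact h0 (2 * m) (by omega) (lowCoef_succ_eq_zero_iff.2 ⟨m, rfl, rfl⟩)
  · intro h0 k hk h1
    obtain ⟨l, hl, hml⟩ := lowCoef_succ_eq_zero_iff.1 h1
    have : m = l := by exact_mod_cast neg_injective hml
    omega

end Reachable

variable {lam mu : ℂ}

/-- The projection `A → L(lam, mu)`, `a ↦ a v`. -/
def toLA (lam mu : ℂ) : A →ₗ[A] L lam mu := toL lam mu ∘ₗ toVerma lam

theorem toLA_surjective : Function.Surjective (toLA lam mu) :=
  (Submodule.mkQ_surjective (shapKer lam mu)).comp (Submodule.mkQ_surjective (vermaIdeal lam))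

theorem toLA_eq_smul (a : A) : toLA lam mu a = a • toLA lam mu 1 := by
  rw [← map_smul, smul_eq_mul, mul_one]

theorem toLA_smul (c : ℂ) (a : A) : toLA lam mu (c • a) = c • toLA lam mu a := by
  rw [Algebra.smul_def, ← smul_eq_mul, map_smul, algebraMap_smul]

/-- The highest weights of the two tensor factors. -/
def weights (lam mu : ℂ) : Fin 2 → ℂ := ![(mu + 1 + lam) / 2, (mu + 1 - lam) / 2]

theorem weights_zero : weights lam mu 0 = (mu + 1 + lam) / 2 := rfl
theorem weights_one : weights lam mu 1 = (mu + 1 - lam) / 2 := rfl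

theorem weights_sub : weights lam mu 0 - weights lam mu 1 = lam := by
  rw [weights_zero, weights_one]; ring

theorem weights_add : weights lam mu 0 + weights lam mu 1 = mu + 1 := by
  rw [weights_zero, weights_one]; ring

theorem weights_add_ne (hmu : ∀ k : ℤ, mu ≠ k) (k : ℤ) :
    weights lam mu 0 + weights lam mu 1 ≠ k := by
  rw [weights_add]
  intro h0
  exact hmu (k - 1) (by push_cast; linear_combination h0)

/-- The functional criterion for `N(lam, mu)`, applied to the leading coefficient, identifies
`L(lam, mu)` with the image of `A` in `W`. -/
theorem toLA_eq_zero_iff (hmu : ∀ k : ℤ, mu ≠ k) (a : A) :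
    toLA lam mu a = 0 ↔ evA (weights_add_ne (lam := lam) hmu) a = 0 := by
  rw [evA_eq_zero_iff]
  exact (isHighestWeightFunctional_chi _ weights_sub weights_add).toL_eq_zero_iff hmu a

theorem exists_evL (hmu : ∀ k : ℤ, mu ≠ k) : ∃ ev : L lam mu →ₗ[ℂ] W, Function.Injective ev ∧
    ∀ a, ev (toLA lam mu a) = evA (weights_add_ne (lam := lam) hmu) a := by
  let π : A →ₗ[ℂ] L lam mu := (toLA lam mu).restrictScalars ℂ
  have hπ : ∀ a, π a = toLA lam mu a := fun _ => rfl
  let e := π.quotKerEquivOfSurjective toLA_surjective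
  have he : ∀ a, e.symm (toLA lam mu a) = Submodule.Quotient.mk a := fun a => by
    rw [LinearEquiv.symm_apply_eq]; rfl
  refine ⟨(LinearMap.ker π).liftQ (evA (weights_add_ne (lam := lam) hmu)) (fun a ha =>
    (toLA_eq_zero_iff hmu a).1 ha) ∘ₗ e.symm.toLinearMap, ?_, fun a => ?_⟩
  · rw [← LinearMap.ker_eq_bot, LinearMap.ker_eq_bot']
    intro y hy
    obtain ⟨a, rfl⟩ := toLA_surjective y
    rw [LinearMap.comp_apply, LinearEquiv.coe_coe, he] at hy
    exact (toLA_eq_zero_iff hmu a).2 hy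
  · rw [LinearMap.comp_apply, LinearEquiv.coe_coe, he]; rfl

/-- The embedding of `L(lam, mu)` into `W`. -/
def evL (hmu : ∀ k : ℤ, mu ≠ k) : L lam mu →ₗ[ℂ] W := (exists_evL hmu).choose

theorem evL_injective (hmu : ∀ k : ℤ, mu ≠ k) : Function.Injective (evL (lam := lam) hmu) :=
  (exists_evL hmu).choose_spec.1

theorem evL_toLA (hmu : ∀ k : ℤ, mu ≠ k) (a : A) :
    evL hmu (toLA lam mu a) = evA (weights_add_ne (lam := lam) hmu) a :=
  (exists_evL hmu).choose_spec.2 a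

theorem evA_eq_iff (hmu : ∀ k : ℤ, mu ≠ k) {a b : A} :
    toLA lam mu a = toLA lam mu b ↔ evA (weights_add_ne (lam := lam) hmu) a
      = evA (weights_add_ne (lam := lam) hmu) b := by
  rw [← evL_toLA hmu, ← evL_toLA hmu, (evL_injective hmu).eq_iff]

theorem toLA_one_ne_zero (hmu : ∀ k : ℤ, mu ≠ k) : toLA lam mu 1 ≠ 0 := by
  rw [ne_eq, toLA_eq_zero_iff hmu, evA_one]
  intro h0
  have := congrFun (congrFun h0 0) 0
  simp [delta_apply] at this

theorem xb_xp1_smul_toLA_one : xb .xp1 • toLA lam mu 1 = 0 := by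
  rw [← toLA_eq_smul]
  have : toVerma lam (xb .xp1) = 0 :=
    (Submodule.Quotient.mk_eq_zero _).2 (Ideal.subset_span (by simp))
  rw [toLA, LinearMap.comp_apply, this, map_zero]

theorem xb_xp2_smul_toLA_one : xb .xp2 • toLA lam mu 1 = 0 := by
  rw [← toLA_eq_smul]
  have : toVerma lam (xb .xp2) = 0 :=
    (Submodule.Quotient.mk_eq_zero _).2 (Ideal.subset_span (by simp))
  rw [toLA, LinearMap.comp_apply, this, map_zero]

theorem xb_h_smul_toLA_one : xb .h • toLA lam mu 1 = lam • toLA lam mu 1 := by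
  have : toVerma lam (xb .h - algebraMap ℂ A lam) = 0 :=
    (Submodule.Quotient.mk_eq_zero _).2 (Ideal.subset_span (by simp))
  rw [← toLA_eq_smul, ← sub_eq_zero, ← toLA_smul, ← map_sub, ← Algebra.algebraMap_eq_smul_one, toLA,
    LinearMap.comp_apply, this, map_zero]

theorem HA_smul_toLA_one (hmu : ∀ k : ℤ, mu ≠ k) :
    HA • toLA lam mu 1 = (mu + 1) • toLA lam mu 1 := by
  rw [← toLA_eq_smul, ← toLA_smul, evA_eq_iff hmu, evA_HA, map_smul, evA_one, weights_add]

theorem isSimpleModule_L (hmu : ∀ k : ℤ, mu ≠ k) : IsSimpleModule A (L lam mu) := by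
  rw [isSimpleModule_iff_toSpanSingleton_surjective]
  refine ⟨⟨toLA lam mu 1, 0, toLA_one_ne_zero hmu⟩, fun y hy z => ?_⟩
  obtain ⟨a, rfl⟩ := toLA_surjective y
  obtain ⟨c, rfl⟩ := toLA_surjective z
  obtain ⟨b, hb⟩ := exists_mul_evA_eq_delta (weights_add_ne (lam := lam) hmu)
    (fun h0 => hy ((toLA_eq_zero_iff hmu a).2 h0))
  rw [← evA_one (weights_add_ne (lam := lam) hmu), ← evA_eq_iff hmu] at hb
  refine ⟨c * b, ?_⟩
  rw [LinearMap.toSpanSingleton_apply, mul_smul, ← map_smul, smul_eq_mul, hb, ← toLA_eq_smul]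

/-- The coordinates of an element of `L(lam, mu)` in terms of singular vectors. -/
def coordL (hmu : ∀ k : ℤ, mu ≠ k) (N : ℕ) : L lam mu →ₗ[ℂ] (Fin N → ℂ) where
  toFun := fun y k => evL hmu y 0 k
  map_add' := fun y z => by rw [map_add]; rfl
  map_smul' := fun c y => by rw [map_smul]; rfl

theorem coordL_surjective (hmu : ∀ k : ℤ, mu ≠ k) {N : ℕ}
    (h0 : ∀ k < N, IsReachable (weights lam mu 0) k)
    (h1 : ∀ k < N, IsReachable (weights lam mu 1) k) :
    Function.Surjective (coordL (lam := lam) hmu N) := by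
  choose f hf using fun k : Fin N => exists_evA_eq_singularW (weights_add_ne (lam := lam) hmu)
    (h0 k k.2) (h1 k k.2)
  intro g
  refine ⟨∑ k, g k • toLA lam mu (f k), ?_⟩
  rw [map_sum]
  ext l
  rw [Finset.sum_apply, Finset.sum_eq_single l]
  · rw [map_smul, Pi.smul_apply]
    change g l • evL hmu _ 0 l = _
    rw [evL_toLA, hf]
    simp [singularW, eps]
  · intro k _ hkl
    rw [map_smul, Pi.smul_apply]
    change g k • evL hmu _ 0 l = _
    rw [evL_toLA, hf, singularW, if_neg, smul_zero]
    rw [zero_add]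
    exact fun h2 => hkl (Fin.ext h2.symm)
  · simp

theorem coordL_injective (hmu : ∀ k : ℤ, mu ≠ k) {N : ℕ}
    (h0 : ∀ k, IsReachable (weights lam mu 0) k → IsReachable (weights lam mu 1) k → k < N) :
    Function.Injective (coordL (lam := lam) hmu N) := by
  rw [← LinearMap.ker_eq_bot, LinearMap.ker_eq_bot']
  intro y hy
  obtain ⟨a, rfl⟩ := toLA_surjective y
  rw [toLA_eq_zero_iff hmu]
  have hs := eq_eps_mul_of_singular _ (rep_X_xp1_evA (weights_add_ne (lam := lam) hmu) a)
  have hw := (evA_mem_simpleW (weights_add_ne (lam := lam) hmu) a).2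
  have key : ∀ k, evA (weights_add_ne (lam := lam) hmu) a 0 k = 0 := by
    intro k
    by_cases hk : k < N
    · have h1 : coordL (lam := lam) hmu N (toLA lam mu a) ⟨k, hk⟩ = 0 := by rw [hy]; rfl
      rw [← evL_toLA]
      exact h1
    · by_contra h1
      -- A nonzero value at `(0, k)` forces one at `(k, 0)`, since `eps k ≠ 0`; the two positions
      -- show that `k` is reachable in either factor.
      refine hk (h0 k (hw k 0 ?_).1 (hw 0 k h1).2)
      rw [hs, add_zero]
      exact mul_ne_zero (eps_ne_zero k) h1
  ext i j
  rw [hs, key, mul_zero]; rfl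

/-- With `p 0`, `p 1` the two weights and `n = 2m + 1`, one has `4 (p 0 + m) (p 1 + m) = (mu + n)² -
lam²`. -/
theorem eq_neg_natCast_iff {m : ℕ} :
    weights lam mu 0 = -m ∨ weights lam mu 1 = -m ↔ lam ^ 2 = (mu + (2 * m + 1 : ℕ)) ^ 2 := by
  rw [sq_eq_sq_iff_eq_or_eq_neg, weights_zero, weights_one, or_comm]
  push_cast
  refine or_congr ⟨fun h0 => ?_, fun h0 => ?_⟩ ⟨fun h0 => ?_, fun h0 => ?_⟩
  · linear_combination -2 * h0
  · linear_combination -h0 / 2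
  · linear_combination 2 * h0
  · linear_combination h0 / 2

/-- The weights have a non-integral sum, so if one of them is `-m` the other is not a nonpositive
integer and imposes no bound. -/
theorem isReachable_weights_iff (hmu : ∀ k : ℤ, mu ≠ k) {m : ℕ}
    (hm : weights lam mu 0 = -m ∨ weights lam mu 1 = -m) (k : ℕ) :
    IsReachable (weights lam mu 0) k ∧ IsReachable (weights lam mu 1) k ↔ k < 2 * m + 1 := by
  have hne := weights_add_ne (lam := lam) hmu
  rcases hm with hm | hm
  · have h1 : ∀ l : ℕ, weights lam mu 1 ≠ -l := fun l hl =>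
      hne (-m - l) (by rw [hm, hl]; push_cast; ring)
    simp only [hm, isReachable_neg_natCast_iff, isReachable_of_ne h1, and_true]
  · have h1 : ∀ l : ℕ, weights lam mu 0 ≠ -l := fun l hl =>
      hne (-m - l) (by rw [hm, hl]; push_cast; ring)
    simp only [hm, isReachable_neg_natCast_iff, isReachable_of_ne h1, true_and]

theorem finrank_L (hmu : ∀ k : ℤ, mu ≠ k) {n : ℕ} (hn : Odd n) (h : lam ^ 2 = (mu + n) ^ 2) :
    FiniteDimensional ℂ (L lam mu) ∧ Module.finrank ℂ (L lam mu) = n := by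
  obtain ⟨m, rfl⟩ := hn
  have hr := isReachable_weights_iff hmu (eq_neg_natCast_iff.2 h)
  let e := LinearEquiv.ofBijective (coordL (lam := lam) hmu (2 * m + 1))
    ⟨coordL_injective hmu fun k h0 h1 => (hr k).1 ⟨h0, h1⟩,
      coordL_surjective hmu (fun k hk => ((hr k).2 hk).1) (fun k hk => ((hr k).2 hk).2)⟩
  exact ⟨Module.Finite.equiv e.symm, by rw [e.finrank_eq]; simp⟩

/-- Otherwise every index is reachable in both factors, and the space maps onto coordinates of
length one more than its dimension. -/
theorem exists_odd_of_finiteDimensional (hmu : ∀ k : ℤ, mu ≠ k)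
    (hL : FiniteDimensional ℂ (L lam mu)) : ∃ n : ℕ, Odd n ∧ lam ^ 2 = (mu + n) ^ 2 := by
  by_contra! h0
  have h1 : ∀ m : ℕ, ¬(weights lam mu 0 = -m ∨ weights lam mu 1 = -m) := fun m hm =>
    h0 (2 * m + 1) ⟨m, rfl⟩ (eq_neg_natCast_iff.1 hm)
  have h2 := LinearMap.finrank_le_finrank_of_surjective (coordL_surjective (lam := lam) hmu
    (N := Module.finrank ℂ (L lam mu) + 1)
    (fun k _ => isReachable_of_ne (fun m hm => h1 m (Or.inl hm)) k)
    (fun k _ => isReachable_of_ne (fun m hm => h1 m (Or.inr hm)) k))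
  simp at h2

theorem lam_ne_zero (hmu : ∀ k : ℤ, mu ≠ k) {n : ℕ} (h : lam ^ 2 = (mu + n) ^ 2) : lam ≠ 0 := by
  rintro rfl
  rw [zero_pow two_ne_zero, eq_comm, sq_eq_zero_iff] at h
  exact hmu (-n) (by push_cast; exact eq_neg_of_add_eq_zero_left h)

/-! ### The action of `H` and `h̄` on `L(lam, mu)` -/

theorem evA_HA_mul (hmu : ∀ k : ℤ, mu ≠ k) (a : A) (i j : ℕ) :
    evA (weights_add_ne (lam := lam) hmu) (HA * a) i j
      = (mu + 1 + i + j) * evA (weights_add_ne (lam := lam) hmu) a i j := by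
  rw [HA_eq, evA_toA_mul, rep_X_h_apply, weights_add]

theorem eq_of_HA_smul_eq (hmu : ∀ k : ℤ, mu ≠ k) {nu : ℂ} {y : L lam mu} (hy0 : y ≠ 0)
    (hy : HA • y = nu • y) : ∃ k : ℕ, nu = mu + 1 + k := by
  obtain ⟨a, rfl⟩ := toLA_surjective y
  rw [← map_smul, smul_eq_mul, ← toLA_smul, evA_eq_iff hmu, map_smul] at hy
  rw [ne_eq, toLA_eq_zero_iff hmu] at hy0
  have : ∃ i j, evA (weights_add_ne (lam := lam) hmu) a i j ≠ 0 := by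
    by_contra! h0
    exact hy0 (by ext i j; exact h0 i j)
  obtain ⟨i, j, hij⟩ := this
  have h1 := congrFun (congrFun hy i) j
  rw [evA_HA_mul hmu] at h1
  refine ⟨i + j, ?_⟩
  have := mul_right_cancel₀ hij h1
  push_cast
  linear_combination -this

/-- `H` acts at `(i, j)` by `mu + 1 + i + j`, so its eigenspace for `mu + 1` is the line of the
generator. -/
theorem xb_h_smul_of_HA_smul (hmu : ∀ k : ℤ, mu ≠ k) {y : L lam mu}
    (hy : HA • y = (mu + 1) • y) : xb .h • y = lam • y := by
  obtain ⟨a, rfl⟩ := toLA_surjective y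
  rw [← map_smul, smul_eq_mul, ← toLA_smul, evA_eq_iff hmu, map_smul] at hy
  have h1 : evA (weights_add_ne (lam := lam) hmu) a
      = evA (weights_add_ne (lam := lam) hmu)
        (evA (weights_add_ne (lam := lam) hmu) a 0 0 • (1 : A)) := by
    rw [map_smul, evA_one]
    ext i j
    by_cases hij : i = 0 ∧ j = 0
    · rw [hij.1, hij.2]; simp [delta_apply]
    · have h1 := congrFun (congrFun hy i) j
      rw [evA_HA_mul hmu] at h1
      simp only [Pi.smul_apply, smul_eq_mul, delta_apply, hij, if_false, mul_zero]
      have h2 : ((i : ℂ) + j) * evA (weights_add_ne (lam := lam) hmu) a i j = 0 := by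
        rw [Pi.smul_apply, Pi.smul_apply, smul_eq_mul] at h1
        linear_combination h1
      refine (mul_eq_zero.1 h2).resolve_left ?_
      norm_cast
      omega
  rw [← evA_eq_iff hmu, toLA_smul] at h1
  rw [h1, smul_algebra_smul_comm, xb_h_smul_toLA_one, smul_comm]

/-- The pair `(lam, mu)` is determined by the isomorphism class of `L(lam, mu)`. -/
theorem eq_of_equiv {lam' mu' : ℂ} (hmu : ∀ k : ℤ, mu ≠ k) (hmu' : ∀ k : ℤ, mu' ≠ k)
    (e : L lam mu ≃ₗ[A] L lam' mu') : lam = lam' ∧ mu = mu' := by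
  have hsmul : ∀ (c : ℂ) (y : L lam mu), e (c • y) = c • e y := fun c y => by
    rw [← algebraMap_smul A, map_smul, algebraMap_smul]
  have hsmul' : ∀ (c : ℂ) (y : L lam' mu'), e.symm (c • y) = c • e.symm y := fun c y => by
    rw [← algebraMap_smul A, map_smul, algebraMap_smul]
  have h1 : HA • e (toLA lam mu 1) = (mu + 1) • e (toLA lam mu 1) := by
    rw [← map_smul, HA_smul_toLA_one hmu, hsmul]
  have h2 : HA • e.symm (toLA lam' mu' 1) = (mu' + 1) • e.symm (toLA lam' mu' 1) := by
    rw [← map_smul, HA_smul_toLA_one hmu', hsmul']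
  have hne : e (toLA lam mu 1) ≠ 0 := by
    rw [ne_eq, e.map_eq_zero_iff]; exact toLA_one_ne_zero hmu
  obtain ⟨k, hk⟩ := eq_of_HA_smul_eq hmu' hne h1
  obtain ⟨l, hl⟩ := eq_of_HA_smul_eq hmu (by
    rw [ne_eq, e.symm.map_eq_zero_iff]; exact toLA_one_ne_zero hmu') h2
  -- Each of `mu`, `mu'` exceeds the other by a natural number, so both differences vanish.
  have hkl : ((k + l : ℕ) : ℂ) = 0 := by push_cast; linear_combination -hk - hl
  have hk0 : k = 0 := by
    have : k + l = 0 := by exact_mod_cast hkl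
    omega
  have hmm : mu = mu' := by
    rw [hk0] at hk; push_cast at hk; linear_combination hk
  refine ⟨?_, hmm⟩
  rw [show mu + 1 = mu' + 1 by rw [hmm]] at h1
  have h3 := xb_h_smul_of_HA_smul hmu' h1
  rw [← map_smul, xb_h_smul_toLA_one, hsmul] at h3
  exact smul_left_injective ℂ hne h3

end Osp12

end

noncomputable section

namespace Osp12

attribute [local simp] E_mul_F E_mul_h h_mul_F E_one_mul_E_zero F_one_mul_F_zero E_one_mul_F_zero
  E_zero_mul_F_one E_zero_mul_h_one E_one_mul_h_zero h_one_mul_F_zero h_zero_mul_F_one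
  h_one_mul_h_zero hinv_mul_F E_mul_hinv h_mul_hinv
  E_mul_F_assoc h_mul_F_assoc E_one_mul_E_zero_assoc F_one_mul_F_zero_assoc
  E_one_mul_F_zero_assoc E_zero_mul_F_one_assoc
  h_one_mul_F_zero_assoc h_zero_mul_F_one_assoc hinv_mul_F_assoc
  E_mul_hinv_assoc h_mul_hinv_assoc

/-! ### The parity automorphism -/

theorem sigma_toU (a : FreeAlgebra ℂ Gen) : sigma (toU a) = freeSigma a :=
  RingQuot.liftAlgHom_mkAlgHom_apply ℂ freeSigma freeSigma_rel a

theorem sigma_E (i : Fin 2) : sigma (E i) = -E i := by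
  rw [E, x, sigma_toU, freeSigma_fg]; simp [genSign, parity]

theorem sigma_F (i : Fin 2) : sigma (F i) = -F i := by
  rw [F, x, sigma_toU, freeSigma_fg]; simp [genSign, parity]

theorem sigma_h (i : Fin 2) : sigma (h i) = h i := by
  rw [h, x, sigma_toU, freeSigma_fg]; simp [genSign, parity]

theorem sigma_hinv (n : ℤ) : sigma (hinv n) = hinv n := by
  rw [hinv, sigma_toU, freeSigma_fg]; simp [genSign]

theorem sigma_sigma (u : U) : sigma (sigma u) = u := by
  refine U_induction
    (LinearMap.eqLocus (sigma.toLinearMap ∘ₗ sigma.toLinearMap) LinearMap.id) ?_ ?_ ?_ ?_ ?_ u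
  · change sigma (sigma 1) = 1
    simp
  all_goals
    intro k u hu
    change sigma (sigma u) = u at hu
    change sigma (sigma (_ * u)) = _ * u
  · simp [sigma_E, hu]
  · simp [sigma_F, hu]
  · simp [sigma_h, hu]
  · simp [sigma_hinv, hu]

theorem sigma_X_xp1 : sigma (X .xp1) = -X .xp1 := by
  rw [X_xp1, map_add, sigma_E, sigma_E]; abel

/-- The parity automorphism changes `X_α` only by a sign, hence preserves `I` and its normalizer.
This is what allows elements of `A` to be split into even and odd parts. -/
theorem sigma_mem_normI {n : U} (hn : n ∈ normI) : sigma n ∈ normI := by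
  obtain ⟨v, hv⟩ := mem_leftI.1 (mem_normI.1 hn)
  refine mem_normI.2 (mem_leftI.2 ⟨sigma v, ?_⟩)
  have := congrArg sigma hv
  rw [map_mul, map_mul, sigma_X_xp1, neg_mul, mul_neg, neg_inj] at this
  exact this

theorem mem_gradeA {i : ZMod 2} {a : A} :
    a ∈ gradeA i ↔ ∃ n : normI, sigma (n : U) = ((-1 : ℂ) ^ i.val) • (n : U) ∧ toA n = a :=
  Iff.rfl

theorem neg_one_pow_val_add (i j : ZMod 2) :
    (-1 : ℂ) ^ (i + j).val = (-1) ^ i.val * (-1) ^ j.val := by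
  rw [ZMod.val_add, ← neg_one_pow_eq_pow_mod_two, pow_add]

theorem gradeA_mul {i j : ZMod 2} {a b : A} (ha : a ∈ gradeA i) (hb : b ∈ gradeA j) :
    a * b ∈ gradeA (i + j) := by
  obtain ⟨n, hn, rfl⟩ := mem_gradeA.1 ha
  obtain ⟨m, hm, rfl⟩ := mem_gradeA.1 hb
  refine mem_gradeA.2 ⟨n * m, ?_, map_mul _ _ _⟩
  rw [Subalgebra.coe_mul, map_mul, hn, hm, smul_mul_smul_comm, neg_one_pow_val_add]

theorem exists_gradeA_add (a : A) : ∃ a₀ ∈ gradeA 0, ∃ a₁ ∈ gradeA 1, a = a₀ + a₁ := by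
  obtain ⟨n, rfl⟩ := toA_surjective a
  let m : normI := ⟨sigma n, sigma_mem_normI n.2⟩
  have hm : (m : U) = sigma n := rfl
  refine ⟨_, mem_gradeA.2 ⟨(1 / 2 : ℂ) • (n + m), ?_, rfl⟩, _,
    mem_gradeA.2 ⟨(1 / 2 : ℂ) • (n - m), ?_, rfl⟩, ?_⟩
  · simp [hm, sigma_sigma, add_comm]
  · have : (1 : ZMod 2).val = 1 := rfl
    simp only [Subalgebra.coe_smul, Subalgebra.coe_sub, map_smul, map_sub, hm, sigma_sigma, this,
      pow_one]
    module
  · rw [← map_add]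
    congr 1
    module

theorem toA_mem_gradeA_zero {n : normI} (hn : sigma (n : U) = n) : toA n ∈ gradeA 0 :=
  mem_gradeA.2 ⟨n, by simpa using hn, rfl⟩

theorem HA_mem_gradeA : HA ∈ gradeA 0 := by
  rw [HA_eq]
  exact toA_mem_gradeA_zero (by simp [X_h, sigma_h])

theorem xb_h_mem_gradeA : xb .h ∈ gradeA 0 := by
  rw [xb_h_eq]
  refine toA_mem_gradeA_zero ?_
  simp [repH, xt_h, xt_xp1, xt_xp2, X_xm1, sigma_h, sigma_E, sigma_F, sigma_hinv, mul_add, add_mul,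
    mul_sub]

/-! ### The grading of `L(lam, mu)` -/

/-- The parity operator on `W`. -/
def parityW : W →ₗ[ℂ] W where
  toFun := fun w i j => (-1) ^ (i + j) * w i j
  map_add' := fun _ _ => by ext; simp [mul_add]
  map_smul' := fun _ _ => by ext; simp; ring

theorem parityW_apply (w : W) (i j : ℕ) : parityW w i j = (-1) ^ (i + j) * w i j := rfl

section Parity

variable {p : Fin 2 → ℂ} (hp : ∀ k : ℤ, p 0 + p 1 ≠ k)

theorem parityW_opE (i : Fin 2) (w : W) : parityW (opE i w) = -opE i (parityW w) := by
  ext i' j'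
  rw [Pi.neg_apply, Pi.neg_apply, parityW_apply]
  fin_cases i
  · simp only [Fin.zero_eta, opE_zero_apply, parityW_apply]; ring
  · simp only [Fin.mk_one, opE_one_apply, parityW_apply]; ring

theorem parityW_opF (i : Fin 2) (w : W) : parityW (opF p i w) = -opF p i (parityW w) := by
  ext i' j'
  rw [Pi.neg_apply, Pi.neg_apply, parityW_apply]
  fin_cases i
  · simp only [Fin.zero_eta, opF_zero_apply, parityW_apply]
    cases i'
    · simp [lowCoef]
    · rw [Nat.add_sub_cancel]; ring
  · simp only [Fin.mk_one, opF_one_apply, parityW_apply]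
    cases j'
    · simp [lowCoef]
    · rw [Nat.add_sub_cancel]; ring

theorem parityW_rep (u : U) (w : W) :
    parityW (rep hp u w) = rep hp (sigma u) (parityW w) := by
  revert w
  refine U_induction
    { carrier := {u | ∀ w, parityW (rep hp u w) = rep hp (sigma u) (parityW w)}
      zero_mem' := fun w => by simp
      add_mem' := fun hu hv w => by simp [hu w, hv w]
      smul_mem' := fun c u hu w => by simp [hu w] } ?_ ?_ ?_ ?_ ?_ u
  · intro w
    simp
  all_goals
    intro k u hu w
    rw [map_mul, map_mul, map_mul, Module.End.mul_apply, Module.End.mul_apply, ← hu]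
  · rw [rep_E, parityW_opE, sigma_E, map_neg, rep_E, LinearMap.neg_apply]
  · rw [rep_F, parityW_opF, sigma_F, map_neg, rep_F, LinearMap.neg_apply]
  · rw [sigma_h, rep_h]
    ext i j
    fin_cases k
    · simp only [Fin.zero_eta, parityW_apply, opH_zero_apply]; ring
    · simp only [Fin.mk_one, parityW_apply, opH_one_apply]; ring
  · rw [sigma_hinv, rep_hinv]
    ext i j
    simp only [parityW_apply, opHinv_apply]; ring

theorem parityW_delta : parityW (delta 0 0) = delta 0 0 := by
  ext i j
  rw [parityW_apply, delta_apply]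
  split_ifs with hij
  · rw [hij.1, hij.2]; simp
  · simp

theorem parityW_evA {i : ZMod 2} {a : A} (ha : a ∈ gradeA i) :
    parityW (evA hp a) = (-1 : ℂ) ^ i.val • evA hp a := by
  obtain ⟨n, hn, rfl⟩ := mem_gradeA.1 ha
  rw [evA_toA, parityW_rep, hn, parityW_delta, map_smul, LinearMap.smul_apply]

end Parity

variable {lam mu : ℂ}

theorem mem_gradeL {i : ZMod 2} {y : L lam mu} :
    y ∈ gradeL lam mu i ↔ ∃ a ∈ gradeA i, toLA lam mu a = y := Iff.rfl

theorem isSupermodule_gradeL (hmu : ∀ k : ℤ, mu ≠ k) : IsSupermodule (gradeL lam mu) where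
  internal := by
    rw [DirectSum.isInternal_submodule_iff_isCompl (gradeL lam mu) (i := 0) (j := 1) (by decide)
      (by
        ext i
        simp only [Set.mem_univ, true_iff, Set.mem_insert_iff, Set.mem_singleton_iff]
        revert i; decide), isCompl_iff, disjoint_iff, codisjoint_iff]
    refine ⟨?_, ?_⟩
    · rw [Submodule.eq_bot_iff]
      rintro y ⟨⟨a, ha, hay⟩, ⟨b, hb, hby⟩⟩
      change toLA lam mu a = y at hay
      change toLA lam mu b = y at hby
      have h1 := parityW_evA (weights_add_ne (lam := lam) hmu) ha
      have h2 := parityW_evA (weights_add_ne (lam := lam) hmu) hb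
      have h3 := (evA_eq_iff hmu).1 (hay.trans hby.symm)
      -- The parity operator of `W` fixes an even vector and negates an odd one, so a vector that is
      -- both equals its own negative.
      have h4 : (1 : ZMod 2).val = 1 := rfl
      rw [← h3, h1, h4] at h2
      simp only [ZMod.val_zero, pow_zero, one_smul, pow_one, neg_smul] at h2
      rw [← hay, toLA_eq_zero_iff hmu]
      exact self_eq_neg.1 h2
    · rw [Submodule.eq_top_iff']
      intro y
      obtain ⟨a, rfl⟩ := toLA_surjective y
      obtain ⟨a₀, h0, a₁, h1, rfl⟩ := exists_gradeA_add a
      rw [map_add]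
      exact Submodule.add_mem_sup ⟨a₀, h0, rfl⟩ ⟨a₁, h1, rfl⟩
  smul_mem := by
    rintro i j a ha _ ⟨b, hb, rfl⟩
    exact ⟨a * b, gradeA_mul ha hb, (toLA lam mu).map_smul a b⟩

/-! ### The Scasimir elements and the ghost center -/

/-- The Scasimir element of the `i`-th factor. -/
def scas (i : Fin 2) : U := (2 : ℂ) • h i - 1 - (4 : ℂ) • (F i * E i)

/-- The constants in `scas` are chosen so that it anticommutes with the odd generators of its own
factor. Being even, it commutes with the other factor. -/
theorem scas_mul_E (i : Fin 2) : scas i * E i = -(E i * scas i) := by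
  simp [scas, mul_sub, sub_mul, mul_assoc]; module

theorem scas_mul_F (i : Fin 2) : scas i * F i = -(F i * scas i) := by
  simp [scas, mul_sub, sub_mul, mul_assoc]; module

theorem scas_mul_h (i j : Fin 2) : scas i * h j = h j * scas i := by
  fin_cases i <;> fin_cases j <;> simp [scas, mul_sub, sub_mul, mul_add, mul_assoc]

theorem scas_mul_hinv (i : Fin 2) (n : ℤ) : scas i * hinv n = hinv n * scas i := by
  fin_cases i <;> simp [scas, mul_sub, sub_mul, mul_assoc]

theorem scas_zero_mul_E_one : scas 0 * E 1 = E 1 * scas 0 := by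
  simp [scas, mul_sub, sub_mul, mul_assoc]

theorem scas_one_mul_E_zero : scas 1 * E 0 = E 0 * scas 1 := by
  simp [scas, mul_sub, sub_mul, mul_assoc]

theorem scas_zero_mul_F_one : scas 0 * F 1 = F 1 * scas 0 := by
  simp [scas, mul_sub, sub_mul, mul_assoc]

theorem scas_one_mul_F_zero : scas 1 * F 0 = F 0 * scas 1 := by
  simp [scas, mul_sub, sub_mul, mul_assoc]

theorem scas_mul_scas_commute (i : Fin 2) (u : U) :
    scas i * scas i * u = u * (scas i * scas i) := by
  refine U_induction (LinearMap.eqLocus (LinearMap.mulLeft ℂ (scas i * scas i))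
    (LinearMap.mulRight ℂ (scas i * scas i))) ?_ ?_ ?_ ?_ ?_ u
  · change scas i * scas i * 1 = 1 * _
    rw [mul_one, one_mul]
  all_goals
    intro k u hu
    change scas i * scas i * u = u * _ at hu
    change scas i * scas i * (_ * u) = _ * u * _
    rw [mul_assoc _ u, ← hu, ← mul_assoc, ← mul_assoc]
    congr 1
  · fin_cases i <;> fin_cases k <;>
      simp [mul_assoc, scas_mul_E, scas_zero_mul_E_one, scas_one_mul_E_zero,
        mul_mul_of_eq (scas_mul_E _), mul_mul_of_eq scas_zero_mul_E_one,
        mul_mul_of_eq scas_one_mul_E_zero]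
  · fin_cases i <;> fin_cases k <;>
      simp [mul_assoc, scas_mul_F, scas_zero_mul_F_one, scas_one_mul_F_zero,
        mul_mul_of_eq (scas_mul_F _), mul_mul_of_eq scas_zero_mul_F_one,
        mul_mul_of_eq scas_one_mul_F_zero]
  · rw [mul_assoc, scas_mul_h, ← mul_assoc, scas_mul_h, mul_assoc]
  · rw [mul_assoc, scas_mul_hinv, ← mul_assoc, scas_mul_hinv, mul_assoc]

/-- An odd generator anticommutes with exactly one of the two Scasimirs, so passing the product
costs one sign; for the squares two signs cancel. -/
theorem scas_mul_scas_supercommute (u : U) :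
    scas 0 * scas 1 * u = sigma u * (scas 0 * scas 1) := by
  refine U_induction (LinearMap.eqLocus (LinearMap.mulLeft ℂ (scas 0 * scas 1))
    (LinearMap.mulRight ℂ (scas 0 * scas 1) ∘ₗ sigma.toLinearMap)) ?_ ?_ ?_ ?_ ?_ u
  · change scas 0 * scas 1 * 1 = sigma 1 * (scas 0 * scas 1)
    rw [mul_one, map_one, one_mul]
  all_goals
    intro k u hu
    change scas 0 * scas 1 * u = sigma u * (scas 0 * scas 1) at hu
    change scas 0 * scas 1 * (_ * u) = sigma (_ * u) * (scas 0 * scas 1)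
    rw [map_mul, mul_assoc (sigma _), ← hu, ← mul_assoc, ← mul_assoc (sigma _)]
    congr 1
  · fin_cases k <;>
      simp [mul_assoc, scas_mul_E, scas_one_mul_E_zero, sigma_E,
        mul_mul_of_eq (scas_mul_E _), mul_mul_of_eq scas_zero_mul_E_one]
  · fin_cases k <;>
      simp [mul_assoc, scas_mul_F, scas_one_mul_F_zero, sigma_F,
        mul_mul_of_eq (scas_mul_F _), mul_mul_of_eq scas_zero_mul_F_one]
  · rw [mul_assoc, scas_mul_h, ← mul_assoc, scas_mul_h, mul_assoc, sigma_h]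
  · rw [mul_assoc, scas_mul_hinv, ← mul_assoc, scas_mul_hinv, mul_assoc, sigma_hinv]

theorem scas_sq_mem (i : Fin 2) : scas i * scas i ∈ normI :=
  mem_normI.2 (mem_leftI.2 ⟨_, (scas_mul_scas_commute i _).symm⟩)

theorem scas_mul_scas_mem : scas 0 * scas 1 ∈ normI :=
  mem_normI.2 (mem_leftI.2 ⟨-(scas 0 * scas 1), by
    rw [neg_mul, scas_mul_scas_supercommute, sigma_X_xp1, neg_mul, neg_neg]⟩)

/-- The Casimir element of the `i`-th factor, in `A`. -/
def casA (i : Fin 2) : A := toA ⟨scas i * scas i, scas_sq_mem i⟩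

theorem casA_commute (i : Fin 2) (a : A) : casA i * a = a * casA i := by
  obtain ⟨n, rfl⟩ := toA_surjective a
  rw [casA, ← map_mul, ← map_mul]
  congr 1
  exact Subtype.ext (scas_mul_scas_commute i n)

/-! ### Products in `A` -/

theorem bar_xt_xm1_mul_X_xm1_mul (w : U) :
    bar (xt .xm1 * (X .xm1 * w)) = (2 : ℂ) • bar (xt .xm2 * w) := by
  rw [mul_mul_of_eq xt_xm1_mul_X_xm1, sub_mul, mul_assoc, bar_sub, bar_X_xm1_mul, sub_zero,
    smul_mul_assoc, bar_smul]

theorem xt_h_mul_X_xm1 : xt .h * X .xm1 = X .xm1 * xt .h + xt .xm1 := by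
  simp [xt_h, X_xm1, xt_xm1, mul_add, add_mul, mul_sub, sub_mul]; abel

theorem bar_xt_h_mul_X_xm1_mul (w : U) : bar (xt .h * (X .xm1 * w)) = bar (xt .xm1 * w) := by
  rw [mul_mul_of_eq xt_h_mul_X_xm1, add_mul, mul_assoc, bar_add, bar_X_xm1_mul, zero_add]

theorem xt_xm2_mul_hinv (n : ℤ) : xt .xm2 * hinv n = hinv (n + 2) * xt .xm2 := by
  simp [xt_xm2, mul_sub, sub_mul, mul_assoc]; ring_nf

theorem xt_xm1_mul_hinv (n : ℤ) : xt .xm1 * hinv n = hinv (n + 1) * xt .xm1 := by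
  simp [xt_xm1, mul_sub, sub_mul]

/-- Only the right factor is replaced by its normalizer representative. In the correction term
`X_{-α}` is then moved to the far left, where `bar` kills it. -/
theorem xb_xm1_mul_xb_xp1 : xb .xm1 * xb .xp1 = bar (xt .xm1 * xt .xp1)
    + (4 : ℂ) • (HAinv 2 * bar (xt .xm2 * xt .xp2)) := by
  rw [show xb .xm1 = bar (xt .xm1) from rfl, ← bar_mul_repP1, repP1, mul_add, bar_add, mul_smul_comm, bar_smul, bar_xt_xm1_mul_X_xm1_mul,
    mul_mul_of_eq (xt_xm2_mul_hinv 0), mul_assoc, bar_hinv_mul, smul_smul]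
  norm_num

theorem xb_h_mul_xb_h : xb .h * xb .h = bar (xt .h * xt .h)
    - HAinv 1 * bar (xt .xm1 * xt .xp1) + (4 : ℂ) • (HAinv 1 * bar (xt .xm2 * xt .xp2)) := by
  rw [show xb .h * xb .h = bar (xt .h) * xb .h from rfl, ← bar_mul_repH, repH, mul_add, mul_sub, bar_add, bar_sub, mul_smul_comm, bar_smul,
    bar_xt_h_mul_X_xm1_mul, bar_xt_h_mul_X_xm1_mul, bar_xt_xm1_mul_X_xm1_mul,
    mul_mul_of_eq (xt_xm2_mul_hinv _), mul_mul_of_eq (xt_xm1_mul_hinv _), mul_assoc, mul_assoc,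
    bar_hinv_mul, bar_hinv_mul, smul_smul]
  norm_num

theorem xb_xm2_mul_xb_xp2 : xb .xm2 * xb .xp2 = bar (xt .xm2 * xt .xp2) :=
  (bar_mul_repP2 _).symm

theorem HA_mul_HAinv (n : ℤ) : HA * HAinv n = 1 + (n : ℂ) • HAinv n := by
  have h1 := HA_sub_mul_HAinv n
  rw [sub_mul, sub_eq_iff_eq_add] at h1
  rw [h1, Algebra.smul_def, map_intCast]

theorem HAinv_mul_HA (n : ℤ) : HAinv n * HA = 1 + (n : ℂ) • HAinv n := by
  have h1 := HAinv_mul_HA_sub n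
  rw [mul_sub, sub_eq_iff_eq_add] at h1
  rw [h1, Algebra.smul_def, map_intCast, ← (Int.cast_commute n (HAinv n)).eq]

/-- Partial fractions, obtained by evaluating `HAinv 1 * HA * HAinv 2` in two ways. -/
theorem HAinv_one_mul_HAinv_two : HAinv 1 * HAinv 2 = HAinv 2 - HAinv 1 := by
  have h1 : HAinv 1 * (HA * HAinv 2) = HAinv 1 * HA * HAinv 2 := (mul_assoc _ _ _).symm
  rw [HA_mul_HAinv, HAinv_mul_HA, mul_add, add_mul, one_mul, mul_one, mul_smul_comm,
    smul_mul_assoc] at h1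
  push_cast at h1
  linear_combination (norm := module) h1

theorem HA_sub_one_sq : (HA - 1) ^ 2 = bar ((X .h - 1) * (X .h - 1)) := by
  have h1 : HA - 1 = toA (⟨X .h, X_h_mem_normI⟩ - 1) := by rw [map_sub, HA_eq, map_one]
  rw [pow_two, h1, ← map_mul, ← bar_coe]
  rfl

/-- The comparison is made in `U/II`, where both sides have explicit representatives; the witnesses
write their difference as a left multiple of `X_α` plus a right multiple of `X_{-α}`. Centrality of
`C1` follows from that of the Casimirs. -/
theorem C1_eq : C1 = (1 / 2 : ℂ) • (casA 0 - casA 1) := by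
  have h1 : C1 = bar ((2 : ℂ) • ((X .h - 1) * xt .h)) := by
    rw [C1, bar_smul, sub_mul, bar_sub, bar_X_h_mul, one_mul, xb]
    have : (2 : A) = algebraMap ℂ A 2 := (map_ofNat _ 2).symm
    rw [this, mul_assoc, ← Algebra.smul_def, sub_mul, one_mul]
  rw [h1, casA, casA, ← bar_coe, ← bar_coe, ← bar_sub, ← bar_smul]
  refine bar_congr (mem_doubleI.2 ⟨(2 : ℂ) • xt .xm1 + (4 : ℂ) • (xt .xm2 * X .xp1),
    (2 : ℂ) • xt .xp1 - (4 : ℂ) • (X .xm1 * xt .xp2), ?_⟩)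
  simp [scas, X_h, xt_h, xt_xm1, xt_xp1, X_xm1, X_xp1, xt_xm2, xt_xp2, mul_add, add_mul, mul_sub,
    sub_mul, mul_assoc]
  module

theorem C2_eq : C2 = (1 / 2 : ℂ) • (casA 0 + casA 1) := by
  have h1 : C2 = bar ((4 : ℂ) • (xt .xm2 * xt .xp2) - (2 : ℂ) • (xt .xm1 * xt .xp1)
      + xt .h * xt .h + (X .h - 1) * (X .h - 1)) := by
    have h2 : (2 : A) = algebraMap ℂ A 2 := (map_ofNat _ 2).symm
    have h4 : (4 : A) = algebraMap ℂ A 4 := (map_ofNat _ 4).symm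
    rw [C2, mul_assoc _ (xb .xm2), mul_assoc _ (xb .xm1), xb_xm1_mul_xb_xp1, xb_h_mul_xb_h,
      xb_xm2_mul_xb_xp2, HA_sub_one_sq, bar_add, bar_add, bar_sub, bar_smul, bar_smul, h2, h4]
    have k := mul_mul_of_eq HAinv_one_mul_HAinv_two (bar (xt .xm2 * xt .xp2))
    simp only [add_mul, sub_mul, mul_add, mul_sub, mul_smul_comm, k, ← Algebra.smul_def,
      smul_mul_assoc]
    module
  rw [h1, casA, casA, ← bar_coe, ← bar_coe, ← bar_add, ← bar_smul]
  refine bar_congr (mem_doubleI.2 ⟨(2 : ℂ) • X .xm1 + (4 : ℂ) • (X .xm1 * (X .xm1 * X .xp1)),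
    0, ?_⟩)
  simp [scas, X_h, xt_h, xt_xm1, xt_xp1, X_xm1, X_xp1, xt_xm2, xt_xp2, mul_add, add_mul, mul_sub,
    sub_mul, mul_assoc]
  module

theorem Q2_eq : Q2 = toA ⟨scas 0 * scas 1, scas_mul_scas_mem⟩ := by
  have h1 : Q2 = bar (-(4 : ℂ) • (xt .xm2 * xt .xp2)
      - (2 : ℂ) • ((X .h - (2 : ℂ) • 1) * (xt .xm1 * xt .xp1))
      - xt .h * xt .h + (X .h - 1) * (X .h - 1)) := by
    have h2 : (2 : A) = algebraMap ℂ A 2 := (map_ofNat _ 2).symm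
    have h4 : (4 : A) = algebraMap ℂ A 4 := (map_ofNat _ 4).symm
    rw [Q2, mul_assoc _ (xb .xm2), mul_assoc _ (xb .xm1), xb_xm1_mul_xb_xp1, xb_h_mul_xb_h,
      xb_xm2_mul_xb_xp2, HA_sub_one_sq, bar_add, bar_sub, bar_sub, bar_smul, bar_smul, h2, h4,
      sub_mul _ _ (xt .xm1 * xt .xp1), bar_sub, bar_X_h_mul, smul_mul_assoc, bar_smul, one_mul]
    have k := mul_mul_of_eq HAinv_one_mul_HAinv_two (bar (xt .xm2 * xt .xp2))
    have k' := mul_mul_of_eq (HA_mul_HAinv 2) (bar (xt .xm2 * xt .xp2))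
    simp only [add_mul, sub_mul, mul_add, mul_sub, mul_smul_comm, k, k', ← Algebra.smul_def,
      smul_mul_assoc, one_mul, mul_assoc]
    push_cast
    module
  rw [h1, ← bar_coe]
  refine bar_congr (mem_doubleI.2 ⟨(2 : ℂ) • ((X .h - 1) * X .xm1) - (2 : ℂ) • (xt .h * xt .xm1)
      + (4 : ℂ) • (xt .xm2 * xt .xp1),
    -(2 : ℂ) • (xt .h * xt .xp1) - (4 : ℂ) • (xt .xm1 * (xt .xp2 + xt .xp1 * X .xp1)), ?_⟩)
  simp [scas, X_h, xt_h, xt_xm1, xt_xp1, X_xm1, X_xp1, xt_xm2, xt_xp2, mul_add, add_mul, mul_sub,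
    sub_mul, mul_assoc]
  module

/-! ### The action of the ghost center on `L(lam, mu)` -/

/-- A central element acts on a cyclic module by the scalar that it has on the generator. -/
theorem casA_comb_smul {z : A} (hz : ∀ a, z * a = a * z) {c : ℂ}
    (h1 : z • toLA lam mu 1 = c • toLA lam mu 1) (y : L lam mu) : z • y = c • y := by
  obtain ⟨a, rfl⟩ := toLA_surjective y
  rw [toLA_eq_smul, smul_smul, hz, mul_smul, h1, smul_algebra_smul_comm]

theorem HA_sub_one_smul_toLA_one (hmu : ∀ k : ℤ, mu ≠ k) :
    (HA - 1) • toLA lam mu 1 = mu • toLA lam mu 1 := by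
  rw [sub_smul, HA_smul_toLA_one hmu, one_smul]; module

theorem C1_smul (hmu : ∀ k : ℤ, mu ≠ k) (y : L lam mu) : C1 • y = (2 * lam * mu) • y := by
  refine casA_comb_smul (fun a => ?_) ?_ y
  · rw [C1_eq, smul_mul_assoc, mul_smul_comm, sub_mul, mul_sub, casA_commute, casA_commute]
  · have h2 : (2 : A) = algebraMap ℂ A 2 := (map_ofNat _ 2).symm
    rw [C1, mul_smul, xb_h_smul_toLA_one, mul_smul, smul_algebra_smul_comm,
      HA_sub_one_smul_toLA_one hmu, h2, algebraMap_smul, smul_smul, smul_smul]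

/-- Terms ending in a raising operator vanish on the generator whatever their coefficients, so `C2`
and `Q2` are evaluated alike. -/
theorem xb_products_smul (hmu : ∀ k : ℤ, mu ≠ k) (u v : A) :
    (u * xb .xm2 * xb .xp2 - v * xb .xm1 * xb .xp1) • toLA lam mu 1 = 0 ∧
    (xb .h * xb .h) • toLA lam mu 1 = lam ^ 2 • toLA lam mu 1 ∧
    ((HA - 1) ^ 2) • toLA lam mu 1 = mu ^ 2 • toLA lam mu 1 := by
  refine ⟨?_, ?_, ?_⟩
  · rw [sub_smul, mul_smul, mul_smul _ (xb .xp1), xb_xp1_smul_toLA_one, xb_xp2_smul_toLA_one,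
      smul_zero, smul_zero, sub_zero]
  · rw [mul_smul, xb_h_smul_toLA_one, smul_algebra_smul_comm, xb_h_smul_toLA_one, smul_smul, sq]
  · rw [sq, mul_smul, HA_sub_one_smul_toLA_one hmu, smul_algebra_smul_comm,
      HA_sub_one_smul_toLA_one hmu, smul_smul, sq]

theorem C2_smul (hmu : ∀ k : ℤ, mu ≠ k) (y : L lam mu) : C2 • y = (mu ^ 2 + lam ^ 2) • y := by
  refine casA_comb_smul (fun a => ?_) ?_ y
  · rw [C2_eq, smul_mul_assoc, mul_smul_comm, add_mul, mul_add, casA_commute, casA_commute]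
  · obtain ⟨h1, h2, h3⟩ := xb_products_smul (lam := lam) hmu (4 + 4 * HAinv 2) (2 - HAinv 1)
    rw [C2, add_smul, add_smul, h1, h2, h3]
    module

theorem Q2_smul (hmu : ∀ k : ℤ, mu ≠ k) {i : ZMod 2} {y : L lam mu} (hy : y ∈ gradeL lam mu i) :
    Q2 • y = ((mu ^ 2 - lam ^ 2) * (-1) ^ i.val) • y := by
  obtain ⟨a, ha, rfl⟩ := mem_gradeL.1 hy
  -- The sign for moving the product of Scasimirs past a homogeneous element becomes the parity
  -- operator.
  have h0 : Q2 * a = (-1 : ℂ) ^ i.val • (a * Q2) := by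
    obtain ⟨n, hn, rfl⟩ := mem_gradeA.1 ha
    rw [Q2_eq, ← map_mul, ← map_mul, ← map_smul]
    congr 1
    refine Subtype.ext ?_
    change scas 0 * scas 1 * (n : U) = (-1 : ℂ) ^ i.val • ((n : U) * (scas 0 * scas 1))
    rw [scas_mul_scas_supercommute, hn, smul_mul_assoc]
  obtain ⟨h1, h2, h3⟩ := xb_products_smul (lam := lam) hmu (4 * ((HA - 1) * HAinv 2))
    (2 * (HA - 2) + HAinv 1)
  have h4 : Q2 • toLA lam mu 1 = (mu ^ 2 - lam ^ 2) • toLA lam mu 1 := by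
    rw [Q2, add_smul, sub_smul _ (xb .h * xb .h), h1, h2, h3]
    module
  rw [toLA_eq_smul, smul_smul, h0, smul_assoc, mul_smul, h4, smul_algebra_smul_comm, smul_smul,
    mul_comm]

end Osp12

end

noncomputable section

namespace Osp12

/-! ### Weights -/

/-- Every generator is a vector of integral weight for `H`, and weights add under multiplication. -/
theorem mem_span_weight (u : U) :
    u ∈ Submodule.span ℂ {w : U | ∃ k : ℤ, X .h * w = w * (X .h + (k : U))} := by
  have key : ∀ {g : U} {l : ℤ}, X .h * g = g * (X .h + (l : U)) → ∀ u,
      u ∈ Submodule.span ℂ {w : U | ∃ k : ℤ, X .h * w = w * (X .h + (k : U))} →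
      g * u ∈ Submodule.span ℂ {w : U | ∃ k : ℤ, X .h * w = w * (X .h + (k : U))} := by
    intro g l hg u hu
    induction hu using Submodule.span_induction with
    | mem w hw =>
      obtain ⟨k, hk⟩ := hw
      refine Submodule.subset_span ⟨l + k, ?_⟩
      rw [← mul_assoc, hg, mul_assoc, add_mul, hk, (Int.cast_commute l w).eq, ← mul_add, mul_assoc]
      push_cast
      rw [add_assoc, add_comm (k : U)]
    | zero => rw [mul_zero]; exact zero_mem _
    | add w w' _ _ hw hw' => rw [mul_add]; exact add_mem hw hw'
    | smul c w _ hw => rw [mul_smul_comm]; exact Submodule.smul_mem _ c hw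
  refine U_induction (Submodule.span ℂ {w : U | ∃ k : ℤ, X .h * w = w * (X .h + (k : U))})
    (Submodule.subset_span ⟨0, by simp⟩)
    (fun i u hu => key (l := -1) ?_ u hu) (fun i u hu => key (l := 1) ?_ u hu)
    (fun i u hu => key (l := 0) ?_ u hu) (fun n u hu => key (l := 0) ?_ u hu) u
  · rw [mul_add, E_mul_X_h]; simp
  · rw [mul_add, X_h_mul_F]; simp
  · rw [X_h_mul_h]; simp
  · rw [X_h, add_mul, h_mul_hinv, h_mul_hinv]
    simp [mul_add]

theorem X_h_mul_xt_h : X .h * xt .h = xt .h * (X .h + ((0 : ℤ) : U)) := by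
  rw [xt_h, mul_sub, X_h_mul_h, X_h_mul_h, Int.cast_zero, add_zero, sub_mul]

theorem X_h_mul_xt_xp1 : X .h * xt .xp1 = xt .xp1 * (X .h + ((-1 : ℤ) : U)) := by
  rw [mul_add, xt_xp1, sub_mul, E_mul_X_h, E_mul_X_h]; push_cast; noncomm_ring

theorem X_h_mul_xt_xm1 : X .h * xt .xm1 = xt .xm1 * (X .h + ((1 : ℤ) : U)) := by
  rw [xt_xm1, mul_sub, X_h_mul_F, X_h_mul_F]; push_cast; noncomm_ring

theorem X_h_mul_xt_xp2 : X .h * xt .xp2 = xt .xp2 * (X .h + ((-2 : ℤ) : U)) := by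
  have key : ∀ i, X .h * (E i * E i) = E i * E i * (X .h + ((-2 : ℤ) : U)) := fun i => by
    rw [mul_add, mul_assoc (E i) (E i) (X .h), E_mul_X_h, mul_add, ← mul_assoc (E i) (X .h),
      E_mul_X_h]; push_cast; noncomm_ring
  rw [xt_xp2, mul_sub, key, key, sub_mul]

theorem X_h_mul_xt_xm2 : X .h * xt .xm2 = xt .xm2 * (X .h + ((2 : ℤ) : U)) := by
  have key : ∀ i, X .h * (F i * F i) = F i * F i * (X .h + ((2 : ℤ) : U)) := fun i => by
    rw [← mul_assoc, X_h_mul_F, add_mul, mul_assoc, X_h_mul_F]; push_cast; noncomm_ring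
  rw [xt_xm2, mul_sub, key, key, sub_mul]

/-! ### Highest weight modules -/

section HighestWeight

variable {V : Type*} [AddCommGroup V] [Module ℂ V] [Module A V] [IsScalarTower ℂ A V]

theorem HA_smul_bar_smul {u : U} {k : ℤ} (hu : X .h * u = u * (X .h + (k : U))) {nu : ℂ} {y : V}
    (hy : HA • y = nu • y) : HA • bar u • y = (nu + k) • bar u • y := by
  have hk : (k : A) • y = (k : ℂ) • y := by
    rw [← map_intCast (algebraMap ℂ A), algebraMap_smul]
  rw [smul_smul, HA_mul_bar hu, mul_smul, add_smul, hy, hk, ← add_smul, smul_algebra_smul_comm]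

/-- `v` is a highest weight vector of weights `lam` for `h̄` and `nu` for `H` that generates the
`A`-module `V`, and no `nu - k` with `k > 0` is an eigenvalue of `H` on `V`. -/
structure IsHighestWeightGenerator (lam nu : ℂ) (v : V) : Prop where
  ne_zero : v ≠ 0
  xp1_smul : xb .xp1 • v = 0
  xp2_smul : xb .xp2 • v = 0
  h_smul : xb .h • v = lam • v
  HA_smul : HA • v = nu • v
  exists_eq_smul : ∀ y : V, ∃ a : A, y = a • v
  eq_zero_of_low : ∀ (k : ℕ) (y : V), HA • y = (nu - (k + 1)) • y → y = 0

variable (V) in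
/-- The eigenspace of `H` for the eigenvalue `nu`. -/
def weightSpace (nu : ℂ) : Submodule ℂ V := (Algebra.lsmul ℂ ℂ V HA).eigenspace nu

theorem mem_weightSpace {nu : ℂ} {y : V} : y ∈ weightSpace V nu ↔ HA • y = nu • y := by
  rw [weightSpace, Module.End.mem_eigenspace_iff]; rfl

variable (V) in
/-- The sum of the eigenspaces of `H` for the eigenvalues `nu + k` with `k > 0`. -/
def lowerPart (nu : ℂ) : Submodule ℂ V := ⨆ k : ℕ, weightSpace V (nu + (k + 1))

namespace IsHighestWeightGenerator

variable {lam nu : ℂ} {v : V}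

/-- `H - n` is invertible in `A` and so cannot kill a nonzero vector. Hence the parameter `mu = nu -
1` is never an integer. -/
theorem nu_ne (hv : IsHighestWeightGenerator lam nu v) (n : ℤ) : nu ≠ n := by
  rintro rfl
  have h1 : (HAinv n * (HA - (n : A))) • v = v := by rw [HAinv_mul_HA_sub, one_smul]
  have hn : (n : A) • v = (n : ℂ) • v := by
    rw [← map_intCast (algebraMap ℂ A), algebraMap_smul]
  rw [mul_smul, sub_smul, hv.HA_smul, hn, sub_self, smul_zero] at h1
  exact hv.ne_zero h1.symm

theorem HAinv_smul (hv : IsHighestWeightGenerator lam nu v) (n : ℤ) :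
    HAinv n • v = (nu - n)⁻¹ • v := by
  have h1 : (HAinv n * (HA - (n : A))) • v = v := by rw [HAinv_mul_HA_sub, one_smul]
  have hn : (n : A) • v = (n : ℂ) • v := by
    rw [← map_intCast (algebraMap ℂ A), algebraMap_smul]
  rw [mul_smul, sub_smul, hv.HA_smul, hn, ← sub_smul, smul_algebra_smul_comm] at h1
  nth_rewrite 2 [← h1]
  rw [smul_smul, inv_mul_cancel₀ (sub_ne_zero.2 (hv.nu_ne n)), one_smul]

theorem dynScalars_smul (hv : IsHighestWeightGenerator lam nu v) {r : A} (hr : r ∈ dynScalars) :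
    ∃ c : ℂ, r • v = c • v := by
  induction hr using Algebra.adjoin_induction with
  | mem r hr =>
    rcases hr with rfl | ⟨n, rfl⟩
    · exact ⟨nu, hv.HA_smul⟩
    · exact ⟨_, hv.HAinv_smul n⟩
  | algebraMap c => exact ⟨c, algebraMap_smul A c v⟩
  | add r s _ _ hr hs =>
    obtain ⟨c, hc⟩ := hr
    obtain ⟨d, hd⟩ := hs
    exact ⟨c + d, by rw [add_smul, hc, hd, add_smul]⟩
  | mul r s _ _ hr hs =>
    obtain ⟨c, hc⟩ := hr
    obtain ⟨d, hd⟩ := hs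
    exact ⟨d * c, by rw [mul_smul, hd, smul_algebra_smul_comm, hc, smul_smul]⟩

theorem verma_smul (hv : IsHighestWeightGenerator lam nu v) {a : A} (ha : a ∈ vermaIdeal lam) :
    a • v = 0 := by
  obtain ⟨b, c, d, rfl⟩ := Submodule.mem_span_triple.1 ha
  simp only [smul_eq_mul, add_smul, mul_smul, sub_smul]
  rw [hv.xp1_smul, hv.xp2_smul, hv.h_smul, algebraMap_smul, sub_self]
  simp

/-- Weight elements of `U` move `v` to eigenvectors for `nu + k` with `k` an integer, and minimality
of `nu` kills those with `k < 0`. -/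
theorem iSup_weightSpace (hv : IsHighestWeightGenerator lam nu v) (y : V) :
    y ∈ ⨆ k : ℕ, weightSpace V (nu + k) := by
  obtain ⟨a, rfl⟩ := hv.exists_eq_smul y
  obtain ⟨u, rfl⟩ := bar_surjective a
  induction mem_span_weight u using Submodule.span_induction with
  | mem u hu =>
    obtain ⟨k, hk⟩ := hu
    have h1 := HA_smul_bar_smul hk hv.HA_smul
    obtain ⟨l, rfl | rfl⟩ := k.eq_nat_or_neg
    · exact Submodule.mem_iSup_of_mem l (mem_weightSpace.2 (by simpa using h1))
    · rcases l with _ | l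
      · exact Submodule.mem_iSup_of_mem 0 (mem_weightSpace.2 (by simpa using h1))
      · rw [hv.eq_zero_of_low l (bar u • v) (by rw [h1]; push_cast; ring_nf)]
        exact zero_mem _
  | zero => rw [bar_zero, zero_smul]; exact zero_mem _
  | add u w _ _ hu hw => rw [bar_add, add_smul]; exact add_mem hu hw
  | smul c u _ hu => rw [bar_smul, smul_assoc]; exact Submodule.smul_mem _ c hu

theorem bar_smul_mem_lowerPart (hv : IsHighestWeightGenerator lam nu v) {u : U} {l : ℕ}
    (hu : X .h * u = u * (X .h + ((l + 1 : ℕ) : ℤ))) (y : V) : bar u • y ∈ lowerPart V nu := by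
  induction hv.iSup_weightSpace y using Submodule.iSup_induction' with
  | mem k y hy =>
    have h1 := HA_smul_bar_smul hu (mem_weightSpace.1 hy)
    refine Submodule.mem_iSup_of_mem (k + l) (mem_weightSpace.2 ?_)
    rw [h1]; push_cast; ring_nf
  | zero => rw [smul_zero]; exact zero_mem _
  | add y z _ _ hy hz => rw [smul_add]; exact add_mem hy hz

theorem xb_h_smul_mem_lowerPart {y : V} (hy : y ∈ lowerPart V nu) :
    xb .h • y ∈ lowerPart V nu := by
  induction hy using Submodule.iSup_induction' with
  | mem k y hy =>
    have h1 := HA_smul_bar_smul X_h_mul_xt_h (mem_weightSpace.1 hy)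
    refine Submodule.mem_iSup_of_mem k (mem_weightSpace.2 ?_)
    rw [xb]
    simpa using h1
  | zero => rw [smul_zero]; exact zero_mem _
  | add y z _ _ hy hz => rw [smul_add]; exact add_mem hy hz

theorem HA_smul_mem_lowerPart {y : V} (hy : y ∈ lowerPart V nu) :
    HA • y ∈ lowerPart V nu := by
  induction hy using Submodule.iSup_induction' with
  | mem k y hy =>
    rw [mem_weightSpace.1 hy]
    exact Submodule.smul_mem _ _ (Submodule.mem_iSup_of_mem k hy)
  | zero => rw [smul_zero]; exact zero_mem _
  | add y z _ _ hy hz => rw [smul_add]; exact add_mem hy hz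

/-- In the ordered form of `a`, the `R`-part acts on `v` by a scalar, the Verma part kills `v`, and
the remaining terms have strictly larger weight. -/
theorem exists_eq_smul_add (hv : IsHighestWeightGenerator lam nu v) (y : V) :
    ∃ c : ℂ, ∃ z ∈ lowerPart V nu, y = c • v + z := by
  obtain ⟨a, rfl⟩ := hv.exists_eq_smul y
  obtain ⟨r, hr, b, c, d, hd, rfl⟩ := mem_orderedA.1 (orderedA_eq_top lam a)
  obtain ⟨k, hk⟩ := hv.dynScalars_smul hr
  refine ⟨k, xb .xm1 • b • v + xb .xm2 • c • v, add_mem ?_ ?_, ?_⟩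
  · exact hv.bar_smul_mem_lowerPart (l := 0) X_h_mul_xt_xm1 _
  · exact hv.bar_smul_mem_lowerPart (l := 1) X_h_mul_xt_xm2 _
  · rw [add_smul, add_smul, add_smul, hk, hv.verma_smul hd, mul_smul, mul_smul, add_zero, add_assoc]

theorem notMem_lowerPart (hv : IsHighestWeightGenerator lam nu v) : v ∉ lowerPart V nu := by
  intro h0
  have h1 := (Module.End.eigenspaces_iSupIndep (Algebra.lsmul ℂ ℂ V HA)) nu
  refine hv.ne_zero (Submodule.disjoint_def.1 h1 v (mem_weightSpace.2 hv.HA_smul) ?_)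
  refine (iSup_le fun k => ?_ : lowerPart V nu ≤ _) h0
  refine le_iSup₂_of_le (nu + (k + 1)) ?_ le_rfl
  intro h2
  have h3 : ((k + 1 : ℕ) : ℂ) = 0 := by push_cast; linear_combination h2
  exact k.succ_ne_zero (by exact_mod_cast h3)

/-- The coefficient of the highest weight vector. -/
theorem exists_functional (hv : IsHighestWeightGenerator lam nu v) :
    ∃ ψ : V →ₗ[ℂ] ℂ, ψ v = 1 ∧ ∀ y ∈ lowerPart V nu, ψ y = 0 := by
  obtain ⟨f, hf, hle⟩ := Submodule.exists_le_ker_of_notMem hv.notMem_lowerPart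
  refine ⟨(f v)⁻¹ • f, ?_, fun y hy => ?_⟩
  · rw [LinearMap.smul_apply, smul_eq_mul, inv_mul_cancel₀ hf]
  · rw [LinearMap.smul_apply, LinearMap.mem_ker.1 (hle hy), smul_zero]

/-- The functional on `A` that is induced by a functional on `V` and a vector of `V`. -/
def functional (ψ : V →ₗ[ℂ] ℂ) (v : V) : A →ₗ[ℂ] ℂ where
  toFun := fun a => ψ (a • v)
  map_add' := fun a b => by rw [add_smul, map_add]
  map_smul' := fun c a => by rw [smul_assoc, map_smul]; rfl

theorem functional_apply (ψ : V →ₗ[ℂ] ℂ) (a : A) : functional ψ v a = ψ (a • v) := rfl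

/-- The complement `lowerPart` of the line of `v` contains the images of `x̄_{-α}` and `x̄_{-2α}`
and is stable under `h̄` and `H`; hence `ψ` has the required eigenvalue properties. -/
theorem isHighestWeightFunctional (hv : IsHighestWeightGenerator lam nu v) {ψ : V →ₗ[ℂ] ℂ}
    (h1 : ψ v = 1) (h0 : ∀ y ∈ lowerPart V nu, ψ y = 0) :
    IsHighestWeightFunctional lam (nu - 1) (functional ψ v) where
  map_one := by rw [functional_apply, one_smul, h1]
  map_verma := fun a ha => by rw [functional_apply, hv.verma_smul ha, map_zero]
  map_xm1 := fun a => by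
    rw [functional_apply, mul_smul]
    exact h0 _ (hv.bar_smul_mem_lowerPart (l := 0) X_h_mul_xt_xm1 _)
  map_xm2 := fun a => by
    rw [functional_apply, mul_smul]
    exact h0 _ (hv.bar_smul_mem_lowerPart (l := 1) X_h_mul_xt_xm2 _)
  map_h := fun a => by
    obtain ⟨c, z, hz, h2⟩ := hv.exists_eq_smul_add (a • v)
    rw [functional_apply, functional_apply, mul_smul, h2, smul_add, smul_algebra_smul_comm,
      hv.h_smul, map_add, map_add, h0 _ hz, h0 _ (xb_h_smul_mem_lowerPart hz), map_smul, map_smul,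
      map_smul, h1]
    simp [mul_comm]
  map_dyn := fun a => by
    obtain ⟨c, z, hz, h2⟩ := hv.exists_eq_smul_add (a • v)
    have h3 : HA - 1 - algebraMap ℂ A (nu - 1) = HA - algebraMap ℂ A nu := by
      rw [map_sub, map_one]; abel
    rw [functional_apply, h3, mul_smul, h2, smul_add, sub_smul, sub_smul, algebraMap_smul,
      algebraMap_smul, smul_algebra_smul_comm, hv.HA_smul, smul_comm c nu, sub_self, zero_add,
      map_sub, h0 _ (HA_smul_mem_lowerPart hz), map_smul, h0 _ hz]
    simp

/-- A highest weight module on which the coefficient of the highest weight vector is nondegenerate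
is isomorphic to some `L(lam, mu)`. -/
theorem exists_equiv (hv : IsHighestWeightGenerator lam nu v) {ψ : V →ₗ[ℂ] ℂ}
    (h1 : ψ v = 1) (h0 : ∀ y ∈ lowerPart V nu, ψ y = 0)
    (hrad : ∀ y : V, (∀ b : A, ψ (b • y) = 0) → y = 0) :
    ∃ e : V ≃ₗ[A] L lam (nu - 1), ∀ a : A, e (a • v) = toLA lam (nu - 1) a := by
  have hmu : ∀ k : ℤ, nu - 1 ≠ k := fun k hk =>
    hv.nu_ne (k + 1) (by push_cast; linear_combination hk)
  -- Both kernels are the set of `a` with `ψ (b a v) = 0` for all `b`: on the side of `V` by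
  -- nondegeneracy, on the side of `L` by the functional criterion.
  have hker : LinearMap.ker (LinearMap.toSpanSingleton A V v) = LinearMap.ker (toLA lam (nu - 1)) := by
    ext a
    rw [LinearMap.mem_ker, LinearMap.mem_ker, LinearMap.toSpanSingleton_apply]
    have h2 := (hv.isHighestWeightFunctional h1 h0).toL_eq_zero_iff hmu a
    rw [toLA, LinearMap.comp_apply, h2]
    constructor
    · intro h3 b
      rw [functional_apply, mul_smul, h3, smul_zero, map_zero]
    · intro h3
      refine hrad _ fun b => ?_
      rw [smul_smul]
      exact h3 b
  have hsurj : Function.Surjective (LinearMap.toSpanSingleton A V v) := fun y => by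
    obtain ⟨a, rfl⟩ := hv.exists_eq_smul y
    exact ⟨a, rfl⟩
  let e₁ := (LinearMap.toSpanSingleton A V v).quotKerEquivOfSurjective hsurj
  let e₂ := (toLA lam (nu - 1)).quotKerEquivOfSurjective toLA_surjective
  refine ⟨e₁.symm.trans ((Submodule.quotEquivOfEq _ _ hker).trans e₂), fun a => ?_⟩
  have h2 : e₁.symm (a • v) = Submodule.Quotient.mk a := by
    rw [LinearEquiv.symm_apply_eq]; rfl
  rw [LinearEquiv.trans_apply, h2]
  rfl

end IsHighestWeightGenerator

/-! ### Existence of highest weight vectors -/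

/-- There are finitely many eigenvalues. Minimizing the real part suffices, since the excluded
eigenvalues differ from `nu` by positive integers. -/
theorem exists_minimal_weight [FiniteDimensional ℂ V] [Nontrivial V] :
    ∃ nu : ℂ, weightSpace V nu ≠ ⊥ ∧
      ∀ (k : ℕ) (y : V), HA • y = (nu - (k + 1)) • y → y = 0 := by
  obtain ⟨c, hc⟩ := Module.End.exists_eigenvalue (Algebra.lsmul ℂ ℂ V HA)
  obtain ⟨nu, hnu, hmin⟩ := Set.exists_min_image _ Complex.re
    (Module.End.finite_hasEigenvalue (Algebra.lsmul ℂ ℂ V HA)) ⟨c, hc⟩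
  refine ⟨nu, hnu, fun k y hy => ?_⟩
  by_contra h0
  have h1 := hmin _ (Module.End.hasEigenvalue_of_hasEigenvector (x := y)
    ⟨Module.End.mem_eigenspace_iff.2 hy, h0⟩)
  simp only [Complex.sub_re, Complex.add_re, Complex.natCast_re, Complex.one_re] at h1
  have : (0 : ℝ) ≤ k := k.cast_nonneg
  linarith

/-- A nonzero subspace of a minimal weight space that is stable under `h̄` contains a highest
weight vector. -/
theorem exists_highest_weight_vector [FiniteDimensional ℂ V] {nu : ℂ}
    (hlow : ∀ (k : ℕ) (y : V), HA • y = (nu - (k + 1)) • y → y = 0) {G : Submodule ℂ V}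
    (hG : ∀ y ∈ G, xb .h • y ∈ G) (hne : weightSpace V nu ⊓ G ≠ ⊥) :
    ∃ v ∈ G, ∃ lam : ℂ, v ≠ 0 ∧ xb .xp1 • v = 0 ∧ xb .xp2 • v = 0 ∧ xb .h • v = lam • v ∧
      HA • v = nu • v := by
  have hstab : ∀ y ∈ weightSpace V nu ⊓ G, Algebra.lsmul ℂ ℂ V (xb .h) y ∈ weightSpace V nu ⊓ G := by
    rintro y ⟨hy, hyG⟩
    refine ⟨mem_weightSpace.2 ?_, hG y hyG⟩
    have := HA_smul_bar_smul X_h_mul_xt_h (mem_weightSpace.1 hy)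
    rw [Algebra.lsmul_coe, xb]
    simpa using this
  have : Nontrivial ↥(weightSpace V nu ⊓ G) := Submodule.nontrivial_iff_ne_bot.2 hne
  obtain ⟨lam, hlam⟩ := Module.End.exists_eigenvalue
    ((Algebra.lsmul ℂ ℂ V (xb .h)).restrict hstab)
  obtain ⟨⟨v, hv, hvG⟩, hve, hv0⟩ := hlam.exists_hasEigenvector
  rw [Module.End.mem_eigenspace_iff] at hve
  have hv1 := mem_weightSpace.1 hv
  refine ⟨v, hvG, lam, fun h0 => hv0 (Subtype.ext h0), ?_, ?_, congrArg Subtype.val hve, hv1⟩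
  -- With the sign convention here `x̄_α` and `x̄_{2α}` decrease the eigenvalue of `H` by `1` and
  -- `2`, below the minimal one.
  · refine hlow 0 _ ?_
    have := HA_smul_bar_smul X_h_mul_xt_xp1 hv1
    rw [xb, this]; push_cast; ring_nf
  · refine hlow 1 _ ?_
    have := HA_smul_bar_smul X_h_mul_xt_xp2 hv1
    rw [xb, this]; push_cast; ring_nf

theorem finrank_of_equiv {lam mu : ℂ} (hmu : ∀ k : ℤ, mu ≠ k) [FiniteDimensional ℂ V]
    (e : V ≃ₗ[A] L lam mu) :
    Odd (Module.finrank ℂ V) ∧ lam ^ 2 = (mu + (Module.finrank ℂ V : ℂ)) ^ 2 := by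
  have hL : FiniteDimensional ℂ (L lam mu) := Module.Finite.equiv (e.restrictScalars ℂ)
  obtain ⟨n, hn, h1⟩ := exists_odd_of_finiteDimensional hmu hL
  rw [(e.restrictScalars ℂ).finrank_eq, (finrank_L hmu hn h1).2]
  exact ⟨hn, h1⟩

theorem exists_equiv_of_isSimpleModule [FiniteDimensional ℂ V] (hV : IsSimpleModule A V) :
    ∃ lam mu : ℂ, (∀ k : ℤ, mu ≠ k) ∧ Nonempty (V ≃ₗ[A] L lam mu) := by
  have : Nontrivial V := IsSimpleModule.nontrivial A V
  obtain ⟨nu, hnu, hlow⟩ := exists_minimal_weight (V := V)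
  obtain ⟨v, -, lam, hv0, h1, h2, h3, h4⟩ := exists_highest_weight_vector hlow (G := ⊤)
    (fun _ _ => Submodule.mem_top) (by rwa [inf_top_eq])
  have hv : IsHighestWeightGenerator lam nu v := ⟨hv0, h1, h2, h3, h4, fun y => by
    obtain ⟨a, ha⟩ := IsSimpleModule.toSpanSingleton_surjective A hv0 y
    exact ⟨a, ha.symm⟩, hlow⟩
  obtain ⟨ψ, hψ1, hψ0⟩ := hv.exists_functional
  -- In a simple module every nonzero vector can be moved to `v`, where `ψ` equals `1`, so
  -- nondegeneracy is automatic.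
  obtain ⟨e, -⟩ := hv.exists_equiv hψ1 hψ0 (fun y hy => by
    by_contra hy0
    obtain ⟨b, hb⟩ := IsSimpleModule.toSpanSingleton_surjective A hy0 v
    rw [LinearMap.toSpanSingleton_apply] at hb
    have := hy b
    rw [hb, hψ1] at this
    exact one_ne_zero this)
  exact ⟨lam, nu - 1, fun k hk => hv.nu_ne (k + 1) (by push_cast; linear_combination hk), ⟨e⟩⟩

end HighestWeight

end Osp12

end

noncomputable section

namespace Osp12

/-! ### Irreducible supermodules -/

theorem exists_gradeA_add_of (k : ZMod 2) (a : A) :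
    ∃ a₀ ∈ gradeA k, ∃ a₁ ∈ gradeA (k + 1), a = a₀ + a₁ := by
  obtain ⟨a₀, h0, a₁, h1, rfl⟩ := exists_gradeA_add a
  rcases (show ∀ k : ZMod 2, k = 0 ∨ k = 1 by decide) k with rfl | rfl
  · exact ⟨a₀, h0, a₁, h1, rfl⟩
  · exact ⟨a₁, h1, a₀, h0, add_comm _ _⟩

/-- Functionals as in `IsHighestWeightFunctional` are even. -/
theorem IsHighestWeightFunctional.eq_zero_of_odd {lam mu : ℂ} {χ : A →ₗ[ℂ] ℂ}
    (hmu : ∀ k : ℤ, mu ≠ k) (hχ : IsHighestWeightFunctional lam mu χ) {a : A}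
    (ha : a ∈ gradeA 1) : χ a = 0 := by
  -- All functionals for the same `(lam, mu)` have the same kernel, so it suffices to test the
  -- leading coefficient in `W`, which sits in even degree.
  have hW := isHighestWeightFunctional_chi (weights_add_ne (lam := lam) hmu) weights_sub weights_add
  rw [← hχ.toShapTarget_mem_iff hmu, hW.toShapTarget_mem_iff hmu, chi_apply]
  have h1 := congrFun (congrFun (parityW_evA (weights_add_ne (lam := lam) hmu) ha) 0) 0
  have h2 : (1 : ZMod 2).val = 1 := rfl
  rw [parityW_apply, h2, Pi.smul_apply, Pi.smul_apply] at h1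
  simpa [self_eq_neg] using h1

section Super

variable {V : Type*} [AddCommGroup V] [Module ℂ V] [Module A V]
  {gr : ZMod 2 → Submodule ℂ V}

namespace IsSupermodule

theorem isCompl (hgr : IsSupermodule gr) : IsCompl (gr 0) (gr 1) :=
  (DirectSum.isInternal_submodule_iff_isCompl gr (i := 0) (j := 1) (by decide) (by
    ext i
    simp only [Set.mem_univ, true_iff, Set.mem_insert_iff, Set.mem_singleton_iff]
    revert i; decide)).1 hgr.internal

theorem disjoint (hgr : IsSupermodule gr) (i : ZMod 2) : Disjoint (gr i) (gr (i + 1)) := by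
  rcases (show ∀ k : ZMod 2, k = 0 ∨ k = 1 by decide) i with rfl | rfl
  · exact hgr.isCompl.disjoint
  · exact hgr.isCompl.disjoint.symm

theorem exists_add (hgr : IsSupermodule gr) (y : V) : ∃ y₀ ∈ gr 0, ∃ y₁ ∈ gr 1, y₀ + y₁ = y :=
  Submodule.mem_sup.1 (by rw [hgr.isCompl.sup_eq_top]; exact Submodule.mem_top)

theorem even_smul_mem (hgr : IsSupermodule gr) {a : A} (ha : a ∈ gradeA 0) {i : ZMod 2} {y : V}
    (hy : y ∈ gr i) : a • y ∈ gr i := by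
  simpa using hgr.smul_mem 0 i a ha y hy

/-- A nonzero eigenspace of `H` contains a nonzero homogeneous element. -/
theorem exists_weightSpace_inf_ne_bot [IsScalarTower ℂ A V] (hgr : IsSupermodule gr) {nu : ℂ}
    (hne : weightSpace V nu ≠ ⊥) : ∃ i, weightSpace V nu ⊓ gr i ≠ ⊥ := by
  obtain ⟨y, hy, hy0⟩ := Submodule.exists_mem_ne_zero_of_ne_bot hne
  obtain ⟨y₀, h0, y₁, h1, rfl⟩ := hgr.exists_add y
  rw [mem_weightSpace, smul_add, smul_add] at hy
  have h2 : HA • y₀ - nu • y₀ = nu • y₁ - HA • y₁ := by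
    rw [sub_eq_sub_iff_add_eq_add, hy, add_comm]
  have m0 : HA • y₀ - nu • y₀ ∈ gr 0 :=
    sub_mem (hgr.even_smul_mem HA_mem_gradeA h0) (Submodule.smul_mem _ nu h0)
  have m1 : nu • y₁ - HA • y₁ ∈ gr 1 :=
    sub_mem (Submodule.smul_mem _ nu h1) (hgr.even_smul_mem HA_mem_gradeA h1)
  have e0 : HA • y₀ - nu • y₀ = 0 :=
    Submodule.disjoint_def.1 hgr.isCompl.disjoint _ m0 (by rw [h2]; exact m1)
  have e1 : nu • y₁ - HA • y₁ = 0 := by rw [← h2, e0]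
  by_cases hz : y₀ = 0
  · refine ⟨1, (Submodule.ne_bot_iff _).2 ⟨y₁, ⟨mem_weightSpace.2 (sub_eq_zero.1 e1).symm, h1⟩, ?_⟩⟩
    rintro rfl
    exact hy0 (by rw [hz, add_zero])
  · exact ⟨0, (Submodule.ne_bot_iff _).2 ⟨y₀, ⟨mem_weightSpace.2 (sub_eq_zero.1 e0), h0⟩, hz⟩⟩

/-- The homogeneous components of `a v`, for homogeneous `v`, lie in `A v`. -/
theorem exists_homogeneous_parts (hgr : IsSupermodule gr) {i : ZMod 2} {v : V} (hv : v ∈ gr i)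
    {a₀ a₁ : A} (h0 : a₀ ∈ gradeA 0) (h1 : a₁ ∈ gradeA 1) {W : Submodule A V}
    (m0 : a₀ • v ∈ W) (m1 : a₁ • v ∈ W) :
    ∃ w₀ ∈ W, ∃ w₁ ∈ W, w₀ ∈ gr 0 ∧ w₁ ∈ gr 1 ∧ (a₀ + a₁) • v = w₀ + w₁ := by
  have g0 := hgr.smul_mem 0 i a₀ h0 v hv
  have g1 := hgr.smul_mem 1 i a₁ h1 v hv
  rcases (show ∀ k : ZMod 2, k = 0 ∨ k = 1 by decide) i with rfl | rfl
  · exact ⟨_, m0, _, m1, g0, g1, add_smul _ _ _⟩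
  · exact ⟨_, m1, _, m0, g1, g0, by rw [add_smul, add_comm]⟩

/-- The component of `a` of the wrong parity sends `v` into the intersection of the two homogeneous
parts of `V`, hence to `0`, and can be dropped. -/
theorem exists_homogeneous_eq_smul (hgr : IsSupermodule gr) {i j : ZMod 2} {v : V} (hv : v ∈ gr i)
    {a : A} (hy : a • v ∈ gr j) : ∃ b ∈ gradeA (j + i), b • v = a • v := by
  obtain ⟨a₀, h0, a₁, h1, rfl⟩ := exists_gradeA_add_of (j + i) a
  refine ⟨a₀, h0, ?_⟩
  have g0 := hgr.smul_mem _ i a₀ h0 v hv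
  have g1 := hgr.smul_mem _ i a₁ h1 v hv
  rw [(by decide : ∀ i j : ZMod 2, j + i + i = j) i j] at g0
  rw [(by decide : ∀ i j : ZMod 2, j + i + 1 + i = j + 1) i j] at g1
  rw [add_smul] at hy ⊢
  have : a₁ • v = 0 := Submodule.disjoint_def.1 (hgr.disjoint j) _
    ((Submodule.add_mem_iff_right _ g0).1 hy) g1
  rw [this, add_zero]

end IsSupermodule

/-- Irreducibility is available for graded submodules only, so both `A v` and the radical of the
functional must be shown to be graded. -/
theorem exists_equiv_of_isSuperIrreducible [IsScalarTower ℂ A V] [FiniteDimensional ℂ V] (hV : IsSuperIrreducible gr) :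
    ∃ lam mu : ℂ, (∀ k : ℤ, mu ≠ k) ∧ ∃ (e : V ≃ₗ[A] L lam mu) (s : ZMod 2),
      ∀ i : ZMod 2, ∀ v ∈ gr i, e v ∈ gradeL lam mu (i + s) := by
  obtain ⟨hgr, hnt, hirr⟩ := hV
  obtain ⟨nu, hnu, hlow⟩ := exists_minimal_weight (V := V)
  obtain ⟨i, hi⟩ := hgr.exists_weightSpace_inf_ne_bot hnu
  obtain ⟨v, hvi, lam, hv0, h1, h2, h3, h4⟩ := exists_highest_weight_vector hlow
    (fun y hy => hgr.even_smul_mem xb_h_mem_gradeA hy) hi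
  have hgen : ∀ y : V, ∃ a : A, y = a • v := by
    intro y
    have htop : Submodule.span A {v} = ⊤ := by
      refine (hirr _ fun w hw => ?_).resolve_left fun h0 => hv0 ?_
      · obtain ⟨a, rfl⟩ := Submodule.mem_span_singleton.1 hw
        obtain ⟨a₀, m0, a₁, m1, rfl⟩ := exists_gradeA_add a
        exact hgr.exists_homogeneous_parts hvi m0 m1
          (Submodule.smul_mem _ _ (Submodule.mem_span_singleton_self v))
          (Submodule.smul_mem _ _ (Submodule.mem_span_singleton_self v))
      · exact Submodule.span_singleton_eq_bot.1 h0
    obtain ⟨a, ha⟩ := Submodule.mem_span_singleton.1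
      (by rw [htop]; exact Submodule.mem_top : y ∈ Submodule.span A {v})
    exact ⟨a, ha.symm⟩
  have hv : IsHighestWeightGenerator lam nu v := ⟨hv0, h1, h2, h3, h4, hgen, hlow⟩
  have hmu : ∀ k : ℤ, nu - 1 ≠ k := fun k hk =>
    hv.nu_ne (k + 1) (by push_cast; linear_combination hk)
  obtain ⟨ψ, hψ1, hψ0⟩ := hv.exists_functional
  have hodd : ∀ a ∈ gradeA 1, ψ (a • v) = 0 := fun a ha =>
    (hv.isHighestWeightFunctional hψ1 hψ0).eq_zero_of_odd hmu ha
  let rad : Submodule A V :=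
    { carrier := {y | ∀ b : A, ψ (b • y) = 0}
      zero_mem' := fun b => by rw [smul_zero, map_zero]
      add_mem' := fun hy hz b => by rw [smul_add, map_add, hy b, hz b, add_zero]
      smul_mem' := fun c y hy b => by rw [smul_smul]; exact hy _ }
  have hrad : rad = ⊥ := by
    refine (hirr rad fun w hw => ?_).resolve_right fun htop => ?_
    · obtain ⟨a, rfl⟩ := hgen w
      obtain ⟨a₀, m0, a₁, m1, rfl⟩ := exists_gradeA_add a
      have hw' : ∀ b : A, ψ ((b * a₀) • v) + ψ ((b * a₁) • v) = 0 := fun b => by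
        rw [← map_add, ← add_smul, ← mul_add, mul_smul]
        exact hw b
      -- Odd elements contribute nothing to `ψ`, so only the even part `b₀` pairs with `a₀`; there
      -- the odd product `b₀ * a₁` vanishes and isolates `b₀ * a₀`.
      have key : ∀ b, ψ ((b * a₀) • v) = 0 := by
        intro b
        obtain ⟨b₀, n0, b₁, n1, rfl⟩ := exists_gradeA_add b
        have t1 : ψ ((b₁ * a₀) • v) = 0 :=
          hodd _ (add_zero (1 : ZMod 2) ▸ gradeA_mul n1 m0)
        have t2 : ψ ((b₀ * a₁) • v) = 0 :=
          hodd _ (zero_add (1 : ZMod 2) ▸ gradeA_mul n0 m1)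
        have t3 := hw' b₀
        rw [t2, add_zero] at t3
        rw [add_mul, add_smul, map_add, t1, t3, add_zero]
      refine hgr.exists_homogeneous_parts hvi m0 m1 (fun b => ?_) (fun b => ?_)
      · rw [smul_smul]; exact key b
      · have := hw' b
        rw [key b, zero_add] at this
        rw [smul_smul]; exact this
    · have h5 : v ∈ rad := by rw [htop]; exact Submodule.mem_top
      have h6 := h5 1
      rw [one_smul, hψ1] at h6
      exact one_ne_zero h6
  obtain ⟨e, he⟩ := hv.exists_equiv hψ1 hψ0 (fun y hy => by
    have h5 : y ∈ rad := hy
    rwa [hrad, Submodule.mem_bot] at h5)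
  -- The shift of parity is the parity `i` of `v`, because the generator of `L(lam, mu)` is even.
  refine ⟨lam, nu - 1, hmu, e, i, fun j y hy => ?_⟩
  obtain ⟨a, rfl⟩ := hgen y
  obtain ⟨b, hb, hba⟩ := hgr.exists_homogeneous_eq_smul hvi hy
  rw [← hba, he]
  exact mem_gradeL.2 ⟨b, hb, rfl⟩

end Super

end Osp12

end

theorem theorem2 :
    -- irreducibility
    (∀ lam mu : ℂ, (∀ k : ℤ, mu ≠ k) → IsSimpleModule Osp12.A (Osp12.L lam mu)) ∧
    -- finite-dimensionality and dimension
    (∀ lam mu : ℂ, (∀ k : ℤ, mu ≠ k) →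
      (FiniteDimensional ℂ (Osp12.L lam mu) ↔
        ∃ n : ℕ, Odd n ∧ lam ^ 2 = (mu + n) ^ 2) ∧
      (∀ n : ℕ, Odd n → lam ^ 2 = (mu + n) ^ 2 →
        FiniteDimensional ℂ (Osp12.L lam mu) ∧
          Module.finrank ℂ (Osp12.L lam mu) = n ∧ lam ≠ 0)) ∧
    -- classification of the finite-dimensional irreducible modules
    (∀ (V : Type*) [AddCommGroup V] [Module ℂ V] [Module Osp12.A V]
      [IsScalarTower ℂ Osp12.A V] [FiniteDimensional ℂ V],
      IsSimpleModule Osp12.A V →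
        Odd (Module.finrank ℂ V) ∧
        ∃! p : ℂ × ℂ, (∀ k : ℤ, p.2 ≠ k) ∧
          p.1 ^ 2 = (p.2 + (Module.finrank ℂ V : ℂ)) ^ 2 ∧
          Nonempty (V ≃ₗ[Osp12.A] Osp12.L p.1 p.2)) ∧
    -- classification of the finite-dimensional irreducible supermodules
    (∀ (V : Type*) [AddCommGroup V] [Module ℂ V] [Module Osp12.A V]
      [IsScalarTower ℂ Osp12.A V] [FiniteDimensional ℂ V]
      (gr : ZMod 2 → Submodule ℂ V),
      Osp12.IsSuperIrreducible gr →
        Odd (Module.finrank ℂ V) ∧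
        ∃! p : ℂ × ℂ, (∀ k : ℤ, p.2 ≠ k) ∧
          p.1 ^ 2 = (p.2 + (Module.finrank ℂ V : ℂ)) ^ 2 ∧
          ∃ (e : V ≃ₗ[Osp12.A] Osp12.L p.1 p.2) (s : ZMod 2),
            ∀ i : ZMod 2, ∀ v ∈ gr i, e v ∈ Osp12.gradeL p.1 p.2 (i + s)) ∧
    -- the parity grading, and the action of the generators of the ghost center
    (∀ lam mu : ℂ, (∀ k : ℤ, mu ≠ k) →
      Osp12.IsSupermodule (Osp12.gradeL lam mu) ∧
      (∀ v : Osp12.L lam mu, Osp12.C1 • v = (2 * lam * mu) • v) ∧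
      (∀ v : Osp12.L lam mu, Osp12.C2 • v = (mu ^ 2 + lam ^ 2) • v) ∧
      (∀ i : ZMod 2, ∀ v ∈ Osp12.gradeL lam mu i,
        Osp12.Q2 • v = ((mu ^ 2 - lam ^ 2) * (-1) ^ i.val) • v)) := by
  refine ⟨fun lam mu hmu => Osp12.isSimpleModule_L hmu, fun lam mu hmu => ⟨⟨?_, ?_⟩, ?_⟩, ?_, ?_, ?_⟩
  · exact Osp12.exists_odd_of_finiteDimensional hmu
  · rintro ⟨n, hn, h⟩
    exact (Osp12.finrank_L hmu hn h).1
  · intro n hn h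
    exact ⟨(Osp12.finrank_L hmu hn h).1, (Osp12.finrank_L hmu hn h).2, Osp12.lam_ne_zero hmu h⟩
  · intro V _ _ _ _ _ hV
    obtain ⟨lam, mu, hmu, ⟨e⟩⟩ := Osp12.exists_equiv_of_isSimpleModule hV
    obtain ⟨hodd, hdim⟩ := Osp12.finrank_of_equiv hmu e
    refine ⟨hodd, (lam, mu), ⟨hmu, hdim, ⟨e⟩⟩, ?_⟩
    rintro ⟨lam', mu'⟩ ⟨hmu', -, ⟨e'⟩⟩
    obtain ⟨h1, h2⟩ := Osp12.eq_of_equiv hmu' hmu (e'.symm.trans e)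
    exact Prod.ext h1 h2
  · intro V _ _ _ _ _ gr hV
    obtain ⟨lam, mu, hmu, e, s, he⟩ := Osp12.exists_equiv_of_isSuperIrreducible hV
    obtain ⟨hodd, hdim⟩ := Osp12.finrank_of_equiv hmu e
    refine ⟨hodd, (lam, mu), ⟨hmu, hdim, e, s, he⟩, ?_⟩
    -- Parity is not needed for uniqueness: the ungraded isomorphism already determines the pair.
    rintro ⟨lam', mu'⟩ ⟨hmu', -, e', -, -⟩
    obtain ⟨h1, h2⟩ := Osp12.eq_of_equiv hmu' hmu (e'.symm.trans e)
    exact Prod.ext h1 h2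
  · intro lam mu hmu
    exact ⟨Osp12.isSupermodule_gradeL hmu, Osp12.C1_smul hmu, Osp12.C2_smul hmu,
      fun i v hv => Osp12.Q2_smul hmu hv⟩
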